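/- **Lemma (optimal terminal wealth).** Let $(\Omega,\mathcal F,(\mathcal F_t)_{t\ge 0},P)$ be a filtered probability space carrying a standard one-dimensional $(\mathcal F_t)$-Brownian motion $W$. Let $a>b$, $\gamma:=a-b$, $r\in\mathbb R$, $s_0>0$, $T>0$. Let $\mu$ be an $\mathcal F_0$-measurable random variable, independent of $W$, with values in $\{a,b\}$ almost surely and $0<P(\mu=a)<1$. Let $S$ be the continuous adapted process solving, on $[0,T]$, $$dS_t=\mu S_t\,dt+S_t\,dW_t,\qquad S_0=s_0 .$$ Let $\mathcal G_t:=\sigma(S_s: s\le t)$, let $\pi_t:=P(\mu=a\mid\mathcal G_t)$, $0\le t\le T$ (a jointly measurable version exists; let $\pi$ be any such version), let $$\nu_t:=\log S_t-\int_0^t\bigl(b-\tfrac12+\gamma\pi_s\bigr)ds$$ be the innovation process, and put $$\rho_T:=\exp\Bigl(-\int_0^T(b-r+\gamma\pi_s)\,d\nu_s-\int_0^T\bigl(r+\tfrac12(b-r+\gamma\pi_s)^2\bigr)ds\Bigr),$$ where $d\nu$ denotes the Itô integral in the filtration $(\mathcal G_t)$. Here and in the equation for $S$, the Itô integral of $H$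 with $E\int_0^t|H_s|^2ds<\infty$ is the $L^2(P)$-limit of the integrals of bounded adapted elementary processes converging to $H$ in $L^2(dt\times P)$. Then the Itô integral in the definition of $\rho_T$ exists, $\rho_T$ is $\mathcal G_T$-measurable up to a $P$-null set, $\rho_T\in L^2(P)$, and $\operatorname{Var}(\rho_T)>0$. Let $\mathbb H:=L^2(\Omega,\mathcal G_T,P)$ with $\langle X,Y\rangle_{\mathbb H}=E(XY)$. For all $z,y_0\in\mathbb R$ (in particular for every initial wealth $y_0>0$), the problem $$\text{minimize } E(v-z)^2\ \text{ over } v\in\mathbb H\ \text{ subject to } E v=z,\quad E(\rho_T v)=y_0$$ has a solution, unique up to $P$-null sets, namely $$v=\frac{z\,E\rho_T^2-y_0\,E\rho_T+(y_0-z\,E\rho_T)\,\rho_T}{\operatorname{Var}(\rho_T)} .$$ With $\alpha=1$ and $\beta=\rho_T$ in $\mathbb H$ this is $$v=\frac{(z\langle\beta,\beta\rangle_{\mathbb H}-y_0\langle\alpha,\beta\rangle_{\mathbb H})\,\alpha+(-z\langle\alpha,\beta\rangle_{\mathbb H}+y_0\langle\alpha,\alpha\rangle_{\mathbb H})\,\beta}{\langle\alpha,\alpha\rangle_{\mathbb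 H}\langle\beta,\beta\rangle_{\mathbb H}-\langle\alpha,\beta\rangle_{\mathbb H}^2},$$ and $v$ is the orthogonal projection of $0$ onto the affine set $\{f\in\mathbb H:\ E f=z,\ E(\rho_T f)=y_0\}$. -/

import Mathlib

open MeasureTheory ProbabilityTheory Filter Topology
open scoped NNReal ENNReal

namespace MeanVariance

variable {Ω : Type*} {mΩ : MeasurableSpace Ω}

/-- A bounded elementary process `∑_{i<n} ξ_i 1_{(t_i, t_{i+1}]}` with `t_0 ≤ t_1 ≤ ...` and
`ξ_i` bounded and measurable with respect to the information at time `t_i`. -/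
structure ElementaryProcess (F : Filtration ℝ≥0 mΩ) where
  n : ℕ
  time : ℕ → ℝ≥0
  monotone_time : Monotone time
  coef : ℕ → Ω → ℝ
  measurable_coef : ∀ i, StronglyMeasurable[F (time i)] (coef i)
  bounded_coef : ∀ i, ∃ C : ℝ, ∀ ω, |coef i ω| ≤ C

/-- The value of the elementary process at time `s`. -/
noncomputable def ElementaryProcess.eval {F : Filtration ℝ≥0 mΩ} (K : ElementaryProcess F)
    (s : ℝ≥0) (ω : Ω) : ℝ :=
  ∑ i ∈ Finset.range K.n,
    (Set.Ioc (K.time i) (K.time (i + 1))).indicator (fun _ => K.coef i ω) s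

/-- The stochastic integral over `[0, t]` of an elementary process against the process `B`. -/
noncomputable def ElementaryProcess.integral {F : Filtration ℝ≥0 mΩ} (K : ElementaryProcess F)
    (B : ℝ≥0 → Ω → ℝ) (t : ℝ≥0) (ω : Ω) : ℝ :=
  ∑ i ∈ Finset.range K.n,
    K.coef i ω * (B (min (K.time (i + 1)) t) ω - B (min (K.time i) t) ω)

/-- `X` is (a version of) the Itô integral `∫_0^t H_s dB_s` with respect to the filtration `F`:
there are elementary `F`-processes `K_n` with `E ∫_0^t |K_n - H|² ds → 0` whose elementary
integrals converge to `X` in `L²(P)`. -/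
structure IsItoIntegral (P : Measure Ω) (F : Filtration ℝ≥0 mΩ) (B : ℝ≥0 → Ω → ℝ) (t : ℝ≥0)
    (H : ℝ≥0 → Ω → ℝ) (X : Ω → ℝ) : Prop where
  aestronglyMeasurable_integrand :
    AEStronglyMeasurable (fun p : ℝ × Ω => H p.1.toNNReal p.2)
      ((volume.restrict (Set.Ioc 0 (t : ℝ))).prod P)
  memLp : MemLp X 2 P
  exists_approx : ∃ K : ℕ → ElementaryProcess F,
    Tendsto (fun n => eLpNorm
      (fun p : ℝ × Ω => (K n).eval p.1.toNNReal p.2 - H p.1.toNNReal p.2) 2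
      ((volume.restrict (Set.Ioc 0 (t : ℝ))).prod P)) atTop (𝓝 0) ∧
    Tendsto (fun n => eLpNorm (fun ω => (K n).integral B t ω - X ω) 2 P) atTop (𝓝 0)

/-- `W` is a standard one-dimensional Brownian motion with respect to the filtration `F`. -/
structure IsFiltrationBrownian (P : Measure Ω) (F : Filtration ℝ≥0 mΩ) (W : ℝ≥0 → Ω → ℝ) :
    Prop where
  isBrownian : IsBrownianReal W P
  adapted : StronglyAdapted F W
  indep_increments : ∀ s t : ℝ≥0, s ≤ t →
    Indep (MeasurableSpace.comap (fun ω => W t ω - W s ω) inferInstance) (F s) P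

/-- The continuous `F`-adapted process `S` solves `dS_t = μ S_t dt + S_t dW_t` on `[0, T]`
with `S_0 = s₀`. -/
structure IsStockPrice (P : Measure Ω) (F : Filtration ℝ≥0 mΩ) (W : ℝ≥0 → Ω → ℝ) (μ : Ω → ℝ)
    (s₀ : ℝ) (T : ℝ≥0) (S : ℝ≥0 → Ω → ℝ) : Prop where
  adapted : StronglyAdapted F S
  continuous_paths : ∀ᵐ ω ∂P, ContinuousOn (fun t => S t ω) (Set.Icc 0 T)
  sde : ∀ t ≤ T, IsItoIntegral P F W t S
    (fun ω => S t ω - s₀ - ∫ s in (0 : ℝ)..t, μ ω * S s.toNNReal ω)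

/-- The observation filtration `𝒢_t = σ(S_s : s ≤ t)`. -/
def observation {F : Filtration ℝ≥0 mΩ} {S : ℝ≥0 → Ω → ℝ} (hS : StronglyAdapted F S) :
    Filtration ℝ≥0 mΩ :=
  Filtration.natural S (fun t => (hS t).mono (F.le t))

/-- `π` is (a jointly measurable version of) the posterior probability process
`π_t = P(μ = a | 𝒢_t)`, `t ∈ [0, T]`. -/
structure IsPosterior (P : Measure Ω) (G : Filtration ℝ≥0 mΩ) (μ : Ω → ℝ) (a : ℝ) (T : ℝ≥0)
    (π : ℝ≥0 → Ω → ℝ) : Prop where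
  measurable : Measurable (Function.uncurry π)
  ae_eq_condExp : ∀ t ≤ T, π t =ᵐ[P] P[(μ ⁻¹' {a}).indicator (fun _ => (1 : ℝ)) | G t]

/-- The innovation process `ν_t = log S_t - ∫_0^t (b - 1/2 + (a - b) π_s) ds`. -/
noncomputable def innovation (a b : ℝ) (S π : ℝ≥0 → Ω → ℝ) (t : ℝ≥0) (ω : Ω) : ℝ :=
  Real.log (S t ω) - ∫ s in (0 : ℝ)..t, (b - 1 / 2 + (a - b) * π s.toNNReal ω)

/-- `ρ` is (a version of) the random variable
`ρ_t = exp(-∫_0^t (b - r + γ π_s) dν_s - ∫_0^t (r + (b - r + γ π_s)² / 2) ds)`, `γ = a - b`,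
the stochastic integral against the innovation process being taken in the filtration `G`. -/
def IsStatePriceDensity (P : Measure Ω) (G : Filtration ℝ≥0 mΩ) (a b r : ℝ)
    (S π : ℝ≥0 → Ω → ℝ) (t : ℝ≥0) (ρ : Ω → ℝ) : Prop :=
  ∃ I : Ω → ℝ,
    IsItoIntegral P G (innovation a b S π) t (fun s ω => b - r + (a - b) * π s ω) I ∧
    ρ = fun ω => Real.exp (-I ω
      - ∫ s in (0 : ℝ)..t, (r + 1 / 2 * (b - r + (a - b) * π s.toNNReal ω) ^ 2))

/-- The Hilbert space `L²(Ω, m, P)` of (classes of) square integrable `m`-measurable random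
variables, as a closed subspace of `L²(P)`. -/
noncomputable abbrev HilbertL2 {Ω : Type*} (m : MeasurableSpace Ω) {mΩ : MeasurableSpace Ω} (P : Measure Ω) :
    Submodule ℝ (Lp ℝ 2 P) :=
  lpMeas ℝ ℝ m 2 P

/-- The affine set of all `f` in `L²(Ω, m, P)` with `E f = z` and `E (ρ f) = y₀`. -/
def admissibleClasses {Ω : Type*} (m : MeasurableSpace Ω) {mΩ : MeasurableSpace Ω}
    (P : Measure Ω) (ρ : Ω → ℝ) (z y₀ : ℝ) :
    Set (HilbertL2 m P) :=
  {f | ∫ ω, (f : Lp ℝ 2 P) ω ∂P = z ∧ ∫ ω, ρ ω * (f : Lp ℝ 2 P) ω ∂P = y₀}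

/-- The terminal wealths `v ∈ L²(Ω, m, P)` with `E v = z` and `E (ρ v) = y₀`. -/
def admissible {Ω : Type*} (m : MeasurableSpace Ω) {mΩ : MeasurableSpace Ω}
    (P : Measure Ω) (ρ : Ω → ℝ) (z y₀ : ℝ) :
    Set (Ω → ℝ) :=
  {v | AEStronglyMeasurable[m] v P ∧ MemLp v 2 P ∧
    ∫ ω, v ω ∂P = z ∧ ∫ ω, ρ ω * v ω ∂P = y₀}

/-- The random variable
`[z E ρ² - y₀ E ρ + (y₀ - z E ρ) ρ] / Var(ρ)`. -/
noncomputable def optimalWealth (P : Measure Ω) (ρ : Ω → ℝ) (z y₀ : ℝ) (ω : Ω) : ℝ :=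
  (z * (∫ ω', ρ ω' ^ 2 ∂P) - y₀ * (∫ ω', ρ ω' ∂P) + (y₀ - z * ∫ ω', ρ ω' ∂P) * ρ ω)
    / Var[ρ; P]

end MeanVariance

open MeanVariance

/-! The minimisation itself is Hilbert space geometry. The constraints prescribe the inner products
of `v` with `1` and `ρ`, and since `E v = z` is fixed, minimising `E (v - z)²` is the same as
minimising the norm. The minimiser is the feasible point in the span of `1` and `ρ`; every other
feasible point differs from it by a vector orthogonal to both (`integral_sub_sq_of_mem_admissible`).
The Gram determinant of the pair is `Var ρ`, so everything rests on `ρ` being known at time `T`,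
square integrable and not constant.

By the Itô isometry and Gronwall, the stock price is almost surely geometric Brownian motion
(`IsStockPrice.ae_eq_gbm`). With `A = {μ = a}` and `γ = a - b` this gives `dν = dW + γ (1_A - π) dt`
in the large filtration (`innovation_ae_eq`). Integrals against `ν` are thus integrals against `W`
plus a bounded drift term, and it is never needed that `ν` is a Brownian motion for `𝒢`. The
integral in `ρ` exists because the posterior sampled on uniform grids converges in `L²(dt × P)`: its
second moment is monotone and bounded, so the squared errors telescope
(`integral_condGrid_sub_sq_le`). In this form `ρ = exp (-J - ∫ θ ds)`, where `J` is an Itô integral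
against `W` with bounded integrand `b - r + γ π` and the rate `θ` is bounded. Gaussian exponential
bounds for elementary integrals and Fatou's lemma put `ρ` in `L²`.

For `Var ρ > 0`, suppose `ρ` is constant. Then the martingale term `J` equals a constant minus a
time integral with bounded rate. Over `(u, T]` the time integral has second moment of order `(T -
u)²`, while the martingale has at least `T - u` times `E (b - r + γ π_u)²`. Hence this expectation
is of order `T - u`, and being monotone in `u` it vanishes before `T`
(`integral_affine_condProb_sq_eq_zero`). So `μ - r` is orthogonal to everything observed up to `T /
2`. Testing against `1` and against `log S` yields `E (μ - r) = 0` and `E (μ - r)² = 0`,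
contradicting that `μ` is not constant (`variance_statePriceDensity_pos`). -/

namespace MeanVariance

/-! ### Convergence in `L²`. -/

section L2

variable {α : Type*} {mα : MeasurableSpace α} {μ : Measure α}

/-- Convergence in `L²(μ)` of a sequence of real functions. -/
def L2Tendsto (μ : Measure α) (f : ℕ → α → ℝ) (g : α → ℝ) : Prop :=
  Tendsto (fun n => eLpNorm (fun x => f n x - g x) 2 μ) atTop (𝓝 0)

theorem eLpNorm_two_eq {f : α → ℝ} (hf : MemLp f 2 μ) :
    eLpNorm f 2 μ = ENNReal.ofReal (√(∫ x, f x ^ 2 ∂μ)) := by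
  rw [hf.eLpNorm_eq_integral_rpow_norm two_ne_zero ENNReal.ofNat_ne_top, Real.sqrt_eq_rpow]
  norm_num

theorem integral_sq_eq_toReal {f : α → ℝ} (hf : MemLp f 2 μ) :
    ∫ x, f x ^ 2 ∂μ = (eLpNorm f 2 μ).toReal ^ 2 := by
  rw [eLpNorm_two_eq hf, ENNReal.toReal_ofReal (Real.sqrt_nonneg _), Real.sq_sqrt]
  exact integral_nonneg fun _ => sq_nonneg _

theorem L2Tendsto.of_integral {f : ℕ → α → ℝ} {g : α → ℝ} (hf : ∀ n, MemLp (f n) 2 μ)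
    (hg : MemLp g 2 μ) (h : Tendsto (fun n => ∫ x, (f n x - g x) ^ 2 ∂μ) atTop (𝓝 0)) :
    L2Tendsto μ f g := by
  have h1 : ∀ n, eLpNorm (fun x => f n x - g x) 2 μ
      = ENNReal.ofReal (√(∫ x, (f n x - g x) ^ 2 ∂μ)) := fun n =>
    eLpNorm_two_eq ((hf n).sub hg)
  unfold L2Tendsto
  simp_rw [h1]
  have := ENNReal.tendsto_ofReal ((Real.continuous_sqrt.tendsto 0).comp h)
  simpa using this

theorem L2Tendsto.congr {f f' : ℕ → α → ℝ} {g g' : α → ℝ} (h : L2Tendsto μ f g)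
    (hf : ∀ n, f n =ᵐ[μ] f' n) (hg : g =ᵐ[μ] g') : L2Tendsto μ f' g' := by
  refine Tendsto.congr (fun n => eLpNorm_congr_ae ?_) h
  filter_upwards [hf n, hg] with x h1 h2
  rw [h1, h2]

theorem L2Tendsto.mono_measure {f : ℕ → α → ℝ} {g : α → ℝ} (h : L2Tendsto μ f g)
    {ν : Measure α} (hν : ν ≤ μ) : L2Tendsto ν f g :=
  tendsto_of_tendsto_of_tendsto_of_le_of_le tendsto_const_nhds h (fun _ => zero_le)
    fun _ => eLpNorm_mono_measure _ hν

theorem L2Tendsto.memLp {f : ℕ → α → ℝ} {g : α → ℝ} (h : L2Tendsto μ f g)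
    (hf : ∀ n, MemLp (f n) 2 μ) (hg : AEStronglyMeasurable g μ) : MemLp g 2 μ := by
  have h1 : ∀ᶠ n in atTop, eLpNorm (fun x => f n x - g x) 2 μ < 1 :=
    h.eventually (gt_mem_nhds zero_lt_one)
  obtain ⟨n, hn⟩ := h1.exists
  have h2 : MemLp (fun x => f n x - g x) 2 μ :=
    ⟨(hf n).1.sub hg, hn.trans ENNReal.one_lt_top⟩
  have h3 : g = fun x => f n x - (f n x - g x) := by ext; ring
  rw [h3]
  exact (hf n).sub h2

theorem L2Tendsto.tendsto_toLp {f : ℕ → α → ℝ} {g : α → ℝ} (h : L2Tendsto μ f g)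
    (hf : ∀ n, MemLp (f n) 2 μ) (hg : MemLp g 2 μ) :
    Tendsto (fun n => (hf n).toLp (f n)) atTop (𝓝 (hg.toLp g)) :=
  (Lp.tendsto_Lp_iff_tendsto_eLpNorm'' f hf g hg).2 h

theorem inner_toLp_eq {f g : α → ℝ} (hf : MemLp f 2 μ) (hg : MemLp g 2 μ) :
    inner ℝ (hf.toLp f) (hg.toLp g) = ∫ x, f x * g x ∂μ := by
  rw [L2.inner_def]
  refine integral_congr_ae ?_
  filter_upwards [hf.coeFn_toLp, hg.coeFn_toLp] with x h1 h2
  simp [h1, h2, mul_comm]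

theorem L2Tendsto.tendsto_integral_mul {f f' : ℕ → α → ℝ} {g g' : α → ℝ}
    (h : L2Tendsto μ f g) (h' : L2Tendsto μ f' g') (hf : ∀ n, MemLp (f n) 2 μ) (hg : MemLp g 2 μ)
    (hf' : ∀ n, MemLp (f' n) 2 μ) (hg' : MemLp g' 2 μ) :
    Tendsto (fun n => ∫ x, f n x * f' n x ∂μ) atTop (𝓝 (∫ x, g x * g' x ∂μ)) := by
  have := (h.tendsto_toLp hf hg).inner (𝕜 := ℝ) (h'.tendsto_toLp hf' hg')
  simpa only [inner_toLp_eq] using this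

theorem L2Tendsto.const (f : α → ℝ) : L2Tendsto μ (fun _ => f) f := by
  simp [L2Tendsto]

theorem L2Tendsto.add {f f' : ℕ → α → ℝ} {g g' : α → ℝ}
    (h : L2Tendsto μ f g) (h' : L2Tendsto μ f' g')
    (hm : ∀ n, AEStronglyMeasurable (fun x => f n x - g x) μ)
    (hm' : ∀ n, AEStronglyMeasurable (fun x => f' n x - g' x) μ) :
    L2Tendsto μ (fun n x => f n x + f' n x) (fun x => g x + g' x) := by
  have h0 := Tendsto.add h h'
  rw [add_zero] at h0
  refine tendsto_of_tendsto_of_tendsto_of_le_of_le tendsto_const_nhds h0 (fun _ => zero_le)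
    fun n => ?_
  have := eLpNorm_add_le (hm n) (hm' n) (p := 2) (by norm_num)
  refine le_trans (le_of_eq ?_) this
  congr 1
  ext x
  simp; ring

theorem L2Tendsto.const_mul {f : ℕ → α → ℝ} {g : α → ℝ} (c : ℝ) (h : L2Tendsto μ f g) :
    L2Tendsto μ (fun n x => c * f n x) (fun x => c * g x) := by
  have h0 : Tendsto (fun n => ENNReal.ofReal |c| * eLpNorm (fun x => f n x - g x) 2 μ) atTop
      (𝓝 (ENNReal.ofReal |c| * 0)) := ENNReal.Tendsto.const_mul h (Or.inr ENNReal.ofReal_ne_top)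
  rw [mul_zero] at h0
  refine h0.congr fun n => ?_
  rw [← Real.enorm_eq_ofReal_abs, ← eLpNorm_const_smul]
  congr 1
  ext x
  simp; ring

theorem L2Tendsto.mul_of_bound {f : ℕ → α → ℝ} {g ψ : α → ℝ} {C : ℝ} (hψ : ∀ᵐ x ∂μ, |ψ x| ≤ C)
    (h : L2Tendsto μ f g) :
    L2Tendsto μ (fun n x => f n x * ψ x) (fun x => g x * ψ x) := by
  have h0 : Tendsto (fun n => ENNReal.ofReal C * eLpNorm (fun x => f n x - g x) 2 μ) atTop
      (𝓝 (ENNReal.ofReal C * 0)) := ENNReal.Tendsto.const_mul h (Or.inr ENNReal.ofReal_ne_top)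
  rw [mul_zero] at h0
  refine tendsto_of_tendsto_of_tendsto_of_le_of_le tendsto_const_nhds h0 (fun _ => zero_le)
    fun n => ?_
  refine eLpNorm_le_mul_eLpNorm_of_ae_le_mul ?_ 2
  filter_upwards [hψ] with x hx
  rw [← sub_mul, norm_mul, mul_comm]
  exact mul_le_mul_of_nonneg_right hx (norm_nonneg _)

/-- Convergence in `L²` implies convergence in measure, which has an almost surely convergent
subsequence. It serves to apply Fatou's lemma and to identify almost sure limits. -/
theorem L2Tendsto.exists_subseq {f : ℕ → α → ℝ} {g : α → ℝ} (h : L2Tendsto μ f g)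
    (hf : ∀ n, AEStronglyMeasurable (f n) μ) (hg : AEStronglyMeasurable g μ) :
    ∃ φ : ℕ → ℕ, StrictMono φ ∧ ∀ᵐ x ∂μ, Tendsto (fun n => f (φ n) x) atTop (𝓝 (g x)) :=
  (tendstoInMeasure_of_tendsto_eLpNorm (p := 2) (by norm_num) hf hg h).exists_seq_tendsto_ae

/-- The classes with an `m`-measurable representative are closed in `L²`. This is how Itô integrals
inherit measurability at their terminal time from elementary integrals. -/
theorem L2Tendsto.aestronglyMeasurable_of_sub {α : Type*} {m mα : MeasurableSpace α} {μ : Measure α}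
    {f : ℕ → α → ℝ} {g : α → ℝ}
    (h : L2Tendsto μ f g) (hm : m ≤ mα) (hf : ∀ n, AEStronglyMeasurable[m] (f n) μ)
    (hfL : ∀ n, MemLp (f n) 2 μ) (hg : MemLp g 2 μ) : AEStronglyMeasurable[m] g μ := by
  have h1 := (isClosed_aestronglyMeasurable (F := ℝ) (p := 2) (μ := μ) hm).mem_of_tendsto
    (h.tendsto_toLp hfL hg)
    (Eventually.of_forall fun n => (hf n).congr (hfL n).coeFn_toLp.symm)
  exact AEStronglyMeasurable.congr h1 hg.coeFn_toLp

/-- A sequence dominated in `L²` by a convergent one converges. -/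
theorem exists_l2Tendsto_of_le {β : Type*} {mβ : MeasurableSpace β} {ν : Measure β}
    {f : ℕ → α → ℝ} {k : ℕ → β → ℝ} {H : β → ℝ}
    (hf : ∀ n, MemLp (f n) 2 μ) (hk : ∀ n, MemLp (k n) 2 ν) (hH : MemLp H 2 ν)
    (h : L2Tendsto ν k H)
    (hle : ∀ n l, eLpNorm (fun x => f n x - f l x) 2 μ ≤ eLpNorm (fun x => k n x - k l x) 2 ν) :
    ∃ g, MemLp g 2 μ ∧ L2Tendsto μ f g := by
  have h1 : CauchySeq fun n => (hk n).toLp (k n) := (h.tendsto_toLp hk hH).cauchySeq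
  have h2 : CauchySeq fun n => (hf n).toLp (f n) := by
    rw [Metric.cauchySeq_iff] at h1 ⊢
    intro ε hε
    obtain ⟨N, hN⟩ := h1 ε hε
    refine ⟨N, fun n hn l hl => lt_of_le_of_lt ?_ (hN n hn l hl)⟩
    rw [dist_eq_norm, dist_eq_norm, ← MemLp.toLp_sub, ← MemLp.toLp_sub, Lp.norm_toLp, Lp.norm_toLp]
    exact ENNReal.toReal_mono ((hk n).sub (hk l)).2.ne (hle n l)
  obtain ⟨g, hg⟩ := cauchySeq_tendsto_of_complete h2
  refine ⟨g, Lp.memLp g, ?_⟩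
  rw [← Lp.toLp_coeFn g (Lp.memLp g), Lp.tendsto_Lp_iff_tendsto_eLpNorm''] at hg
  exact hg

theorem integral_mul_sq_le {f g : α → ℝ} (hf : MemLp f 2 μ) (hg : MemLp g 2 μ) :
    (∫ x, f x * g x ∂μ) ^ 2 ≤ (∫ x, f x ^ 2 ∂μ) * ∫ x, g x ^ 2 ∂μ := by
  have h := real_inner_mul_inner_self_le (hf.toLp f) (hg.toLp g)
  simp only [inner_toLp_eq] at h
  simpa only [sq] using h

end L2

/-! ### Time integrals of processes as elements of `L²(P)`. -/

section TimeIntegral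

variable {α Ω : Type*} {mα : MeasurableSpace α} {mΩ : MeasurableSpace Ω} {ν : Measure α}
  {P : Measure Ω}

/-- Cauchy–Schwarz in the time variable for almost every `ω`, followed by Tonelli. -/
theorem eLpNorm_integral_le [IsFiniteMeasure ν] [SFinite P] {f : α × Ω → ℝ}
    (hf : AEStronglyMeasurable f (ν.prod P)) :
    eLpNorm (fun ω => ∫ s, f (s, ω) ∂ν) 2 P
      ≤ ν Set.univ ^ (1 / 2 : ℝ) * eLpNorm f 2 (ν.prod P) := by
  have hsec : ∀ᵐ ω ∂P, AEStronglyMeasurable (fun s => f (s, ω)) ν := by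
    exact (hf.prod_swap).prodMk_left
  have key : ∀ᵐ ω ∂P, ‖∫ s, f (s, ω) ∂ν‖ₑ ^ (2 : ℝ)
      ≤ ν Set.univ * ∫⁻ s, ‖f (s, ω)‖ₑ ^ (2 : ℝ) ∂ν := by
    filter_upwards [hsec] with ω hω
    have h1 := eLpNorm_le_eLpNorm_mul_rpow_measure_univ (p := 1) (q := 2) (by norm_num) hω
    rw [eLpNorm_one_eq_lintegral_enorm, eLpNorm_eq_lintegral_rpow_enorm_toReal (by norm_num)
      (by norm_num)] at h1
    have h2 : ‖∫ s, f (s, ω) ∂ν‖ₑ ≤ _ := (enorm_integral_le_lintegral_enorm _).trans h1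
    refine (ENNReal.rpow_le_rpow h2 (by norm_num : (0 : ℝ) ≤ 2)).trans (le_of_eq ?_)
    rw [ENNReal.mul_rpow_of_nonneg _ _ (by norm_num), ← ENNReal.rpow_mul, ← ENNReal.rpow_mul]
    norm_num
    rw [mul_comm]
  rw [eLpNorm_eq_lintegral_rpow_enorm_toReal (by norm_num) (by norm_num),
    eLpNorm_eq_lintegral_rpow_enorm_toReal (by norm_num) (by norm_num)]
  simp only [ENNReal.toReal_ofNat]
  rw [← ENNReal.mul_rpow_of_nonneg _ _ (by norm_num)]
  refine ENNReal.rpow_le_rpow ?_ (by norm_num)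
  have hm : AEMeasurable (fun p => ‖f p‖ₑ ^ (2 : ℝ)) (ν.prod P) := hf.enorm.pow_const _
  rw [lintegral_prod_symm _ hm, ← lintegral_const_mul' _ _ (measure_ne_top _ _)]
  exact lintegral_mono_ae key

theorem memLp_integral [IsFiniteMeasure ν] [SFinite P] {f : α × Ω → ℝ}
    (hf : MemLp f 2 (ν.prod P)) : MemLp (fun ω => ∫ s, f (s, ω) ∂ν) 2 P := by
  refine ⟨(hf.1.prod_swap).integral_prod_right', (eLpNorm_integral_le hf.1).trans_lt ?_⟩
  exact ENNReal.mul_lt_top (ENNReal.rpow_lt_top_of_nonneg (by norm_num) (measure_ne_top _ _)) hf.2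

theorem ae_integrable_section [IsFiniteMeasure ν] [IsFiniteMeasure P] {f : α × Ω → ℝ}
    (hf : MemLp f 2 (ν.prod P)) : ∀ᵐ ω ∂P, Integrable (fun s => f (s, ω)) ν :=
  (hf.integrable (by norm_num)).prod_left_ae

theorem L2Tendsto.integral [IsFiniteMeasure ν] [IsFiniteMeasure P] {f : ℕ → α × Ω → ℝ}
    {g : α × Ω → ℝ} (h : L2Tendsto (ν.prod P) f g) (hf : ∀ n, MemLp (f n) 2 (ν.prod P))
    (hg : MemLp g 2 (ν.prod P)) :
    L2Tendsto P (fun n ω => ∫ s, f n (s, ω) ∂ν) (fun ω => ∫ s, g (s, ω) ∂ν) := by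
  have h0 : Tendsto (fun n => ν Set.univ ^ (1 / 2 : ℝ) *
      eLpNorm (fun x => f n x - g x) 2 (ν.prod P)) atTop (𝓝 (ν Set.univ ^ (1 / 2 : ℝ) * 0)) :=
    ENNReal.Tendsto.const_mul h
      (Or.inr (ENNReal.rpow_lt_top_of_nonneg (by norm_num) (measure_ne_top _ _)).ne)
  rw [mul_zero] at h0
  refine tendsto_of_tendsto_of_tendsto_of_le_of_le tendsto_const_nhds h0 (fun _ => zero_le)
    fun n => ?_
  refine le_trans (le_of_eq (eLpNorm_congr_ae ?_)) (eLpNorm_integral_le ((hf n).sub hg).1)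
  filter_upwards [ae_integrable_section (hf n), ae_integrable_section hg] with ω h1 h2
  simpa using (integral_sub h1 h2).symm

theorem integral_sq_integral_le [IsFiniteMeasure ν] [SFinite P] {f : α × Ω → ℝ}
    (hf : MemLp f 2 (ν.prod P)) :
    ∫ ω, (∫ s, f (s, ω) ∂ν) ^ 2 ∂P ≤ ν.real Set.univ * ∫ p, f p ^ 2 ∂(ν.prod P) := by
  rw [integral_sq_eq_toReal (memLp_integral hf), integral_sq_eq_toReal hf]
  have h := ENNReal.toReal_mono (ENNReal.mul_lt_top (ENNReal.rpow_lt_top_of_nonneg (by norm_num)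
    (measure_ne_top _ _)) hf.2).ne (eLpNorm_integral_le hf.1)
  have h2 := pow_le_pow_left₀ ENNReal.toReal_nonneg h 2
  refine h2.trans (le_of_eq ?_)
  rw [ENNReal.toReal_mul, mul_pow, ← ENNReal.toReal_pow, ← ENNReal.rpow_natCast,
    ← ENNReal.rpow_mul]
  norm_num [Measure.real]

/-- A time integral of random variables known at the same time is known at that time. -/
theorem aestronglyMeasurable_integral_of_sub {α Ω : Type*} {mα : MeasurableSpace α}
    {m mΩ : MeasurableSpace Ω} {ν : Measure α} {P : Measure Ω} [IsFiniteMeasure ν] [IsFiniteMeasure P]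
    (hm : m ≤ mΩ) {f : α × Ω → ℝ} {C : ℝ}
    (hf : AEStronglyMeasurable f (ν.prod P)) (hC : ∀ᵐ p ∂(ν.prod P), |f p| ≤ C)
    (hfm : ∀ᵐ s ∂ν, AEStronglyMeasurable[m] (fun ω => f (s, ω)) P) :
    AEStronglyMeasurable[m] (fun ω => ∫ s, f (s, ω) ∂ν) P := by
  have hfL : MemLp f 2 (ν.prod P) := MemLp.of_bound hf C (by simpa using hC)
  have hfi : Integrable f (ν.prod P) := hfL.integrable (by norm_num)
  set A : Ω → ℝ := fun ω => ∫ s, f (s, ω) ∂ν with hA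
  have hAi : Integrable A P := (memLp_integral hfL).integrable (by norm_num)
  have hCs : ∀ᵐ s ∂ν, ∀ᵐ ω ∂P, |f (s, ω)| ≤ C := Measure.ae_ae_of_ae_prod hC
  have swap : ∀ Z : Ω → ℝ, MemLp Z 2 P → ∫ ω, Z ω * A ω ∂P = ∫ s, ∫ ω, Z ω * f (s, ω) ∂P ∂ν := by
    intro Z hZ
    have hZ2 : MemLp (fun p : α × Ω => Z p.2) 2 (ν.prod P) := hZ.comp_snd ν
    have hi : Integrable (fun p : α × Ω => Z p.2 * f p) (ν.prod P) := hZ2.integrable_mul hfL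
    have := integral_integral_swap (μ := ν) (ν := P) (f := fun s ω => Z ω * f (s, ω)) hi
    rw [this]
    refine integral_congr_ae (Eventually.of_forall fun ω => ?_)
    simp only [hA]
    rw [integral_const_mul]
  -- Joint measurability is available only for the full σ-algebra, so Fubini cannot be applied
  -- directly in `m`. Instead the conditional expectation is moved from `A` to `Z` by
  -- self-adjointness, integrals are exchanged, and it is removed from `Z` again on each slice,
  -- where `f (s, ·)` is `m`-measurable.
  have key : ∀ Z : Ω → ℝ, MemLp Z 2 P → ∫ ω, Z ω * A ω ∂P = ∫ ω, Z ω * (P[A | m]) ω ∂P := by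
    intro Z hZ
    have hZi : Integrable Z P := hZ.integrable (by norm_num)
    have hZm : MemLp (P[Z | m]) 2 P := hZ.condExp (by norm_num)
    have hAL : MemLp A 2 P := memLp_integral hfL
    have hcA : MemLp (P[A | m]) 2 P := hAL.condExp (by norm_num)
    have e1 : ∫ ω, Z ω * (P[A | m]) ω ∂P = ∫ ω, (P[Z | m]) ω * (P[A | m]) ω ∂P := by
      rw [← integral_condExp hm (f := fun ω => Z ω * (P[A | m]) ω)]
      refine integral_congr_ae ?_
      exact condExp_mul_of_aestronglyMeasurable_right
        stronglyMeasurable_condExp.aestronglyMeasurable (hZ.integrable_mul hcA) hZi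
    have e2 : ∫ ω, (P[Z | m]) ω * A ω ∂P = ∫ ω, (P[Z | m]) ω * (P[A | m]) ω ∂P := by
      rw [← integral_condExp hm (f := fun ω => (P[Z | m]) ω * A ω)]
      refine integral_congr_ae ?_
      exact condExp_mul_of_aestronglyMeasurable_left
        stronglyMeasurable_condExp.aestronglyMeasurable (hZm.integrable_mul hAL) hAi
    rw [e1, ← e2, swap Z hZ, swap _ hZm]
    refine integral_congr_ae ?_
    filter_upwards [hfm, hCs, hf.prodMk_left] with s h1 h2 h3
    have h4 : MemLp (fun ω => f (s, ω)) 2 P := MemLp.of_bound h3 C (by simpa using h2)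
    rw [← integral_condExp hm (f := fun ω => Z ω * f (s, ω))]
    refine integral_congr_ae ?_
    exact condExp_mul_of_aestronglyMeasurable_right h1 (hZ.integrable_mul h4) hZi
  have hEq : A =ᵐ[P] P[A | m] := by
    refine hAi.ae_eq_of_forall_setIntegral_eq _ _ integrable_condExp fun s hs _ => ?_
    have hZ : MemLp (s.indicator fun _ => (1 : ℝ)) 2 P :=
      memLp_indicator_const 2 hs 1 (Or.inr (measure_ne_top _ _))
    have := key _ hZ
    rw [← integral_indicator hs, ← integral_indicator hs]
    convert this using 3 with ω ω <;> by_cases h : ω ∈ s <;> simp [h]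
  exact ⟨_, stronglyMeasurable_condExp, hEq⟩

end TimeIntegral

end MeanVariance

namespace MeanVariance

/-! ### Increments of Brownian motion and stochastic rectangles. -/

section Brownian

variable {Ω : Type*} {mΩ : MeasurableSpace Ω} {P : Measure Ω}
  {F : Filtration ℝ≥0 mΩ} {W : ℝ≥0 → Ω → ℝ}

theorem memLp_bdd_mul {α : Type*} {mα : MeasurableSpace α} {μ : Measure α} {f g : α → ℝ} {C : ℝ}
    (hf : AEStronglyMeasurable f μ) (hC : ∀ᵐ x ∂μ, |f x| ≤ C) (hg : MemLp g 2 μ) :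
    MemLp (fun x => f x * g x) 2 μ := by
  refine MemLp.of_le_mul (c := C) hg (hf.mul hg.1) ?_
  filter_upwards [hC] with x hx
  rw [norm_mul]
  exact mul_le_mul_of_nonneg_right hx (norm_nonneg _)

namespace IsFiltrationBrownian

variable (hW : IsFiltrationBrownian P F W)
include hW

theorem measurable (t : ℝ≥0) : Measurable (W t) := ((hW.adapted t).mono (F.le t)).measurable

theorem measurable_sub (s t : ℝ≥0) : Measurable fun ω => W t ω - W s ω :=
  (hW.measurable t).sub (hW.measurable s)

theorem stronglyMeasurable_sub {s t u : ℝ≥0} (hs : s ≤ u) (ht : t ≤ u) :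
    StronglyMeasurable[F u] fun ω => W t ω - W s ω :=
  ((hW.adapted t).mono (F.mono ht)).sub ((hW.adapted s).mono (F.mono hs))

theorem map_sub {s t : ℝ≥0} (hst : s ≤ t) :
    P.map (fun ω => W t ω - W s ω) = gaussianReal 0 (t - s) := by
  have h := (hW.isBrownian.toIsPreBrownianReal.hasLaw_sub t s).map_eq
  -- The variance of an increment comes as a distance; for `s ≤ t` it is the truncated difference in
  -- `ℝ≥0`.
  have h2 : nndist (t : ℝ≥0).1 (s : ℝ≥0).1 = t - s := by
    ext
    rw [coe_nndist, Real.dist_eq, NNReal.coe_sub hst, abs_of_nonneg]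
    · rfl
    · exact sub_nonneg.2 (NNReal.coe_le_coe.2 hst)
  rw [h2] at h
  exact h

theorem memLp_sub {s t : ℝ≥0} (hst : s ≤ t) (p : ℝ≥0) : MemLp (fun ω => W t ω - W s ω) p P := by
  have h := memLp_id_gaussianReal (μ := 0) (v := t - s) p
  rw [← hW.map_sub hst] at h
  exact h.comp_of_map (hW.measurable_sub s t).aemeasurable

theorem integral_sub_eq_zero {s t : ℝ≥0} (hst : s ≤ t) : ∫ ω, (W t ω - W s ω) ∂P = 0 := by
  have h := integral_map (μ := P) (hW.measurable_sub s t).aemeasurable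
    (f := fun x : ℝ => x) (by fun_prop)
  rw [← h, hW.map_sub hst, integral_id_gaussianReal]

theorem integral_sub_sq {s t : ℝ≥0} (hst : s ≤ t) :
    ∫ ω, (W t ω - W s ω) ^ 2 ∂P = (t : ℝ) - s := by
  have h := integral_map (μ := P) (hW.measurable_sub s t).aemeasurable
    (f := fun x : ℝ => x ^ 2) (by fun_prop)
  rw [← h, hW.map_sub hst]
  have h2 := variance_eq_integral (μ := gaussianReal 0 (t - s)) (X := fun x => x)
    measurable_id.aemeasurable
  rw [variance_fun_id_gaussianReal, integral_id_gaussianReal] at h2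
  simp only [sub_zero] at h2
  rw [← h2, NNReal.coe_sub hst]

theorem integral_exp_sub {s t : ℝ≥0} (hst : s ≤ t) (c : ℝ) :
    ∫ ω, Real.exp (c * (W t ω - W s ω)) ∂P = Real.exp (c ^ 2 * (t - s) / 2) := by
  have h := mgf_gaussianReal (hW.map_sub hst) c
  rw [mgf, NNReal.coe_sub hst] at h
  rw [h]
  congr 1
  ring

theorem integrable_exp_sub {s t : ℝ≥0} (hst : s ≤ t) (c : ℝ) :
    Integrable (fun ω => Real.exp (c * (W t ω - W s ω))) P := by
  have h := integrable_exp_mul_gaussianReal (μ := 0) (v := t - s) c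
  rw [← hW.map_sub hst] at h
  exact h.comp_aemeasurable (hW.measurable_sub s t).aemeasurable

/-- The derivative at `1` of the Gaussian moment generating function. It is the cross term in
`exp_remainder`. -/
theorem integral_mul_exp_sub {s t : ℝ≥0} (hst : s ≤ t) :
    ∫ ω, (W t ω - W s ω) * Real.exp (W t ω - W s ω) ∂P
      = ((t : ℝ) - s) * Real.exp ((t - s) / 2) := by
  set X : Ω → ℝ := fun ω => W t ω - W s ω with hX
  have hint : integrableExpSet X P = Set.univ := by
    ext c
    simp only [integrableExpSet, Set.mem_ofPred_eq, Set.mem_univ, iff_true]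
    exact hW.integrable_exp_sub hst c
  have h1 := deriv_mgf (X := X) (μ := P) (t := 1) (by rw [hint]; simp)
  have h2 : mgf X P = fun c => Real.exp (((t : ℝ) - s) * c ^ 2 / 2) := by
    ext c
    rw [mgf_gaussianReal (hW.map_sub hst) c, NNReal.coe_sub hst]
    congr 1; ring
  have h3 : HasDerivAt (fun c : ℝ => Real.exp (((t : ℝ) - s) * c ^ 2 / 2))
      (Real.exp (((t : ℝ) - s) * 1 ^ 2 / 2) * (((t : ℝ) - s) * (2 * 1) / 2)) 1 := by
    have := (((hasDerivAt_pow 2 (1 : ℝ)).const_mul ((t : ℝ) - s)).div_const 2).exp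
    simpa using this
  rw [h2, h3.deriv] at h1
  simp only [one_mul] at h1
  rw [← h1]
  ring_nf

/-- The independence of increments from the past enters all later arguments through this lemma. -/
theorem indepFun {s t : ℝ≥0} (hst : s ≤ t) {ζ : Ω → ℝ} (hζ : StronglyMeasurable[F s] ζ)
    {g : ℝ → ℝ} (hg : Measurable g) : IndepFun ζ (fun ω => g (W t ω - W s ω)) P := by
  have h := (hW.indep_increments s t hst).symm
  rw [IndepFun_iff_Indep]
  refine indep_of_indep_of_le_left (indep_of_indep_of_le_right h ?_) hζ.measurable.comap_le
  change MeasurableSpace.comap (g ∘ fun ω => W t ω - W s ω) _ ≤ _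
  rw [← MeasurableSpace.comap_comp]
  exact MeasurableSpace.comap_mono hg.comap_le

theorem integral_mul {s t : ℝ≥0} (hst : s ≤ t) {ζ : Ω → ℝ} (hζ : StronglyMeasurable[F s] ζ)
    {g : ℝ → ℝ} (hg : Measurable g) :
    ∫ ω, ζ ω * g (W t ω - W s ω) ∂P = (∫ ω, ζ ω ∂P) * ∫ ω, g (W t ω - W s ω) ∂P :=
  (hW.indepFun hst hζ hg).integral_mul_eq_mul_integral
    (hζ.mono (F.le s)).aestronglyMeasurable
    (hg.comp (hW.measurable_sub s t)).aestronglyMeasurable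

theorem integrable_mul {s t : ℝ≥0} (hst : s ≤ t) {ζ : Ω → ℝ} (hζ : StronglyMeasurable[F s] ζ)
    (hζi : Integrable ζ P)
    {g : ℝ → ℝ} (hg : Measurable g) (hgi : Integrable (fun ω => g (W t ω - W s ω)) P) :
    Integrable (fun ω => ζ ω * g (W t ω - W s ω)) P :=
  (hW.indepFun hst hζ hg).integrable_mul hζi hgi

theorem memLp_mul {s t : ℝ≥0} (hst : s ≤ t) {ζ : Ω → ℝ} (hζ : StronglyMeasurable[F s] ζ)
    (hζi : MemLp ζ 2 P)
    {g : ℝ → ℝ} (hg : Measurable g) (hgi : MemLp (fun ω => g (W t ω - W s ω)) 2 P) :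
    MemLp (fun ω => ζ ω * g (W t ω - W s ω)) 2 P := by
  rw [memLp_two_iff_integrable_sq (f := fun ω => ζ ω * g (W t ω - W s ω)) (hζi.1.mul hgi.1)]
  simp_rw [mul_pow]
  exact hW.integrable_mul hst (hζ.pow 2) hζi.integrable_sq (hg.pow_const 2) hgi.integrable_sq

/-- Integrability of `ζ` is not required, since the product formula for independent factors also
holds for non-integrable ones, whose integral is `0` by convention. This allows `ζ` to contain
earlier increments. -/
theorem integral_mul_sub_eq_zero {s t : ℝ≥0} (hst : s ≤ t) {ζ : Ω → ℝ}
    (hζ : StronglyMeasurable[F s] ζ) : ∫ ω, ζ ω * (W t ω - W s ω) ∂P = 0 := by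
  have h := hW.integral_mul hst hζ measurable_id
  simp only [id_eq] at h
  rw [h, hW.integral_sub_eq_zero hst, mul_zero]

/-- Orthogonality over a common starting time. -/
theorem integral_mul_sub_mul_sub {s t t' : ℝ≥0} (ht : s ≤ t) (ht' : s ≤ t') {ζ : Ω → ℝ} {C : ℝ}
    (hζ : StronglyMeasurable[F s] ζ) (hC : ∀ ω, |ζ ω| ≤ C) :
    ∫ ω, ζ ω * ((W t ω - W s ω) * (W t' ω - W s ω)) ∂P
      = (∫ ω, ζ ω ∂P) * (min (t : ℝ) t' - s) := by
  wlog htt : t ≤ t' generalizing t t'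
  · rw [min_comm, ← this ht' ht (le_of_not_ge htt)]
    refine integral_congr_ae (Eventually.of_forall fun ω => ?_)
    ring
  have hζm : AEStronglyMeasurable ζ P := (hζ.mono (F.le s)).aestronglyMeasurable
  have hζC : ∀ᵐ ω ∂P, |ζ ω| ≤ C := Eventually.of_forall hC
  have h2 : ∀ {u v : ℝ≥0}, u ≤ v → MemLp (fun ω => W v ω - W u ω) 2 P := fun h => hW.memLp_sub h 2
  -- The longer increment is cut at `t`; its later piece has mean zero against everything known at
  -- `t`.
  have e : ∀ ω, ζ ω * ((W t ω - W s ω) * (W t' ω - W s ω))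
      = ζ ω * (W t ω - W s ω) ^ 2 + ζ ω * (W t ω - W s ω) * (W t' ω - W t ω) := fun ω => by ring
  simp_rw [e]
  rw [integral_add]
  · rw [hW.integral_mul ht hζ (g := fun x => x ^ 2) (by fun_prop),
      hW.integral_sub_sq ht, hW.integral_mul_sub_eq_zero htt
        (ζ := fun ω => ζ ω * (W t ω - W s ω)) ((hζ.mono (F.mono ht)).mul (hW.stronglyMeasurable_sub ht le_rfl)), add_zero,
      min_eq_left (NNReal.coe_le_coe.2 htt)]
  · have := (memLp_bdd_mul hζm hζC (h2 ht)).integrable_mul (h2 ht)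
    refine this.congr (Eventually.of_forall fun ω => ?_)
    simp; ring
  · exact (memLp_bdd_mul hζm hζC (h2 ht)).integrable_mul (h2 htt)

/-- The isometry for two stochastic rectangles. -/
theorem integral_rectangle_mul {s t s' t' : ℝ≥0} (ht : s ≤ t) (ht' : s' ≤ t') {ξ ξ' : Ω → ℝ}
    {C C' : ℝ} (hξ : StronglyMeasurable[F s] ξ) (hC : ∀ ω, |ξ ω| ≤ C)
    (hξ' : StronglyMeasurable[F s'] ξ') (hC' : ∀ ω, |ξ' ω| ≤ C') :
    ∫ ω, ξ ω * (W t ω - W s ω) * (ξ' ω * (W t' ω - W s' ω)) ∂P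
      = (∫ ω, ξ ω * ξ' ω ∂P) * max 0 (min (t : ℝ) t' - max (s : ℝ) s') := by
  wlog hss : s ≤ s' generalizing s t s' t' ξ ξ' C C'
  · have := this ht' ht hξ' hC' hξ hC (le_of_not_ge hss)
    rw [min_comm, max_comm (s : ℝ)]
    simp_rw [mul_comm (ξ _) (ξ' _)]
    rw [← this]
    refine integral_congr_ae (Eventually.of_forall fun ω => ?_)
    ring
  have hm : ∀ {u : ℝ≥0} {ζ : Ω → ℝ}, StronglyMeasurable[F u] ζ → AEStronglyMeasurable ζ P :=
    fun {u} _ h => (h.mono (F.le u)).aestronglyMeasurable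
  have h2 : ∀ {u v : ℝ≥0}, u ≤ v → MemLp (fun ω => W v ω - W u ω) 2 P := fun h => hW.memLp_sub h 2
  have hss' : (s : ℝ) ≤ s' := NNReal.coe_le_coe.2 hss
  rw [max_eq_right hss']
  rcases le_total t s' with hts | hts
  · have htsr : (t : ℝ) ≤ s' := NNReal.coe_le_coe.2 hts
    rw [max_eq_left (by linarith [min_le_left (t : ℝ) t']), mul_zero]
    have := hW.integral_mul_sub_eq_zero ht' (ζ := fun ω => ξ ω * (W t ω - W s ω) * ξ' ω)
      (((hξ.mono (F.mono hss)).mul (hW.stronglyMeasurable_sub hss hts)).mul hξ')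
    rw [← this]
    refine integral_congr_ae (Eventually.of_forall fun ω => ?_)
    ring
  -- For overlapping intervals the earlier increment is cut at `s'`. The part before `s'` is known
  -- at `s'` and drops out; the rest shares its starting time with the other rectangle.
  · have e : ∀ ω, ξ ω * (W t ω - W s ω) * (ξ' ω * (W t' ω - W s' ω))
        = ξ ω * (W s' ω - W s ω) * ξ' ω * (W t' ω - W s' ω)
          + ξ ω * ξ' ω * ((W t ω - W s' ω) * (W t' ω - W s' ω)) := fun ω => by ring
    have hprod : StronglyMeasurable[F s'] fun ω => ξ ω * ξ' ω := (hξ.mono (F.mono hss)).mul hξ'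
    have hb : ∀ ω, |ξ ω * ξ' ω| ≤ C * C' := fun ω => by
      rw [abs_mul]
      exact mul_le_mul (hC ω) (hC' ω) (abs_nonneg _) ((abs_nonneg _).trans (hC ω))
    simp_rw [e]
    rw [integral_add]
    · rw [hW.integral_mul_sub_eq_zero ht' (ζ := fun ω => ξ ω * (W s' ω - W s ω) * ξ' ω)
        (((hξ.mono (F.mono hss)).mul (hW.stronglyMeasurable_sub hss le_rfl)).mul hξ'),
        hW.integral_mul_sub_mul_sub hts ht' hprod hb, zero_add, max_eq_right]
      rw [sub_nonneg]
      exact le_min (NNReal.coe_le_coe.2 hts) (NNReal.coe_le_coe.2 ht')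
    · have := (memLp_bdd_mul (hm hprod) (Eventually.of_forall hb) (h2 hss)).integrable_mul (h2 ht')
      refine this.congr (Eventually.of_forall fun ω => ?_)
      simp only [Pi.mul_apply]; ring
    · have := (memLp_bdd_mul (hm hprod) (Eventually.of_forall hb) (h2 hts)).integrable_mul (h2 ht')
      refine this.congr (Eventually.of_forall fun ω => ?_)
      simp; ring

/-- Truncation at `T` needs care: if `u` exceeds `T`, the coefficient is not known at the truncated
time. But then the truncated increment vanishes, and so does the overlap length on the right. -/
theorem integral_rectangle_min_mul {u v u' v' T : ℝ≥0} (h : u ≤ v) (h' : u' ≤ v') {ξ ξ' : Ω → ℝ}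
    {C C' : ℝ} (hξ : StronglyMeasurable[F u] ξ) (hC : ∀ ω, |ξ ω| ≤ C)
    (hξ' : StronglyMeasurable[F u'] ξ') (hC' : ∀ ω, |ξ' ω| ≤ C') :
    ∫ ω, ξ ω * (W (min v T) ω - W (min u T) ω) * (ξ' ω * (W (min v' T) ω - W (min u' T) ω)) ∂P
      = (∫ ω, ξ ω * ξ' ω ∂P) * max 0 (min (min (v : ℝ) v') T - max (u : ℝ) u') := by
  rcases le_total u T with hu | hu
  · rcases le_total u' T with hu' | hu'
    · rw [min_eq_left hu, min_eq_left hu', hW.integral_rectangle_mul (le_min h hu) (le_min h' hu')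
        hξ hC hξ' hC']
      push_cast
      rw [← inf_inf_distrib_right]
    · have : (T : ℝ) ≤ u' := NNReal.coe_le_coe.2 hu'
      rw [min_eq_right hu', min_eq_right (hu'.trans h'), max_eq_left]
      · simp
      · linarith [min_le_right (min (v : ℝ) v') T, le_max_right (u : ℝ) u']
  · have : (T : ℝ) ≤ u := NNReal.coe_le_coe.2 hu
    rw [min_eq_right hu, min_eq_right (hu.trans h), max_eq_left]
    · simp
    · linarith [min_le_right (min (v : ℝ) v') T, le_max_left (u : ℝ) u']

theorem memLp_rectangle {u v T : ℝ≥0} (h : u ≤ v) {ξ : Ω → ℝ}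
    {C : ℝ} (hξ : StronglyMeasurable[F u] ξ) (hC : ∀ ω, |ξ ω| ≤ C) :
    MemLp (fun ω => ξ ω * (W (min v T) ω - W (min u T) ω)) 2 P :=
  memLp_bdd_mul (hξ.mono (F.le u)).aestronglyMeasurable (Eventually.of_forall hC)
    (hW.memLp_sub (min_le_min_right T h) 2)

end IsFiltrationBrownian

end Brownian

/-! ### Elementary processes and the isometry for their integrals. -/

section Elementary

variable {Ω : Type*} {mΩ : MeasurableSpace Ω} {P : Measure Ω}
  {F : Filtration ℝ≥0 mΩ} {W : ℝ≥0 → Ω → ℝ}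

/-- The product of Lebesgue measure on `(0, t]` and `P`. -/
noncomputable abbrev timeMeasure (P : Measure Ω) (t : ℝ≥0) : Measure (ℝ × Ω) :=
  (volume.restrict (Set.Ioc 0 (t : ℝ))).prod P

namespace ElementaryProcess

/-- The elementary process as a function on the product space. -/
noncomputable def evalProd (K : ElementaryProcess F) (p : ℝ × Ω) : ℝ := K.eval p.1.toNNReal p.2

theorem measurable_coef' (K : ElementaryProcess F) (i : ℕ) : Measurable (K.coef i) :=
  ((K.measurable_coef i).mono (F.le _)).measurable

theorem evalProd_eq (K : ElementaryProcess F) (p : ℝ × Ω) :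
    K.evalProd p = ∑ i ∈ Finset.range K.n, K.coef i p.2 *
      (Set.Ioc (K.time i) (K.time (i + 1))).indicator (fun _ => (1 : ℝ)) p.1.toNNReal := by
  unfold evalProd eval
  refine Finset.sum_congr rfl fun i _ => ?_
  by_cases h : p.1.toNNReal ∈ Set.Ioc (K.time i) (K.time (i + 1)) <;> simp [h]

theorem measurable_evalProd (K : ElementaryProcess F) : Measurable K.evalProd := by
  have : K.evalProd = fun p => _ := funext K.evalProd_eq
  rw [this]
  refine Finset.measurable_sum _ fun i _ => ?_
  exact ((K.measurable_coef' i).comp measurable_snd).mul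
    ((measurable_const.indicator measurableSet_Ioc).comp
      (measurable_real_toNNReal.comp measurable_fst))

theorem exists_bound (K : ElementaryProcess F) : ∃ C : ℝ, ∀ p, |K.evalProd p| ≤ C := by
  choose c hc using K.bounded_coef
  refine ⟨∑ i ∈ Finset.range K.n, c i, fun p => ?_⟩
  rw [K.evalProd_eq]
  refine (Finset.abs_sum_le_sum_abs _ _).trans (Finset.sum_le_sum fun i _ => ?_)
  rw [abs_mul]
  refine (mul_le_of_le_one_right (abs_nonneg _) ?_).trans (hc i p.2)
  by_cases h : p.1.toNNReal ∈ Set.Ioc (K.time i) (K.time (i + 1)) <;> simp [h]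

theorem memLp_evalProd [IsProbabilityMeasure P] (K : ElementaryProcess F) (t : ℝ≥0) :
    MemLp K.evalProd 2 (timeMeasure P t) := by
  obtain ⟨C, hC⟩ := K.exists_bound
  exact MemLp.of_bound K.measurable_evalProd.aestronglyMeasurable C
    (Eventually.of_forall fun p => by simpa using hC p)

theorem memLp_integral (hW : IsFiltrationBrownian P F W) (K : ElementaryProcess F) (t : ℝ≥0) :
    MemLp (K.integral W t) 2 P := by
  have : K.integral W t = fun ω => ∑ i ∈ Finset.range K.n,
    K.coef i ω * (W (min (K.time (i + 1)) t) ω - W (min (K.time i) t) ω) := rfl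
  rw [this]
  refine memLp_finsetSum _ fun i _ => ?_
  obtain ⟨C, hC⟩ := K.bounded_coef i
  exact hW.memLp_rectangle (K.monotone_time (Nat.le_succ i)) (K.measurable_coef i) hC

/-- The overlap length within `(0, T]`, in the form in which `integral_rectangle_min_mul` produces
it, so that the two sides of the isometry match term by term. -/
theorem setIntegral_indicator_mul (u v u' v' T : ℝ≥0) :
    ∫ s in Set.Ioc 0 (T : ℝ), (Set.Ioc u v).indicator (fun _ => (1 : ℝ)) s.toNNReal *
      (Set.Ioc u' v').indicator (fun _ => (1 : ℝ)) s.toNNReal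
      = max 0 (min (min (v : ℝ) v') T - max (u : ℝ) u') := by
  have h1 : ∀ s ∈ Set.Ioc 0 (T : ℝ), (Set.Ioc u v).indicator (fun _ => (1 : ℝ)) s.toNNReal *
      (Set.Ioc u' v').indicator (fun _ => (1 : ℝ)) s.toNNReal
      = (Set.Ioc (max (u : ℝ) u') (min (v : ℝ) v')).indicator (fun _ => (1 : ℝ)) s := by
    intro s hs
    have e1 : ∀ x : ℝ≥0, x < s.toNNReal ↔ (x : ℝ) < s := fun x => Real.lt_toNNReal_iff_coe_lt
    have e2 : ∀ x : ℝ≥0, s.toNNReal ≤ x ↔ s ≤ (x : ℝ) := fun x => Real.toNNReal_le_iff_le_coe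
    simp only [Set.indicator_apply, Set.mem_Ioc, e1, e2, max_lt_iff, le_min_iff]
    by_cases a1 : (u : ℝ) < s <;> by_cases a2 : s ≤ (v : ℝ) <;> by_cases a3 : (u' : ℝ) < s <;>
      by_cases a4 : s ≤ (v' : ℝ) <;> simp [a1, a2, a3, a4]
  rw [setIntegral_congr_fun measurableSet_Ioc h1, setIntegral_indicator measurableSet_Ioc,
    Set.Ioc_inter_Ioc]
  simp only [integral_const, smul_eq_mul, mul_one, MeasurableSet.univ, measureReal_restrict_apply,
    Set.univ_inter, Real.volume_real_Ioc]
  rw [max_eq_right (le_max_of_le_left u.2 : (0 : ℝ) ≤ max (u : ℝ) u'), max_comm, min_comm]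

/-- The Itô isometry, in bilinear form. -/
theorem integral_integral_mul [IsProbabilityMeasure P] (hW : IsFiltrationBrownian P F W) (K K' : ElementaryProcess F)
    (t : ℝ≥0) :
    ∫ ω, K.integral W t ω * K'.integral W t ω ∂P
      = ∫ p, K.evalProd p * K'.evalProd p ∂(timeMeasure P t) := by
  choose c hc using K.bounded_coef
  choose c' hc' using K'.bounded_coef
  have hle := fun i => K.monotone_time (Nat.le_succ i)
  have hle' := fun i => K'.monotone_time (Nat.le_succ i)
  have lhs : ∀ ω, K.integral W t ω * K'.integral W t ω
      = ∑ i ∈ Finset.range K.n, ∑ j ∈ Finset.range K'.n,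
        K.coef i ω * (W (min (K.time (i + 1)) t) ω - W (min (K.time i) t) ω) *
        (K'.coef j ω * (W (min (K'.time (j + 1)) t) ω - W (min (K'.time j) t) ω)) := by
    intro ω
    unfold integral
    rw [Finset.sum_mul_sum]
  have rhs : ∀ p, K.evalProd p * K'.evalProd p
      = ∑ i ∈ Finset.range K.n, ∑ j ∈ Finset.range K'.n,
        ((Set.Ioc (K.time i) (K.time (i + 1))).indicator (fun _ => (1 : ℝ)) p.1.toNNReal *
          (Set.Ioc (K'.time j) (K'.time (j + 1))).indicator (fun _ => (1 : ℝ)) p.1.toNNReal) *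
        (K.coef i p.2 * K'.coef j p.2) := by
    intro p
    rw [K.evalProd_eq, K'.evalProd_eq, Finset.sum_mul_sum]
    refine Finset.sum_congr rfl fun i _ => Finset.sum_congr rfl fun j _ => ?_
    ring
  have hcoef : ∀ i j, Integrable (fun ω => K.coef i ω * K'.coef j ω) P := fun i j =>
    Integrable.of_bound ((K.measurable_coef' i).mul (K'.measurable_coef' j)).aestronglyMeasurable
      (c i * c' j) (Eventually.of_forall fun ω => by
        rw [norm_mul]
        exact mul_le_mul (hc i ω) (hc' j ω) (abs_nonneg _) ((abs_nonneg _).trans (hc i ω)))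
  have hind : ∀ i j, Integrable (fun s : ℝ =>
      (Set.Ioc (K.time i) (K.time (i + 1))).indicator (fun _ => (1 : ℝ)) s.toNNReal *
      (Set.Ioc (K'.time j) (K'.time (j + 1))).indicator (fun _ => (1 : ℝ)) s.toNNReal)
      (volume.restrict (Set.Ioc 0 (t : ℝ))) := fun i j => by
    refine Integrable.of_bound (C := 1) (Measurable.aestronglyMeasurable ?_)
      (Eventually.of_forall fun s => ?_)
    · exact ((measurable_const.indicator measurableSet_Ioc).comp measurable_real_toNNReal).mul
        ((measurable_const.indicator measurableSet_Ioc).comp measurable_real_toNNReal)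
    · simp only [Set.indicator_apply]
      split_ifs <;> simp
  simp_rw [lhs, rhs]
  rw [integral_finsetSum, integral_finsetSum]
  · refine Finset.sum_congr rfl fun i _ => ?_
    rw [integral_finsetSum, integral_finsetSum]
    · refine Finset.sum_congr rfl fun j _ => ?_
      rw [hW.integral_rectangle_min_mul (hle i) (hle' j) (K.measurable_coef i) (hc i)
        (K'.measurable_coef j) (hc' j), integral_prod_mul (μ := volume.restrict (Set.Ioc 0 (t : ℝ)))
        (fun s : ℝ => (Set.Ioc (K.time i) (K.time (i + 1))).indicator (fun _ => (1 : ℝ)) s.toNNReal *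
          (Set.Ioc (K'.time j) (K'.time (j + 1))).indicator (fun _ => (1 : ℝ)) s.toNNReal)
        (fun ω => K.coef i ω * K'.coef j ω), setIntegral_indicator_mul, mul_comm]
    · exact fun j _ => (hind i j).mul_prod (hcoef i j)
    · exact fun j _ => (hW.memLp_rectangle (hle i) (K.measurable_coef i) (hc i)).integrable_mul
        (hW.memLp_rectangle (hle' j) (K'.measurable_coef j) (hc' j))
  · exact fun i _ => integrable_finsetSum _ fun j _ => (hind i j).mul_prod (hcoef i j)
  · exact fun i _ => integrable_finsetSum _ fun j _ =>
      (hW.memLp_rectangle (hle i) (K.measurable_coef i) (hc i)).integrable_mul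
        (hW.memLp_rectangle (hle' j) (K'.measurable_coef j) (hc' j))

theorem integral_sub_sq {α : Type*} {mα : MeasurableSpace α} {μ : Measure α} {f g : α → ℝ}
    (hf : MemLp f 2 μ) (hg : MemLp g 2 μ) :
    ∫ x, (f x - g x) ^ 2 ∂μ = ∫ x, f x * f x ∂μ - 2 * ∫ x, f x * g x ∂μ + ∫ x, g x * g x ∂μ := by
  have e : ∀ x, (f x - g x) ^ 2 = f x * f x - 2 * (f x * g x) + g x * g x := fun x => by ring
  simp_rw [e]
  rw [integral_add, integral_sub, integral_const_mul]
  · exact hf.integrable_mul hf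
  · exact (hf.integrable_mul hg).const_mul 2
  · exact (hf.integrable_mul hf).sub ((hf.integrable_mul hg).const_mul 2)
  · exact hg.integrable_mul hg

/-- Two elementary processes live on different partitions. Rather than subtracting them on a common
refinement, the square is expanded and the bilinear isometry applied to each term. -/
theorem eLpNorm_integral_sub [IsProbabilityMeasure P] (hW : IsFiltrationBrownian P F W) (K K' : ElementaryProcess F)
    (t : ℝ≥0) :
    eLpNorm (fun ω => K.integral W t ω - K'.integral W t ω) 2 P
      = eLpNorm (fun p => K.evalProd p - K'.evalProd p) 2 (timeMeasure P t) := by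
  have h1 := K.memLp_integral hW t
  have h2 := K'.memLp_integral hW t
  have h3 := K.memLp_evalProd (P := P) t
  have h4 := K'.memLp_evalProd (P := P) t
  rw [eLpNorm_two_eq (f := fun ω => K.integral W t ω - K'.integral W t ω) (h1.sub h2),
    eLpNorm_two_eq (f := fun p => K.evalProd p - K'.evalProd p) (h3.sub h4),
    integral_sub_sq h1 h2, integral_sub_sq h3 h4, integral_integral_mul hW,
    integral_integral_mul hW, integral_integral_mul hW]

end ElementaryProcess

end Elementary
end MeanVariance

namespace MeanVariance

/-! ### The Itô integral: isometry, uniqueness, existence, martingale property. -/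

section Ito

variable {Ω : Type*} {mΩ : MeasurableSpace Ω} {P : Measure Ω} [IsProbabilityMeasure P]
  {F : Filtration ℝ≥0 mΩ} {W : ℝ≥0 → Ω → ℝ}

theorem timeMeasure_mono {s t : ℝ≥0} (hst : s ≤ t) : timeMeasure P s ≤ timeMeasure P t :=
  Measure.prod_mono (Measure.restrict_mono
    (Set.Ioc_subset_Ioc_right (NNReal.coe_le_coe.2 hst)) le_rfl) le_rfl

namespace IsItoIntegral

variable {t : ℝ≥0} {H H' : ℝ≥0 → Ω → ℝ} {X X' : Ω → ℝ}

theorem memLp_integrand {B : ℝ≥0 → Ω → ℝ} (h : IsItoIntegral P F B t H X) :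
    MemLp (fun p : ℝ × Ω => H p.1.toNNReal p.2) 2 (timeMeasure P t) := by
  obtain ⟨K, h1, -⟩ := h.exists_approx
  have h1' : L2Tendsto (timeMeasure P t) (fun n => (K n).evalProd)
    (fun p : ℝ × Ω => H p.1.toNNReal p.2) := h1
  exact h1'.memLp (fun n => (K n).memLp_evalProd t) h.aestronglyMeasurable_integrand

theorem integral_mul (hW : IsFiltrationBrownian P F W) (h : IsItoIntegral P F W t H X)
    (h' : IsItoIntegral P F W t H' X') :
    ∫ ω, X ω * X' ω ∂P
      = ∫ p : ℝ × Ω, H p.1.toNNReal p.2 * H' p.1.toNNReal p.2 ∂(timeMeasure P t) := by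
  obtain ⟨K, h1, h2⟩ := h.exists_approx
  obtain ⟨K', h1', h2'⟩ := h'.exists_approx
  have e1 : L2Tendsto (timeMeasure P t) (fun n => (K n).evalProd)
    (fun p : ℝ × Ω => H p.1.toNNReal p.2) := h1
  have e1' : L2Tendsto (timeMeasure P t) (fun n => (K' n).evalProd)
    (fun p : ℝ × Ω => H' p.1.toNNReal p.2) := h1'
  have e2 : L2Tendsto P (fun n => (K n).integral W t) X := h2
  have e2' : L2Tendsto P (fun n => (K' n).integral W t) X' := h2'
  have l1 := e1.tendsto_integral_mul e1' (fun n => (K n).memLp_evalProd t) h.memLp_integrand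
    (fun n => (K' n).memLp_evalProd t) h'.memLp_integrand
  have l2 := e2.tendsto_integral_mul e2' (fun n => (K n).memLp_integral hW t) h.memLp
    (fun n => (K' n).memLp_integral hW t) h'.memLp
  refine tendsto_nhds_unique l2 (l1.congr fun n => ?_)
  rw [ElementaryProcess.integral_integral_mul hW]

/-- The Itô isometry for differences. -/
theorem integral_sub_sq (hW : IsFiltrationBrownian P F W) (h : IsItoIntegral P F W t H X)
    (h' : IsItoIntegral P F W t H' X') :
    ∫ ω, (X ω - X' ω) ^ 2 ∂P
      = ∫ p : ℝ × Ω, (H p.1.toNNReal p.2 - H' p.1.toNNReal p.2) ^ 2 ∂(timeMeasure P t) := by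
  rw [ElementaryProcess.integral_sub_sq h.memLp h'.memLp,
    ElementaryProcess.integral_sub_sq h.memLp_integrand h'.memLp_integrand, h.integral_mul hW h,
    h.integral_mul hW h', h'.integral_mul hW h']

/-- The isometry for differences, applied with equal integrands. Hence any approximating sequence
may be used to compute with a given Itô integral. -/
theorem unique (hW : IsFiltrationBrownian P F W) (h : IsItoIntegral P F W t H X)
    (h' : IsItoIntegral P F W t H X') : X =ᵐ[P] X' := by
  have h1 := h.integral_sub_sq hW h'
  simp only [sub_self, ne_eq, OfNat.ofNat_ne_zero, not_false_eq_true, zero_pow,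
    integral_zero] at h1
  have hm : MemLp (fun ω => X ω - X' ω) 2 P := h.memLp.sub h'.memLp
  rw [integral_eq_zero_iff_of_nonneg (fun _ => sq_nonneg _) hm.integrable_sq] at h1
  filter_upwards [h1] with ω hω
  simpa [sub_eq_zero] using hω

/-- Along any elementary approximation of the integrand the Itô integral exists. -/
theorem exists_of_approx (hW : IsFiltrationBrownian P F W) (K : ℕ → ElementaryProcess F)
    (hH : AEStronglyMeasurable (fun p : ℝ × Ω => H p.1.toNNReal p.2) (timeMeasure P t))
    (hK : L2Tendsto (timeMeasure P t) (fun n => (K n).evalProd)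
      (fun p : ℝ × Ω => H p.1.toNNReal p.2)) :
    ∃ X, IsItoIntegral P F W t H X ∧ L2Tendsto P (fun n => (K n).integral W t) X := by
  obtain ⟨X, hX, hlim⟩ := exists_l2Tendsto_of_le (fun n => (K n).memLp_integral hW t)
    (fun n => (K n).memLp_evalProd t) (hK.memLp (fun n => (K n).memLp_evalProd t) hH) hK
    (fun n l => (ElementaryProcess.eLpNorm_integral_sub hW (K n) (K l) t).le)
  exact ⟨X, ⟨hH, hX, K, hK, hlim⟩, hlim⟩

end IsItoIntegral

namespace ElementaryProcess

variable (K : ElementaryProcess F)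

omit [IsProbabilityMeasure P] in
theorem stronglyMeasurable_integral (hW : IsFiltrationBrownian P F W) (t : ℝ≥0) :
    StronglyMeasurable[F t] (K.integral W t) := by
  have : K.integral W t = fun ω => ∑ i ∈ Finset.range K.n,
    K.coef i ω * (W (min (K.time (i + 1)) t) ω - W (min (K.time i) t) ω) := rfl
  rw [this]
  refine Finset.stronglyMeasurable_fun_sum _ fun i _ => ?_
  rcases le_total (K.time i) t with h | h
  · exact ((K.measurable_coef i).mono (F.mono h)).mul
      (hW.stronglyMeasurable_sub (min_le_right _ _) (min_le_right _ _))
  · rw [min_eq_right h, min_eq_right (h.trans (K.monotone_time (Nat.le_succ i)))]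
    simp only [sub_self, mul_zero]
    exact stronglyMeasurable_const

omit [IsProbabilityMeasure P] in
/-- Elementary integrals are martingales. -/
theorem integral_integral_mul_of_le (hW : IsFiltrationBrownian P F W) {t T : ℝ≥0} (htT : t ≤ T)
    {Z : Ω → ℝ} (hZ : StronglyMeasurable[F t] Z) (hZL : MemLp Z 2 P) :
    ∫ ω, K.integral W T ω * Z ω ∂P = ∫ ω, K.integral W t ω * Z ω ∂P := by
  choose c hc using K.bounded_coef
  have hle := fun i => K.monotone_time (Nat.le_succ i)
  have hi : ∀ (u : ℝ≥0) i, Integrable (fun ω =>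
      K.coef i ω * (W (min (K.time (i + 1)) u) ω - W (min (K.time i) u) ω) * Z ω) P := fun u i =>
    (hW.memLp_rectangle (hle i) (K.measurable_coef i) (hc i)).integrable_mul hZL
  have e : ∀ u ω, K.integral W u ω * Z ω = ∑ i ∈ Finset.range K.n,
      K.coef i ω * (W (min (K.time (i + 1)) u) ω - W (min (K.time i) u) ω) * Z ω := fun u ω => by
    unfold integral
    rw [Finset.sum_mul]
  simp_rw [e]
  rw [integral_finsetSum _ fun i _ => hi T i, integral_finsetSum _ fun i _ => hi t i]
  refine Finset.sum_congr rfl fun i _ => ?_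
  rcases le_total (K.time (i + 1)) t with h1 | h1
  · have h2 := (hle i).trans h1
    rw [min_eq_left h1, min_eq_left h2, min_eq_left (h1.trans htT), min_eq_left (h2.trans htT)]
  -- From a time `v` on at which both the coefficient and `Z` are known, further increments
  -- contribute nothing. The remaining cases only locate `t` and `T` relative to the interval.
  · have key : ∀ v : ℝ≥0, K.time i ≤ v → t ≤ v → ∀ w, v ≤ w →
        ∫ ω, K.coef i ω * (W w ω - W v ω) * Z ω ∂P = 0 := by
      intro v hv1 hv2 w hw
      rw [← hW.integral_mul_sub_eq_zero hw (ζ := fun ω => K.coef i ω * Z ω)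
        (((K.measurable_coef i).mono (F.mono hv1)).mul (hZ.mono (F.mono hv2)))]
      refine integral_congr_ae (Eventually.of_forall fun ω => ?_)
      ring
    rcases le_total (K.time i) t with h2 | h2
    · rw [min_eq_right h1, min_eq_left h2, min_eq_left (h2.trans htT), ← sub_eq_zero,
        ← integral_sub]
      · rw [← key t h2 le_rfl (min (K.time (i + 1)) T) (le_min h1 htT)]
        refine integral_congr_ae (Eventually.of_forall fun ω => ?_)
        ring
      · have := hi T i
        rwa [min_eq_left (h2.trans htT)] at this
      · have := hi t i
        rwa [min_eq_right h1, min_eq_left h2] at this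
    · rw [min_eq_right h1, min_eq_right h2]
      simp only [sub_self, mul_zero, zero_mul, integral_zero]
      rcases le_total (K.time i) T with h3 | h3
      · rw [min_eq_left h3]
        exact key _ le_rfl h2 _ (le_min (hle i) h3)
      · rw [min_eq_right h3, min_eq_right (h3.trans (hle i))]
        simp

end ElementaryProcess

/-! ### Exponential moments of elementary integrals and of their limits. -/

section Exponential

/-- `x * g` is a convex combination of `D * g` and `-D * g`. The random coefficient moves from the
exponent into the weights, where independence of the increment can be used. -/
theorem exp_mul_le_of_abs_le {D x g : ℝ} (hD : 0 < D) (hx : |x| ≤ D) :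
    Real.exp (x * g) ≤ (1 + x / D) / 2 * Real.exp (D * g) + (1 - x / D) / 2 * Real.exp (-D * g) := by
  obtain ⟨h1, h2⟩ := abs_le.1 hx
  have h3 : x / D ≤ 1 := (div_le_one hD).2 h2
  have h4 : -1 ≤ x / D := by rw [le_div_iff₀ hD]; linarith
  have := convexOn_exp.2 (Set.mem_univ (D * g)) (Set.mem_univ (-D * g))
    (show 0 ≤ (1 + x / D) / 2 by linarith) (show 0 ≤ (1 - x / D) / 2 by linarith) (by ring)
  simp only [smul_eq_mul] at this
  refine le_trans (le_of_eq ?_) this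
  congr 1
  field_simp
  ring

-- After the convexity bound both exponentials have the same mean, because the Gaussian moment
-- generating function is even. The weights add up to one, so the coefficient `x` disappears from
-- the bound.
omit [IsProbabilityMeasure P] in
theorem IsFiltrationBrownian.integral_mul_exp_le (hW : IsFiltrationBrownian P F W) {s u : ℝ≥0}
    (hsu : s ≤ u) {Y x : Ω → ℝ} {D : ℝ} (hD : 0 < D) (hY : StronglyMeasurable[F s] Y)
    (hYi : Integrable Y P) (hY0 : ∀ ω, 0 ≤ Y ω) (hx : StronglyMeasurable[F s] x)
    (hxD : ∀ ω, |x ω| ≤ D) :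
    Integrable (fun ω => Y ω * Real.exp (x ω * (W u ω - W s ω))) P ∧
      ∫ ω, Y ω * Real.exp (x ω * (W u ω - W s ω)) ∂P
        ≤ (∫ ω, Y ω ∂P) * Real.exp (D ^ 2 * (u - s) / 2) := by
  have hb : ∀ ω, |x ω / D| ≤ 1 := fun ω => by
    rw [abs_div, abs_of_pos hD]
    exact (div_le_one hD).2 (hxD ω)
  have hxd : StronglyMeasurable[F s] fun ω => x ω / D := by
    simpa only [div_eq_mul_inv] using hx.mul_const (D⁻¹)
  have hθ : StronglyMeasurable[F s] fun ω => Y ω * (x ω / D) := hY.mul hxd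
  have hθi : Integrable (fun ω => Y ω * (x ω / D)) P :=
    hYi.mul_bdd (c := 1) (hxd.mono (F.le s)).aestronglyMeasurable (Eventually.of_forall hb)
  have m1 : StronglyMeasurable[F s] fun ω => 2⁻¹ * (Y ω + Y ω * (x ω / D)) :=
    (hY.add hθ).const_mul 2⁻¹
  have m2 : StronglyMeasurable[F s] fun ω => 2⁻¹ * (Y ω - Y ω * (x ω / D)) :=
    (hY.sub hθ).const_mul 2⁻¹
  have i1 := hW.integrable_mul hsu m1 ((hYi.add hθi).const_mul 2⁻¹)
    (g := fun z => Real.exp (D * z)) (by fun_prop) (hW.integrable_exp_sub hsu D)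
  have i2 := hW.integrable_mul hsu m2 ((hYi.sub hθi).const_mul 2⁻¹)
    (g := fun z => Real.exp (-D * z)) (by fun_prop) (hW.integrable_exp_sub hsu (-D))
  have hle : ∀ ω, Y ω * Real.exp (x ω * (W u ω - W s ω))
      ≤ 2⁻¹ * (Y ω + Y ω * (x ω / D)) * Real.exp (D * (W u ω - W s ω))
        + 2⁻¹ * (Y ω - Y ω * (x ω / D)) * Real.exp (-D * (W u ω - W s ω)) := fun ω => by
    have := mul_le_mul_of_nonneg_left
      (exp_mul_le_of_abs_le (g := W u ω - W s ω) hD (hxD ω)) (hY0 ω)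
    refine this.trans (le_of_eq ?_)
    ring
  have hmeas : AEStronglyMeasurable (fun ω => Y ω * Real.exp (x ω * (W u ω - W s ω))) P :=
    ((hY.mono (F.le s)).mul (Real.continuous_exp.comp_stronglyMeasurable
      ((hx.mono (F.le s)).mul (hW.measurable_sub s u).stronglyMeasurable))).aestronglyMeasurable
  have hint : Integrable (fun ω => Y ω * Real.exp (x ω * (W u ω - W s ω))) P := by
    refine (i1.add i2).mono' hmeas (Eventually.of_forall fun ω => ?_)
    rw [Real.norm_of_nonneg (mul_nonneg (hY0 ω) (Real.exp_nonneg _))]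
    exact hle ω
  refine ⟨hint, (integral_mono hint (i1.add i2) hle).trans (le_of_eq ?_)⟩
  have e := integral_add i1 i2
  simp only [Pi.add_apply]
  rw [e, hW.integral_mul hsu m1 (g := fun z => Real.exp (D * z)) (by fun_prop),
    hW.integral_mul hsu m2 (g := fun z => Real.exp (-D * z)) (by fun_prop),
    hW.integral_exp_sub hsu, hW.integral_exp_sub hsu, integral_const_mul, integral_const_mul,
    integral_add hYi hθi, integral_sub hYi hθi, neg_sq]
  ring

/-- Elementary integrals of bounded integrands have Gaussian exponential moments. -/
theorem ElementaryProcess.integral_exp_le (hW : IsFiltrationBrownian P F W)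
    (K : ElementaryProcess F) {C : ℝ} (hC : 0 < C) (hK : ∀ i ω, |K.coef i ω| ≤ C) {c : ℝ}
    (hc : c ≠ 0) (t : ℝ≥0) :
    Integrable (fun ω => Real.exp (c * K.integral W t ω)) P ∧
      ∫ ω, Real.exp (c * K.integral W t ω) ∂P ≤ Real.exp ((|c| * C) ^ 2 * t / 2) := by
  set D := |c| * C with hDdef
  have hD : 0 < D := mul_pos (abs_pos.2 hc) hC
  -- Induction on the number of intervals: the last increment costs a factor `exp (D² Δ / 2)`, and
  -- the lengths `Δ` add up to at most `min (K.time m) t`.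
  have key : ∀ m : ℕ,
      Integrable (fun ω => Real.exp (c * ∑ i ∈ Finset.range m,
        K.coef i ω * (W (min (K.time (i + 1)) t) ω - W (min (K.time i) t) ω))) P ∧
      ∫ ω, Real.exp (c * ∑ i ∈ Finset.range m,
        K.coef i ω * (W (min (K.time (i + 1)) t) ω - W (min (K.time i) t) ω)) ∂P
        ≤ Real.exp (D ^ 2 * (min (K.time m) t : ℝ≥0) / 2) := by
    intro m
    induction m with
    | zero =>
      simp only [Finset.range_zero, Finset.sum_empty, mul_zero, Real.exp_zero]
      refine ⟨integrable_const _, ?_⟩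
      simp only [integral_const, probReal_univ, smul_eq_mul, mul_one]
      -- The first partition point need not be `0`, so already the base case is only an inequality.
      exact Real.one_le_exp (by positivity)
    | succ m ih =>
      obtain ⟨ih1, ih2⟩ := ih
      have hle := K.monotone_time (Nat.le_succ m)
      rcases le_total (K.time m) t with h | h
      · have hY : StronglyMeasurable[F (K.time m)] fun ω => Real.exp (c * ∑ i ∈ Finset.range m,
            K.coef i ω * (W (min (K.time (i + 1)) t) ω - W (min (K.time i) t) ω)) := by
          refine Real.continuous_exp.comp_stronglyMeasurable
            (StronglyMeasurable.const_mul (Finset.stronglyMeasurable_fun_sum _ fun i hi => ?_) c)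
          have hi' := Finset.mem_range.1 hi
          exact ((K.measurable_coef i).mono (F.mono (K.monotone_time hi'.le))).mul
            (hW.stronglyMeasurable_sub
              ((min_le_left _ _).trans (K.monotone_time hi'.le))
              ((min_le_left _ _).trans (K.monotone_time hi')))
        have hx : StronglyMeasurable[F (K.time m)] fun ω => c * K.coef m ω :=
          (K.measurable_coef m).const_mul c
        have hxD : ∀ ω, |c * K.coef m ω| ≤ D := fun ω => by
          rw [abs_mul]
          exact mul_le_mul_of_nonneg_left (hK m ω) (abs_nonneg _)
        have hst : K.time m ≤ min (K.time (m + 1)) t := le_min hle h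
        obtain ⟨s1, s2⟩ := hW.integral_mul_exp_le hst hD hY ih1 (fun _ => Real.exp_nonneg _) hx hxD
        have e : ∀ ω, Real.exp (c * ∑ i ∈ Finset.range (m + 1),
            K.coef i ω * (W (min (K.time (i + 1)) t) ω - W (min (K.time i) t) ω))
            = Real.exp (c * ∑ i ∈ Finset.range m,
              K.coef i ω * (W (min (K.time (i + 1)) t) ω - W (min (K.time i) t) ω)) *
              Real.exp (c * K.coef m ω * (W (min (K.time (m + 1)) t) ω - W (K.time m) ω)) := by
          intro ω
          rw [Finset.sum_range_succ, ← Real.exp_add, min_eq_left h]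
          congr 1
          ring
        simp_rw [e]
        refine ⟨s1, s2.trans ?_⟩
        refine (mul_le_mul_of_nonneg_right ih2 (Real.exp_nonneg _)).trans (le_of_eq ?_)
        rw [← Real.exp_add, min_eq_left h]
        congr 1
        ring
      · simp_rw [Finset.sum_range_succ]
        rw [min_eq_right h] at ih2
        rw [min_eq_right h, min_eq_right (h.trans hle)]
        simp only [sub_self, mul_zero, add_zero]
        exact ⟨ih1, ih2⟩
  obtain ⟨k1, k2⟩ := key K.n
  refine ⟨k1, k2.trans (Real.exp_le_exp.2 ?_)⟩
  have : ((min (K.time K.n) t : ℝ≥0) : ℝ) ≤ t := NNReal.coe_le_coe.2 (min_le_right _ _)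
  have h2 := mul_le_mul_of_nonneg_left this (sq_nonneg D)
  linarith

omit [IsProbabilityMeasure P] in
/-- Exponential moments pass to `L²` limits. -/
theorem integrable_exp_of_l2Tendsto {X : ℕ → Ω → ℝ} {Y : Ω → ℝ} {B : ℝ} (h : L2Tendsto P X Y)
    (hX : ∀ n, AEStronglyMeasurable (X n) P) (hY : AEStronglyMeasurable Y P) (c : ℝ)
    (hi : ∀ n, Integrable (fun ω => Real.exp (c * X n ω)) P)
    (hB : ∀ n, ∫ ω, Real.exp (c * X n ω) ∂P ≤ B) :
    Integrable (fun ω => Real.exp (c * Y ω)) P := by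
  -- Fatou's lemma is applied along an almost surely convergent subsequence.
  obtain ⟨φ, -, hφ⟩ := h.exists_subseq hX hY
  refine ⟨Real.continuous_exp.comp_aestronglyMeasurable (hY.const_mul c), ?_⟩
  rw [hasFiniteIntegral_iff_ofReal (Eventually.of_forall fun _ => Real.exp_nonneg _)]
  have h1 : ∫⁻ ω, ENNReal.ofReal (Real.exp (c * Y ω)) ∂P
      = ∫⁻ ω, liminf (fun n => ENNReal.ofReal (Real.exp (c * X (φ n) ω))) atTop ∂P := by
    refine lintegral_congr_ae ?_
    filter_upwards [hφ] with ω hω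
    refine (Tendsto.liminf_eq ?_).symm
    exact ENNReal.tendsto_ofReal ((Real.continuous_exp.tendsto _).comp (hω.const_mul c))
  rw [h1]
  refine (lintegral_liminf_le' fun n => (hi (φ n)).1.aemeasurable.ennreal_ofReal).trans_lt ?_
  refine lt_of_le_of_lt (liminf_le_of_le (a := ENNReal.ofReal B) (by isBoundedDefault) ?_)
    ENNReal.ofReal_lt_top
  intro b hb
  obtain ⟨n, hn⟩ := hb.exists
  refine hn.trans ?_
  rw [← ofReal_integral_eq_lintegral_ofReal (hi _)
    (Eventually.of_forall fun _ => Real.exp_nonneg _)]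
  exact ENNReal.ofReal_le_ofReal (hB _)

end Exponential

end Ito
end MeanVariance

namespace MeanVariance

/-! ### Uniform grids, joint measurability, and exponential martingale increments. -/

section Grid

variable {Ω : Type*} {mΩ : MeasurableSpace Ω} {P : Measure Ω} {F : Filtration ℝ≥0 mΩ}
  {W : ℝ≥0 → Ω → ℝ}

namespace ElementaryProcess

theorem eval_eq_of_mem (K : ElementaryProcess F) {i : ℕ} (hi : i < K.n) {s : ℝ≥0}
    (hs : s ∈ Set.Ioc (K.time i) (K.time (i + 1))) (ω : Ω) : K.eval s ω = K.coef i ω := by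
  unfold eval
  rw [Finset.sum_eq_single i]
  · rw [Set.indicator_of_mem hs]
  · intro j _ hj
    refine Set.indicator_of_notMem (fun hj' => ?_) _
    rcases lt_or_gt_of_ne hj with h | h
    · exact absurd (hs.1.trans_le hj'.2) (not_lt.2 (K.monotone_time h))
    · exact absurd (hj'.1.trans_le hs.2) (not_lt.2 (K.monotone_time h))
  · exact fun h => absurd (Finset.mem_range.2 hi) h

/-- The elementary process with values `ξ_i` on the `N` intervals of the uniform grid of
`(0, t]`. -/
noncomputable def grid (t : ℝ≥0) (N : ℕ) (ξ : ℕ → Ω → ℝ)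
    (hξ : ∀ i : ℕ, StronglyMeasurable[F (i * (t / N))] (ξ i))
    (hb : ∀ i, ∃ C : ℝ, ∀ ω, |ξ i ω| ≤ C) : ElementaryProcess F where
  n := N
  time i := i * (t / N)
  monotone_time _ _ hij := mul_le_mul_left (Nat.cast_le.2 hij) _
  coef := ξ
  measurable_coef := hξ
  bounded_coef := hb

/-- The right endpoint is the first grid point not below `s`; it is not the zeroth one since `s` is
positive. -/
theorem exists_mem_grid {t : ℝ≥0} {N : ℕ} (hN : N ≠ 0) {s : ℝ≥0} (hs : s ∈ Set.Ioc 0 t) :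
    ∃ i < N, s ∈ Set.Ioc ((i : ℝ≥0) * (t / N)) (((i + 1 : ℕ) : ℝ≥0) * (t / N)) := by
  have ht : 0 < t := hs.1.trans_le hs.2
  have hN' : (0 : ℝ≥0) < N := Nat.cast_pos.2 (Nat.pos_of_ne_zero hN)
  have hh : 0 < t / N := div_pos ht hN'
  have hex : ∃ k : ℕ, s ≤ (k : ℝ≥0) * (t / N) := ⟨N, by
    rw [mul_div_cancel₀ _ hN'.ne']; exact hs.2⟩
  classical
  have hpos : Nat.find hex ≠ 0 := by
    intro h0
    have := Nat.find_spec hex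
    rw [h0] at this
    simp only [Nat.cast_zero, zero_mul] at this
    exact absurd hs.1 (not_lt.2 this)
  obtain ⟨i, hi⟩ := Nat.exists_eq_succ_of_ne_zero hpos
  refine ⟨i, ?_, ?_, ?_⟩
  · have : Nat.find hex ≤ N := Nat.find_min' hex (by rw [mul_div_cancel₀ _ hN'.ne']; exact hs.2)
    omega
  · have := Nat.find_min hex (m := i) (by omega)
    exact not_le.1 this
  · have := Nat.find_spec hex
    rwa [hi] at this

/-- The pathwise time integral of an elementary process against a density. -/
theorem setIntegral_eval_mul (K : ElementaryProcess F) (T : ℝ≥0) {θ : ℝ → ℝ}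
    (hθ : IntegrableOn θ (Set.Ioc 0 (T : ℝ))) (ω : Ω) :
    ∫ s in Set.Ioc 0 (T : ℝ), K.eval s.toNNReal ω * θ s
      = ∑ i ∈ Finset.range K.n, K.coef i ω *
        ∫ s in ((min (K.time i) T : ℝ≥0) : ℝ)..((min (K.time (i + 1)) T : ℝ≥0) : ℝ), θ s := by
  have e : ∀ s : ℝ, K.eval s.toNNReal ω * θ s = ∑ i ∈ Finset.range K.n, K.coef i ω *
      ((Set.Ioc (K.time i) (K.time (i + 1))).indicator (fun _ => (1 : ℝ)) s.toNNReal * θ s) := by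
    intro s
    have := K.evalProd_eq (s, ω)
    unfold evalProd at this
    rw [this, Finset.sum_mul]
    exact Finset.sum_congr rfl fun i _ => by ring
  have hind : ∀ i, IntegrableOn (fun s : ℝ =>
      (Set.Ioc (K.time i) (K.time (i + 1))).indicator (fun _ => (1 : ℝ)) s.toNNReal * θ s)
      (Set.Ioc 0 (T : ℝ)) := fun i => by
    refine Integrable.bdd_mul (c := 1) hθ ?_ (Eventually.of_forall fun s => ?_)
    · exact ((measurable_const.indicator measurableSet_Ioc).comp
        measurable_real_toNNReal).aestronglyMeasurable
    · simp only [Set.indicator_apply]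
      split_ifs <;> simp
  simp_rw [e]
  rw [integral_finsetSum _ fun i _ => (hind i).const_mul _]
  refine Finset.sum_congr rfl fun i _ => ?_
  rw [integral_const_mul]
  congr 1
  have hle := K.monotone_time (Nat.le_succ i)
  rw [intervalIntegral.integral_of_le (NNReal.coe_le_coe.2 (min_le_min_right T hle))]
  have h1 : ∀ s ∈ Set.Ioc 0 (T : ℝ),
      (Set.Ioc (K.time i) (K.time (i + 1))).indicator (fun _ => (1 : ℝ)) s.toNNReal * θ s
      = (Set.Ioc ((min (K.time i) T : ℝ≥0) : ℝ) ((min (K.time (i + 1)) T : ℝ≥0) : ℝ)).indicator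
        θ s := by
    intro s hs
    have e1 : ∀ x : ℝ≥0, x < s.toNNReal ↔ (x : ℝ) < s := fun x => Real.lt_toNNReal_iff_coe_lt
    have e2 : ∀ x : ℝ≥0, s.toNNReal ≤ x ↔ s ≤ (x : ℝ) := fun x => Real.toNNReal_le_iff_le_coe
    have hs2 := hs.2
    simp only [Set.indicator_apply, Set.mem_Ioc, e1, e2, NNReal.coe_min, min_lt_iff, le_min_iff,
      hs2, and_true, not_lt.2 hs2, or_false]
    split_ifs <;> simp
  rw [setIntegral_congr_fun measurableSet_Ioc h1, setIntegral_indicator measurableSet_Ioc]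
  congr 2
  rw [Set.Ioc_inter_Ioc]
  congr 1
  · exact max_eq_right (NNReal.coe_nonneg _)
  · exact min_eq_right (NNReal.coe_le_coe.2 (min_le_right _ _))

theorem setIntegral_eval (K : ElementaryProcess F) (T : ℝ≥0) (ω : Ω) :
    ∫ s in Set.Ioc 0 (T : ℝ), K.eval s.toNNReal ω
      = ∑ i ∈ Finset.range K.n, K.coef i ω *
        (((min (K.time (i + 1)) T : ℝ≥0) : ℝ) - ((min (K.time i) T : ℝ≥0) : ℝ)) := by
  have := K.setIntegral_eval_mul T (θ := fun _ => 1) (integrableOn_const (by simp)) ω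
  simpa using this

end ElementaryProcess

theorem memLp_timeMeasure_of_section [IsProbabilityMeasure P] {t : ℝ≥0} {f : ℝ × Ω → ℝ}
    (hf : AEStronglyMeasurable f (timeMeasure P t)) {B : ℝ}
    (hs : ∀ s ∈ Set.Ioc 0 (t : ℝ), MemLp (fun ω => f (s, ω)) 2 P)
    (hB : ∀ s ∈ Set.Ioc 0 (t : ℝ), ∫ ω, f (s, ω) ^ 2 ∂P ≤ B) :
    MemLp f 2 (timeMeasure P t) ∧ ∫ p, f p ^ 2 ∂(timeMeasure P t) ≤ t * B := by
  have h1 : ∫⁻ p, ENNReal.ofReal (f p ^ 2) ∂(timeMeasure P t) ≤ ENNReal.ofReal (t * B) := by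
    rw [lintegral_prod _ (hf.aemeasurable.pow_const 2).ennreal_ofReal]
    have : ∫⁻ s in Set.Ioc 0 (t : ℝ), ∫⁻ ω, ENNReal.ofReal (f (s, ω) ^ 2) ∂P
        ≤ ∫⁻ _ in Set.Ioc 0 (t : ℝ), ENNReal.ofReal B := by
      refine setLIntegral_mono measurable_const fun s hs' => ?_
      rw [← ofReal_integral_eq_lintegral_ofReal (hs s hs').integrable_sq
        (Eventually.of_forall fun _ => sq_nonneg _)]
      exact ENNReal.ofReal_le_ofReal (hB s hs')
    refine this.trans (le_of_eq ?_)
    rw [setLIntegral_const, Real.volume_Ioc, sub_zero, mul_comm, ENNReal.ofReal_mul t.coe_nonneg]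
  have hi : Integrable (fun p => f p ^ 2) (timeMeasure P t) := by
    refine ⟨hf.pow 2, ?_⟩
    rw [hasFiniteIntegral_iff_ofReal (Eventually.of_forall fun _ => sq_nonneg _)]
    exact h1.trans_lt ENNReal.ofReal_lt_top
  refine ⟨(memLp_two_iff_integrable_sq hf).2 hi, ?_⟩
  -- For `t = 0` the hypothesis `hB` is vacuous and says nothing about the sign of `B`; then the
  -- measure itself is zero.
  rcases t.2.eq_or_lt with h0 | h0
  · have hz : timeMeasure P t = 0 := by
      have : (t : ℝ) = 0 := h0.symm
      simp [timeMeasure, this]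
    rw [hz]
    have : (t : ℝ) = 0 := h0.symm
    simp [this]
  · have hB0 : 0 ≤ B := (integral_nonneg fun _ => sq_nonneg _).trans (hB t ⟨h0, le_rfl⟩)
    rw [← ofReal_integral_eq_lintegral_ofReal hi
      (Eventually.of_forall fun _ => sq_nonneg _)] at h1
    exact (ENNReal.ofReal_le_ofReal_iff (mul_nonneg t.2 hB0)).1 h1

namespace IsFiltrationBrownian

variable (hW : IsFiltrationBrownian P F W)
include hW

/-- Paths are continuous only almost surely. Setting `W` to zero on a measurable null set containing
the bad paths gives continuity everywhere, hence joint measurability. -/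
theorem aemeasurable_uncurry [SFinite P] {ν : Measure ℝ} [SFinite ν] :
    AEMeasurable (fun p : ℝ × Ω => W p.1.toNNReal p.2) (ν.prod P) := by
  obtain ⟨G, hGsub, hGm, hG0⟩ := exists_measurable_superset_of_null
    (ae_iff.1 hW.isBrownian.cont)
  have hcont : ∀ ω, Continuous fun t => Gᶜ.indicator (W t) ω := by
    intro ω
    by_cases hω : ω ∈ Gᶜ
    · simp only [Set.indicator_of_mem hω]
      by_contra hc
      exact hω (hGsub hc)
    · simp only [Set.indicator_of_notMem hω]
      exact continuous_const
  have hm : Measurable (Function.uncurry fun t ω => Gᶜ.indicator (W t) ω) :=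
    measurable_uncurry_of_continuous_of_measurable (u := fun t ω => Gᶜ.indicator (W t) ω) hcont
      fun t => (hW.measurable t).indicator hGm.compl
  refine ⟨fun p => Gᶜ.indicator (W p.1.toNNReal) p.2, hm.comp
    ((measurable_real_toNNReal.comp measurable_fst).prodMk measurable_snd), ?_⟩
  have hGae : ∀ᵐ ω ∂P, ω ∈ Gᶜ := by
    rw [ae_iff]; simpa using hG0
  filter_upwards [Measure.quasiMeasurePreserving_snd.ae hGae] with p hp
  rw [Set.indicator_of_mem hp]

/-- Orthogonality of martingale increments. -/
theorem integral_sum_mul_sq [IsProbabilityMeasure P] {τ : ℕ → ℝ≥0} (hτ : Monotone τ) {ξ : ℕ → Ω → ℝ} {g : ℝ → ℝ}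
    (hg : Measurable g) (hξ : ∀ i, StronglyMeasurable[F (τ i)] (ξ i)) (hξL : ∀ i, MemLp (ξ i) 2 P)
    (hgL : ∀ i, MemLp (fun ω => g (W (τ (i + 1)) ω - W (τ i) ω)) 2 P)
    (hg0 : ∀ i, ∫ ω, g (W (τ (i + 1)) ω - W (τ i) ω) ∂P = 0) (n : ℕ) :
    MemLp (fun ω => ∑ i ∈ Finset.range n, ξ i ω * g (W (τ (i + 1)) ω - W (τ i) ω)) 2 P ∧
    ∫ ω, (∑ i ∈ Finset.range n, ξ i ω * g (W (τ (i + 1)) ω - W (τ i) ω)) ^ 2 ∂P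
      = ∑ i ∈ Finset.range n, (∫ ω, ξ i ω ^ 2 ∂P) *
        ∫ ω, g (W (τ (i + 1)) ω - W (τ i) ω) ^ 2 ∂P := by
  have hle := fun i => hτ (Nat.le_succ i)
  have hterm := fun i => hW.memLp_mul (hle i) (hξ i) (hξL i) hg (hgL i)
  have hsum : ∀ n, MemLp (fun ω => ∑ i ∈ Finset.range n,
      ξ i ω * g (W (τ (i + 1)) ω - W (τ i) ω)) 2 P := fun n =>
    memLp_finsetSum _ fun i _ => hterm i
  refine ⟨hsum n, ?_⟩
  induction n with
  | zero => simp
  | succ n ih =>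
    set M : Ω → ℝ := fun ω => ∑ i ∈ Finset.range n,
      ξ i ω * g (W (τ (i + 1)) ω - W (τ i) ω) with hM
    have hMm : StronglyMeasurable[F (τ n)] M := by
      refine Finset.stronglyMeasurable_fun_sum _ fun i hi => ?_
      have hi' := Finset.mem_range.1 hi
      refine ((hξ i).mono (F.mono (hτ hi'.le))).mul ?_
      exact (hg.comp (hW.stronglyMeasurable_sub (hτ hi'.le) (hτ hi')).measurable).stronglyMeasurable
    have hMi : Integrable (fun ω => M ω * ξ n ω) P := (hsum n).integrable_mul (hξL n)
    have hMξ : StronglyMeasurable[F (τ n)] fun ω => M ω * ξ n ω := hMm.mul (hξ n)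
    have e : ∀ ω, (∑ i ∈ Finset.range (n + 1), ξ i ω * g (W (τ (i + 1)) ω - W (τ i) ω)) ^ 2
        = M ω ^ 2 + 2 * (M ω * ξ n ω * g (W (τ (n + 1)) ω - W (τ n) ω))
          + ξ n ω ^ 2 * g (W (τ (n + 1)) ω - W (τ n) ω) ^ 2 := fun ω => by
      rw [Finset.sum_range_succ]; simp only [hM]; ring
    have i1 : Integrable (fun ω => M ω ^ 2) P := (hsum n).integrable_sq
    have i2 : Integrable (fun ω => 2 * (M ω * ξ n ω * g (W (τ (n + 1)) ω - W (τ n) ω))) P :=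
      (hW.integrable_mul (hle n) hMξ hMi hg ((hgL n).integrable (by norm_num))).const_mul 2
    have i3 : Integrable (fun ω => ξ n ω ^ 2 * g (W (τ (n + 1)) ω - W (τ n) ω) ^ 2) P := by
      have := (hterm n).integrable_sq
      simpa only [mul_pow] using this
    simp_rw [e]
    rw [integral_add (i1.fun_add i2) i3, integral_add i1 i2, ih, Finset.sum_range_succ,
      integral_const_mul, hW.integral_mul (hle n) hMξ hg, hg0 n,
      hW.integral_mul (hle n) (ζ := fun ω => ξ n ω ^ 2) ((hξ n).pow 2) (g := fun x => g x ^ 2) (hg.pow_const 2)]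
    simp

theorem memLp_exp_sub [IsProbabilityMeasure P] {s t : ℝ≥0} (hst : s ≤ t) (c : ℝ) :
    MemLp (fun ω => Real.exp (c * (W t ω - W s ω))) 2 P := by
  rw [memLp_two_iff_integrable_sq (Real.continuous_exp.comp_aestronglyMeasurable
    ((hW.measurable_sub s t).aestronglyMeasurable.const_mul c))]
  have := hW.integrable_exp_sub hst (2 * c)
  refine this.congr (Eventually.of_forall fun ω => ?_)
  simp only
  rw [← Real.exp_nat_mul]
  congr 1
  push_cast; ring

/-- The second order remainder of an exponential martingale increment. -/
theorem exp_remainder [IsProbabilityMeasure P] {s t : ℝ≥0} (hst : s ≤ t) :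
    MemLp (fun ω => Real.exp (W t ω - W s ω - ((t : ℝ) - s) / 2) - 1 - (W t ω - W s ω)) 2 P ∧
    ∫ ω, (Real.exp (W t ω - W s ω - ((t : ℝ) - s) / 2) - 1 - (W t ω - W s ω)) ∂P = 0 ∧
    ∫ ω, (Real.exp (W t ω - W s ω - ((t : ℝ) - s) / 2) - 1 - (W t ω - W s ω)) ^ 2 ∂P
      = Real.exp ((t : ℝ) - s) - 1 - (t - s) := by
  set h : ℝ := (t : ℝ) - s with hh
  set X : Ω → ℝ := fun ω => W t ω - W s ω with hX
  have e1 : ∫ ω, Real.exp (X ω) ∂P = Real.exp (h / 2) := by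
    have := hW.integral_exp_sub hst 1
    simpa using this
  have e2 : ∫ ω, Real.exp (X ω) ^ 2 ∂P = Real.exp (2 * h) := by
    have := hW.integral_exp_sub hst 2
    have e : ∀ ω, Real.exp (X ω) ^ 2 = Real.exp (2 * (W t ω - W s ω)) := fun ω => by
      rw [← Real.exp_nat_mul]; rfl
    simp_rw [e]
    rw [this]; congr 1; ring
  have e3 : ∫ ω, X ω * Real.exp (X ω) ∂P = h * Real.exp (h / 2) := hW.integral_mul_exp_sub hst
  have e4 : ∫ ω, X ω ∂P = 0 := hW.integral_sub_eq_zero hst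
  have e5 : ∫ ω, X ω ^ 2 ∂P = h := hW.integral_sub_sq hst
  have m1 : MemLp (fun ω => Real.exp (X ω)) 2 P := by
    have := hW.memLp_exp_sub hst 1
    simpa using this
  have m2 : MemLp X 2 P := hW.memLp_sub hst 2
  have i1 := m1.integrable (by norm_num)
  have i2 := m2.integrable (by norm_num)
  have eq : ∀ ω, Real.exp (X ω - h / 2) = Real.exp (-(h / 2)) * Real.exp (X ω) := fun ω => by
    rw [← Real.exp_add]; congr 1; ring
  change MemLp (fun ω => Real.exp (X ω - h / 2) - 1 - X ω) 2 P ∧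
    ∫ ω, (Real.exp (X ω - h / 2) - 1 - X ω) ∂P = 0 ∧
    ∫ ω, (Real.exp (X ω - h / 2) - 1 - X ω) ^ 2 ∂P = Real.exp h - 1 - h
  simp_rw [eq]
  -- The factor `k` normalises `exp X` to mean one. After expansion of the square, `hk1` and `hk2`
  -- are the only relations needed.
  set k := Real.exp (-(h / 2)) with hk
  have hk1 : k * Real.exp (h / 2) = 1 := by rw [hk, ← Real.exp_add]; simp
  have hk2 : k ^ 2 * Real.exp (2 * h) = Real.exp h := by
    rw [hk, ← Real.exp_nat_mul, ← Real.exp_add]; congr 1; push_cast; ring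
  refine ⟨((m1.const_mul k).sub (memLp_const 1)).sub m2, ?_, ?_⟩
  · rw [integral_sub (f := fun ω => k * Real.exp (X ω) - 1)
      ((i1.const_mul k).sub (integrable_const 1)) i2,
      integral_sub (i1.const_mul k) (integrable_const 1), integral_const_mul, e1, e4, hk1]
    simp
  · have e : ∀ ω, (k * Real.exp (X ω) - 1 - X ω) ^ 2
        = k ^ 2 * Real.exp (X ω) ^ 2 + (-2 * k) * Real.exp (X ω)
          + (-2 * k) * (X ω * Real.exp (X ω)) + (X ω ^ 2 + 2 * X ω) + 1 := fun ω => by ring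
    have j1 : Integrable (fun ω => k ^ 2 * Real.exp (X ω) ^ 2) P := m1.integrable_sq.const_mul _
    have j2 : Integrable (fun ω => (-2 * k) * Real.exp (X ω)) P := i1.const_mul _
    have j3 : Integrable (fun ω => (-2 * k) * (X ω * Real.exp (X ω))) P :=
      (m2.integrable_mul m1).const_mul _
    have j4 : Integrable (fun ω => X ω ^ 2 + 2 * X ω) P := m2.integrable_sq.add (i2.const_mul _)
    simp_rw [e]
    have j12 : Integrable (fun ω => k ^ 2 * Real.exp (X ω) ^ 2 + (-2 * k) * Real.exp (X ω)) P :=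
      j1.add j2
    have j13 : Integrable (fun ω => k ^ 2 * Real.exp (X ω) ^ 2 + (-2 * k) * Real.exp (X ω)
      + (-2 * k) * (X ω * Real.exp (X ω))) P := j12.add j3
    have j14 : Integrable (fun ω => k ^ 2 * Real.exp (X ω) ^ 2 + (-2 * k) * Real.exp (X ω)
      + (-2 * k) * (X ω * Real.exp (X ω)) + (X ω ^ 2 + 2 * X ω)) P := j13.add j4
    rw [integral_add j14 (integrable_const _), integral_add j13 j4, integral_add j12 j3,
      integral_add j1 j2,
      integral_add m2.integrable_sq (i2.const_mul _), integral_const_mul, integral_const_mul,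
      integral_const_mul, integral_const_mul, e1, e2, e3, e4, e5]
    simp only [integral_const, probReal_univ, smul_eq_mul, mul_one]
    linear_combination hk2 - (2 + 2 * h) * hk1

end IsFiltrationBrownian

end Grid
end MeanVariance

namespace MeanVariance

/-! ### Geometric Brownian motion: moments and modulus of continuity. -/

section GBM

variable {Ω : Type*} {mΩ : MeasurableSpace Ω} {P : Measure Ω} {F : Filtration ℝ≥0 mΩ}
  {W : ℝ≥0 → Ω → ℝ}

theorem memLp_integral_sq_le_of_abs_le {α : Type*} {mα : MeasurableSpace α} {ν : Measure α}
    {f g : α → ℝ} {c : ℝ} (hf : AEStronglyMeasurable f ν) (hg : MemLp g 2 ν)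
    (h : ∀ x, |f x| ≤ c * |g x|) :
    MemLp f 2 ν ∧ ∫ x, f x ^ 2 ∂ν ≤ c ^ 2 * ∫ x, g x ^ 2 ∂ν := by
  have hfL : MemLp f 2 ν := MemLp.of_le_mul (c := c) hg hf (Eventually.of_forall h)
  refine ⟨hfL, ?_⟩
  rw [← integral_const_mul]
  refine integral_mono hfL.integrable_sq (hg.integrable_sq.const_mul _) fun x => ?_
  have := pow_le_pow_left₀ (abs_nonneg _) (h x) 2
  simpa only [mul_pow, sq_abs] using this

theorem integral_add_sq_le {α : Type*} {mα : MeasurableSpace α} {ν : Measure α}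
    {f g : α → ℝ} (hf : MemLp f 2 ν) (hg : MemLp g 2 ν) :
    ∫ x, (f x + g x) ^ 2 ∂ν ≤ 2 * ∫ x, f x ^ 2 ∂ν + 2 * ∫ x, g x ^ 2 ∂ν := by
  rw [← integral_const_mul, ← integral_const_mul,
    ← integral_add (hf.integrable_sq.const_mul _) (hg.integrable_sq.const_mul _)]
  refine integral_mono (MemLp.integrable_sq (f := fun x => f x + g x) (hf.add hg))
    ((hf.integrable_sq.const_mul _).add (hg.integrable_sq.const_mul _)) fun x => ?_
  nlinarith [sq_nonneg (f x - g x)]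

theorem integral_sum_sq_le {α : Type*} {mα : MeasurableSpace α} {ν : Measure α}
    {f : ℕ → α → ℝ} (hf : ∀ i, MemLp (f i) 2 ν) (N : ℕ) :
    ∫ x, (∑ i ∈ Finset.range N, f i x) ^ 2 ∂ν
      ≤ N * ∑ i ∈ Finset.range N, ∫ x, f i x ^ 2 ∂ν := by
  rw [← integral_finsetSum _ fun i _ => (hf i).integrable_sq, ← integral_const_mul]
  refine integral_mono (memLp_finsetSum _ fun i _ => hf i).integrable_sq
    ((integrable_finsetSum _ fun i _ => (hf i).integrable_sq).const_mul _) fun x => ?_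
  simpa using sq_sum_le_card_mul_sum_sq (s := Finset.range N) (f := fun i => f i x)

/-- Geometric Brownian motion with an `F 0`-measurable drift. -/
noncomputable def gbm (W : ℝ≥0 → Ω → ℝ) (μ : Ω → ℝ) (x₀ : ℝ) (t : ℝ≥0) (ω : Ω) : ℝ :=
  x₀ * Real.exp ((μ ω - 1 / 2) * t + (W t ω - W 0 ω))

variable {μ : Ω → ℝ} {x₀ m : ℝ}

theorem gbm_pos (hx : 0 < x₀) (t : ℝ≥0) (ω : Ω) : 0 < gbm W μ x₀ t ω :=
  mul_pos hx (Real.exp_pos _)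

theorem gbm_zero (ω : Ω) : gbm W μ x₀ 0 ω = x₀ := by simp [gbm]

/-- One step separates into a drift factor known at time `s`, when `μ` is, and an exponential
martingale factor depending only on the increment of `W`. -/
theorem gbm_eq_mul (s t : ℝ≥0) (ω : Ω) :
    gbm W μ x₀ t ω = gbm W μ x₀ s ω * Real.exp (μ ω * (t - s)) *
      Real.exp (W t ω - W s ω - ((t : ℝ) - s) / 2) := by
  unfold gbm
  rw [mul_assoc, mul_assoc, ← Real.exp_add, ← Real.exp_add]
  congr 2
  ring

theorem stronglyMeasurable_gbm (hW : IsFiltrationBrownian P F W) (hμ : StronglyMeasurable[F 0] μ)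
    (t : ℝ≥0) : StronglyMeasurable[F t] (gbm W μ x₀ t) := by
  have h1 : StronglyMeasurable[F t] fun ω => (μ ω - 1 / 2) * t + (W t ω - W 0 ω) :=
    (((hμ.mono (F.mono (zero_le (a := t)))).sub stronglyMeasurable_const).mul
      stronglyMeasurable_const).add (hW.stronglyMeasurable_sub zero_le le_rfl)
  exact (Real.continuous_exp.comp_stronglyMeasurable h1).const_mul x₀

theorem aestronglyMeasurable_gbm_uncurry [IsProbabilityMeasure P] (hW : IsFiltrationBrownian P F W)
    (hμ : StronglyMeasurable[F 0] μ) {ν : Measure ℝ} [SFinite ν] :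
    AEStronglyMeasurable (fun p : ℝ × Ω => gbm W μ x₀ p.1.toNNReal p.2) (ν.prod P) := by
  refine AEMeasurable.aestronglyMeasurable ?_
  have h1 : AEMeasurable (fun p : ℝ × Ω => W p.1.toNNReal p.2) (ν.prod P) :=
    hW.aemeasurable_uncurry
  have h2 : Measurable (fun p : ℝ × Ω => μ p.2) := (hμ.mono (F.le 0)).measurable.comp measurable_snd
  have h3 : Measurable (fun p : ℝ × Ω => W 0 p.2) := (hW.measurable 0).comp measurable_snd
  have h4 : Measurable (fun p : ℝ × Ω => (p.1.toNNReal : ℝ)) :=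
    (measurable_real_toNNReal.comp measurable_fst).coe_nnreal_real
  exact (Real.measurable_exp.comp_aemeasurable
    ((((h2.sub_const _).mul h4).aemeasurable).add (h1.sub h3.aemeasurable))).const_mul x₀

/-- A bounded drift is absorbed in a constant, leaving a Gaussian exponential moment. The bound is
uniform over `[0, T]`. -/
theorem exists_gbm_moment_bound [IsProbabilityMeasure P] (hW : IsFiltrationBrownian P F W)
    (hx : 0 < x₀) (hμ : StronglyMeasurable[F 0] μ) (hm : ∀ ω, |μ ω| ≤ m) (T : ℝ≥0) (k : ℕ) :
    ∃ M : ℝ, 0 ≤ M ∧ ∀ t ≤ T, Integrable (fun ω => gbm W μ x₀ t ω ^ k) P ∧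
      ∫ ω, gbm W μ x₀ t ω ^ k ∂P ≤ M := by
  refine ⟨x₀ ^ k * Real.exp (k * (m + 1 / 2) * T + k ^ 2 * T / 2), by positivity, fun t ht => ?_⟩
  by_cases hne : Nonempty Ω
  swap
  · have : IsEmpty Ω := not_nonempty_iff.1 hne
    have h0 : P = 0 := Subsingleton.elim _ _
    exact absurd h0 (IsProbabilityMeasure.ne_zero P)
  obtain ⟨ω₀⟩ := hne
  have hm0 : 0 ≤ m := (abs_nonneg _).trans (hm ω₀)
  have hi := (hW.integrable_exp_sub (zero_le (a := t)) k).const_mul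
    (x₀ ^ k * Real.exp (k * (m + 1 / 2) * t))
  have hle : ∀ ω, gbm W μ x₀ t ω ^ k ≤ x₀ ^ k * Real.exp (k * (m + 1 / 2) * t) *
      Real.exp (k * (W t ω - W 0 ω)) := fun ω => by
    unfold gbm
    rw [mul_pow, ← Real.exp_nat_mul, mul_assoc, ← Real.exp_add]
    refine mul_le_mul_of_nonneg_left (Real.exp_le_exp.2 ?_) (by positivity)
    have h1 : (μ ω - 1 / 2) * t ≤ (m + 1 / 2) * t :=
      mul_le_mul_of_nonneg_right (by linarith [(abs_le.1 (hm ω)).2]) t.2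
    have h2 := mul_le_mul_of_nonneg_left h1 (Nat.cast_nonneg (α := ℝ) k)
    linarith
  have hint : Integrable (fun ω => gbm W μ x₀ t ω ^ k) P := by
    refine hi.mono' ((((stronglyMeasurable_gbm hW hμ t).mono (F.le t)).pow k).aestronglyMeasurable)
      (Eventually.of_forall fun ω => ?_)
    rw [Real.norm_of_nonneg (pow_nonneg (gbm_pos hx t ω).le k)]
    exact hle ω
  refine ⟨hint, (integral_mono hint hi hle).trans ?_⟩
  rw [integral_const_mul, hW.integral_exp_sub (zero_le (a := t)), mul_assoc, ← Real.exp_add]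
  refine mul_le_mul_of_nonneg_left (Real.exp_le_exp.2 ?_) (by positivity)
  have htT : (t : ℝ) ≤ T := NNReal.coe_le_coe.2 ht
  have h3 : (k : ℝ) * (m + 1 / 2) * t ≤ k * (m + 1 / 2) * T :=
    mul_le_mul_of_nonneg_left htT (by positivity)
  have h4 : (k : ℝ) ^ 2 * t ≤ k ^ 2 * T := mul_le_mul_of_nonneg_left htT (by positivity)
  simp only [NNReal.coe_zero, sub_zero]
  linarith

theorem memLp_gbm [IsProbabilityMeasure P] (hW : IsFiltrationBrownian P F W)
    (hx : 0 < x₀) (hμ : StronglyMeasurable[F 0] μ) (hm : ∀ ω, |μ ω| ≤ m) (t : ℝ≥0) :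
    MemLp (gbm W μ x₀ t) 2 P := by
  obtain ⟨M, -, hM⟩ := exists_gbm_moment_bound hW hx hμ hm t 2
  exact (memLp_two_iff_integrable_sq
    ((stronglyMeasurable_gbm hW hμ t).mono (F.le t)).aestronglyMeasurable).2 (hM t le_rfl).1

/-- Taylor bounds of order zero, one and two on `|x * δ| ≤ 1`; the constant `3` replaces `e`. -/
theorem exp_mul_bounds {x δ m : ℝ} (hx : |x| ≤ m) (hδ : 0 ≤ δ) (hδm : m * δ ≤ 1) :
    |Real.exp (x * δ)| ≤ 3 ∧ |Real.exp (x * δ) - 1| ≤ 2 * (m * δ) ∧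
      |Real.exp (x * δ) - 1 - x * δ| ≤ (m * δ) ^ 2 := by
  have h1 : |x * δ| ≤ m * δ := by
    rw [abs_mul, abs_of_nonneg hδ]; exact mul_le_mul_of_nonneg_right hx hδ
  have h2 := h1.trans hδm
  refine ⟨?_, ?_, ?_⟩
  · rw [abs_of_pos (Real.exp_pos _)]
    have := Real.exp_le_exp.2 ((le_abs_self _).trans h2)
    linarith [Real.exp_one_lt_d9]
  · have := Real.abs_exp_sub_one_le h2
    linarith
  · have := Real.abs_exp_sub_one_sub_id_le h2
    refine this.trans ?_
    rw [← sq_abs]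
    exact pow_le_pow_left₀ (abs_nonneg _) h1 2

/-- `L²` modulus of continuity of geometric Brownian motion. -/
theorem integral_gbm_sub_sq_le [IsProbabilityMeasure P] (hW : IsFiltrationBrownian P F W)
    (hx : 0 < x₀) (hμ : StronglyMeasurable[F 0] μ) (hm : ∀ ω, |μ ω| ≤ m) (hm0 : 0 ≤ m)
    {s t : ℝ≥0} (hst : s ≤ t) (h1 : (t : ℝ) - s ≤ 1) (h2 : m * ((t : ℝ) - s) ≤ 1) {M : ℝ}
    (hM : ∫ ω, gbm W μ x₀ s ω ^ 2 ∂P ≤ M) (hM0 : 0 ≤ M) :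
    ∫ ω, (gbm W μ x₀ t ω - gbm W μ x₀ s ω) ^ 2 ∂P ≤ (54 + 16 * m) * M * ((t : ℝ) - s) := by
  set δ : ℝ := (t : ℝ) - s with hδ
  have hδ0 : 0 ≤ δ := sub_nonneg.2 (NNReal.coe_le_coe.2 hst)
  have hμs : StronglyMeasurable[F s] μ := hμ.mono (F.mono zero_le)
  have hXm := stronglyMeasurable_gbm (x₀ := x₀) hW hμ s
  have hXL := memLp_gbm hW hx hμ hm s
  have hem : StronglyMeasurable[F s] fun ω => Real.exp (μ ω * δ) :=
    Real.continuous_exp.comp_stronglyMeasurable (hμs.mul_const δ)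
  have ham : StronglyMeasurable[F s] fun ω => gbm W μ x₀ s ω * Real.exp (μ ω * δ) := hXm.mul hem
  have hbm : StronglyMeasurable[F s] fun ω => gbm W μ x₀ s ω * (Real.exp (μ ω * δ) - 1) :=
    hXm.mul (hem.sub stronglyMeasurable_const)
  obtain ⟨aL, aI⟩ := memLp_integral_sq_le_of_abs_le (c := 3)
    (ham.mono (F.le s)).aestronglyMeasurable hXL fun ω => by
      rw [abs_mul, mul_comm]
      exact mul_le_mul_of_nonneg_right (exp_mul_bounds (hm ω) hδ0 h2).1 (abs_nonneg _)
  obtain ⟨bL, bI⟩ := memLp_integral_sq_le_of_abs_le (c := 2 * (m * δ))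
    (hbm.mono (F.le s)).aestronglyMeasurable hXL fun ω => by
      rw [abs_mul, mul_comm]
      exact mul_le_mul_of_nonneg_right (exp_mul_bounds (hm ω) hδ0 h2).2.1 (abs_nonneg _)
  obtain ⟨rL, -, rI⟩ := hW.exp_remainder hst
  rw [← hδ] at rL rI
  have gm : Measurable fun x : ℝ => Real.exp (x - δ / 2) - 1 - x := by fun_prop
  have u1 := hW.memLp_mul hst ham aL gm rL
  have u2 := hW.memLp_mul hst ham aL measurable_id (hW.memLp_sub hst 2)
  have j1 := hW.integral_mul hst (ham.pow 2) (g := fun x => (Real.exp (x - δ / 2) - 1 - x) ^ 2)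
    (by fun_prop)
  have j2 := hW.integral_mul hst (ham.pow 2) (g := fun x => x ^ 2) (by fun_prop)
  simp only [Pi.pow_apply] at j1 j2
  rw [rI] at j1
  rw [hW.integral_sub_sq hst] at j2
  simp only [id_eq] at u2
  -- Three contributions: the second order remainder of the martingale factor, the Gaussian
  -- increment, and the drift. Using `(x + y)² ≤ 2x² + 2y²` twice gives `2 · 9 + 4 · 9 = 54` and `4
  -- · 4m = 16m`.
  have e : ∀ ω, gbm W μ x₀ t ω - gbm W μ x₀ s ω
      = gbm W μ x₀ s ω * Real.exp (μ ω * δ) *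
          (Real.exp (W t ω - W s ω - δ / 2) - 1 - (W t ω - W s ω))
        + (gbm W μ x₀ s ω * Real.exp (μ ω * δ) * (W t ω - W s ω)
        + gbm W μ x₀ s ω * (Real.exp (μ ω * δ) - 1)) := fun ω => by
    rw [gbm_eq_mul s t ω]; ring
  simp_rw [e]
  have k1 := integral_add_sq_le u1 (u2.add bL)
  have k2 := integral_add_sq_le u2 bL
  simp only [Pi.add_apply] at k1
  have f1 : ∫ ω, (gbm W μ x₀ s ω * Real.exp (μ ω * δ) *
      (Real.exp (W t ω - W s ω - δ / 2) - 1 - (W t ω - W s ω))) ^ 2 ∂P ≤ 9 * M * δ := by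
    simp_rw [mul_pow _ (Real.exp (_ - _ - δ / 2) - 1 - _)]
    rw [j1]
    have hr : Real.exp δ - 1 - δ ≤ δ := by
      have := Real.abs_exp_sub_one_sub_id_le (x := δ) (by rwa [abs_of_nonneg hδ0])
      have h3 := (abs_le.1 this).2
      nlinarith
    have hr0 : 0 ≤ Real.exp δ - 1 - δ := by linarith [Real.add_one_le_exp δ]
    refine mul_le_mul ?_ hr hr0 (by positivity)
    linarith
  have f2 : ∫ ω, (gbm W μ x₀ s ω * Real.exp (μ ω * δ) * (W t ω - W s ω)) ^ 2 ∂P ≤ 9 * M * δ := by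
    simp_rw [mul_pow _ (W t _ - W s _)]
    rw [j2]
    refine mul_le_mul ?_ le_rfl hδ0 (by positivity)
    linarith
  have f3 : ∫ ω, (gbm W μ x₀ s ω * (Real.exp (μ ω * δ) - 1)) ^ 2 ∂P ≤ 4 * m * M * δ := by
    refine bI.trans ((mul_le_mul_of_nonneg_left hM (sq_nonneg _)).trans ?_)
    have h3 : (2 * (m * δ)) ^ 2 ≤ 4 * (m * δ) := by nlinarith [mul_nonneg hm0 hδ0]
    have := mul_le_mul_of_nonneg_right h3 hM0
    linarith
  have hmM : 0 ≤ m * M * δ := by positivity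
  have hMδ : 0 ≤ M * δ := by positivity
  have expand : (54 + 16 * m) * M * δ = 54 * (M * δ) + 16 * (m * M * δ) := by ring
  rw [expand]
  linarith

end GBM
end MeanVariance

namespace MeanVariance

/-! ### Grid approximation of geometric Brownian motion. -/

section GBMStep

variable {Ω : Type*} {mΩ : MeasurableSpace Ω} {P : Measure Ω} {F : Filtration ℝ≥0 mΩ}
  {W : ℝ≥0 → Ω → ℝ} {μ : Ω → ℝ} {x₀ m : ℝ}

/-- Truncated geometric Brownian motion along a uniform grid. -/
noncomputable def gbmGrid (hW : IsFiltrationBrownian P F W) (hx : 0 < x₀)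
    (hμ : StronglyMeasurable[F 0] μ) (t : ℝ≥0) (N : ℕ) : ElementaryProcess F :=
  -- Coefficients of elementary processes must be bounded, hence the cut at height `N`, which rises
  -- as the mesh shrinks.
  ElementaryProcess.grid t N (fun i ω => min (gbm W μ x₀ (i * (t / N)) ω) N)
    (fun _ => (continuous_id.min continuous_const).comp_stronglyMeasurable
      (stronglyMeasurable_gbm hW hμ _))
    fun _ => ⟨N, fun ω => abs_le.2 ⟨(neg_nonpos.2 (Nat.cast_nonneg N)).trans
      (le_min (gbm_pos hx _ ω).le (Nat.cast_nonneg N)), min_le_right _ _⟩⟩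

/-- The second bound trades moments for a rate: through it, fourth moments make the mean square
truncation error of order `N⁻²`. -/
theorem sub_min_sq_le {x : ℝ} (hx : 0 ≤ x) {N : ℕ} (hN : N ≠ 0) :
    |x - min x N| ≤ 1 * |x| ∧ |x - min x N| ≤ (N : ℝ)⁻¹ * |x ^ 2| := by
  have hN' : (0 : ℝ) < N := Nat.cast_pos.2 (Nat.pos_of_ne_zero hN)
  have hN0 : (0 : ℝ) ≤ N := hN'.le
  rw [abs_of_nonneg (sub_nonneg.2 (min_le_left _ _)), abs_of_nonneg hx, abs_of_nonneg (sq_nonneg x)]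
  rcases le_total x N with h | h
  · rw [min_eq_left h, sub_self]
    exact ⟨by linarith, by positivity⟩
  · rw [min_eq_right h]
    refine ⟨by linarith, ?_⟩
    rw [inv_mul_eq_div, le_div_iff₀ hN']
    nlinarith

theorem memLp_sub_min_gbm [IsProbabilityMeasure P] (hW : IsFiltrationBrownian P F W)
    (hx : 0 < x₀) (hμ : StronglyMeasurable[F 0] μ) (hm : ∀ ω, |μ ω| ≤ m) (s : ℝ≥0) {N : ℕ}
    (hN : N ≠ 0) {M : ℝ} (hM : ∫ ω, gbm W μ x₀ s ω ^ 4 ∂P ≤ M) :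
    MemLp (fun ω => gbm W μ x₀ s ω - min (gbm W μ x₀ s ω) N) 2 P ∧
    ∫ ω, (gbm W μ x₀ s ω - min (gbm W μ x₀ s ω) N) ^ 2 ∂P ≤ M / N ^ 2 := by
  have hXm := ((stronglyMeasurable_gbm (x₀ := x₀) hW hμ s).mono (F.le s))
  have hm1 : AEStronglyMeasurable (fun ω => gbm W μ x₀ s ω - min (gbm W μ x₀ s ω) N) P :=
    (hXm.sub (hXm.inf stronglyMeasurable_const)).aestronglyMeasurable
  refine ⟨(memLp_integral_sq_le_of_abs_le hm1 (memLp_gbm hW hx hμ hm s)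
    fun ω => (sub_min_sq_le (gbm_pos hx s ω).le hN).1).1, ?_⟩
  obtain ⟨M', -, hM'⟩ := exists_gbm_moment_bound hW hx hμ hm s 4
  have h2 : MemLp (fun ω => gbm W μ x₀ s ω ^ 2) 2 P := by
    rw [memLp_two_iff_integrable_sq (f := fun ω => gbm W μ x₀ s ω ^ 2)
      (hXm.pow 2).aestronglyMeasurable]
    refine (hM' s le_rfl).1.congr (Eventually.of_forall fun ω => ?_)
    simp only; ring
  have h3 := (memLp_integral_sq_le_of_abs_le hm1 h2
    fun ω => (sub_min_sq_le (gbm_pos hx s ω).le hN).2).2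
  refine h3.trans ?_
  have e : ∀ ω, (gbm W μ x₀ s ω ^ 2) ^ 2 = gbm W μ x₀ s ω ^ 4 := fun ω => by ring
  simp_rw [e]
  rw [inv_pow, inv_mul_eq_div]
  exact div_le_div_of_nonneg_right hM (by positivity)

theorem coe_grid (i N : ℕ) (t : ℝ≥0) : (((i : ℝ≥0) * (t / N) : ℝ≥0) : ℝ) = i * ((t : ℝ) / N) := by
  push_cast; rfl

theorem grid_le {i N : ℕ} (hi : i ≤ N) (t : ℝ≥0) : (i : ℝ≥0) * (t / N) ≤ t := by
  rcases Nat.eq_zero_or_pos N with h | h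
  · subst h; simp
  · have hN : (0 : ℝ≥0) < N := Nat.cast_pos.2 h
    calc (i : ℝ≥0) * (t / N) ≤ N * (t / N) := mul_le_mul_left (Nat.cast_le.2 hi) _
      _ = t := mul_div_cancel₀ _ hN.ne'

/-- At each time the error is the oscillation since the last grid point plus the truncation error
there. -/
theorem gbmGrid_approx [IsProbabilityMeasure P] (hW : IsFiltrationBrownian P F W)
    (hx : 0 < x₀) (hμ : StronglyMeasurable[F 0] μ) (hm : ∀ ω, |μ ω| ≤ m) (hm0 : 0 ≤ m)
    {t : ℝ≥0} {N : ℕ} (hN : N ≠ 0) (h1 : (t : ℝ) / N ≤ 1) (h2 : m * ((t : ℝ) / N) ≤ 1) {M : ℝ}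
    (hM0 : 0 ≤ M) (hM2 : ∀ s ≤ t, ∫ ω, gbm W μ x₀ s ω ^ 2 ∂P ≤ M)
    (hM4 : ∀ s ≤ t, ∫ ω, gbm W μ x₀ s ω ^ 4 ∂P ≤ M) :
    MemLp (fun p : ℝ × Ω => (gbmGrid hW hx hμ t N).evalProd p - gbm W μ x₀ p.1.toNNReal p.2) 2
      (timeMeasure P t) ∧
    ∫ p : ℝ × Ω, ((gbmGrid hW hx hμ t N).evalProd p - gbm W μ x₀ p.1.toNNReal p.2) ^ 2
      ∂(timeMeasure P t) ≤ t * (2 * ((54 + 16 * m) * M * ((t : ℝ) / N)) + 2 * (M / N ^ 2)) := by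
  have hN' : (0 : ℝ) < N := Nat.cast_pos.2 (Nat.pos_of_ne_zero hN)
  have key : ∀ s ∈ Set.Ioc 0 (t : ℝ),
      MemLp (fun ω => (gbmGrid hW hx hμ t N).evalProd (s, ω) - gbm W μ x₀ s.toNNReal ω) 2 P ∧
      ∫ ω, ((gbmGrid hW hx hμ t N).evalProd (s, ω) - gbm W μ x₀ s.toNNReal ω) ^ 2 ∂P
        ≤ 2 * ((54 + 16 * m) * M * ((t : ℝ) / N)) + 2 * (M / N ^ 2) := by
    intro s hs
    have hs' : s.toNNReal ∈ Set.Ioc 0 t :=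
      ⟨Real.toNNReal_pos.2 hs.1, Real.toNNReal_le_iff_le_coe.2 hs.2⟩
    obtain ⟨i, hiN, hi⟩ := ElementaryProcess.exists_mem_grid hN hs'
    set u : ℝ≥0 := (i : ℝ≥0) * (t / N) with hu
    have hut : u ≤ t := grid_le hiN.le t
    have hev : ∀ ω, (gbmGrid hW hx hμ t N).evalProd (s, ω) = min (gbm W μ x₀ u ω) N := fun ω =>
      (gbmGrid hW hx hμ t N).eval_eq_of_mem (i := i) hiN hi ω
    simp_rw [hev]
    have hδ : (s.toNNReal : ℝ) - u ≤ (t : ℝ) / N := by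
      have h3 := NNReal.coe_le_coe.2 hi.2
      rw [coe_grid] at h3
      rw [hu, coe_grid]
      push_cast at h3
      linarith
    obtain ⟨aL, aI⟩ := memLp_sub_min_gbm hW hx hμ hm u hN (hM4 u hut)
    have bI := integral_gbm_sub_sq_le hW hx hμ hm hm0 hi.1.le (hδ.trans h1)
      ((mul_le_mul_of_nonneg_left hδ hm0).trans h2) (hM2 u hut) hM0
    have bL : MemLp (fun ω => gbm W μ x₀ s.toNNReal ω - gbm W μ x₀ u ω) 2 P :=
      (memLp_gbm hW hx hμ hm _).sub (memLp_gbm hW hx hμ hm _)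
    have e : (fun ω => min (gbm W μ x₀ u ω) (N : ℝ) - gbm W μ x₀ s.toNNReal ω)
        = fun ω => -((gbm W μ x₀ s.toNNReal ω - gbm W μ x₀ u ω)
          + (gbm W μ x₀ u ω - min (gbm W μ x₀ u ω) N)) := by ext ω; ring
    refine ⟨by rw [e]; exact (bL.add aL).neg, ?_⟩
    have e2 : ∀ ω, (min (gbm W μ x₀ u ω) (N : ℝ) - gbm W μ x₀ s.toNNReal ω) ^ 2
        = ((gbm W μ x₀ s.toNNReal ω - gbm W μ x₀ u ω)
          + (gbm W μ x₀ u ω - min (gbm W μ x₀ u ω) N)) ^ 2 := fun ω => by ring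
    simp_rw [e2]
    refine (integral_add_sq_le bL aL).trans ?_
    have h3 : (54 + 16 * m) * M * ((s.toNNReal : ℝ) - u) ≤ (54 + 16 * m) * M * ((t : ℝ) / N) :=
      mul_le_mul_of_nonneg_left hδ (by positivity)
    linarith
  refine memLp_timeMeasure_of_section ?_ (fun s hs => (key s hs).1) (fun s hs => (key s hs).2)
  exact (ElementaryProcess.measurable_evalProd _).aestronglyMeasurable.sub
    (aestronglyMeasurable_gbm_uncurry hW hμ)

/-- One-step expansion of geometric Brownian motion along the grid, with the error in `L²`. -/
theorem gbmGrid_remainder [IsProbabilityMeasure P] (hW : IsFiltrationBrownian P F W)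
    (hx : 0 < x₀) (hμ : StronglyMeasurable[F 0] μ) (hm : ∀ ω, |μ ω| ≤ m)
    {t : ℝ≥0} {N : ℕ} (hN : N ≠ 0) (h1 : (t : ℝ) / N ≤ 1) (h2 : m * ((t : ℝ) / N) ≤ 1) {M : ℝ}
    (hM0 : 0 ≤ M) (hM2 : ∀ s ≤ t, ∫ ω, gbm W μ x₀ s ω ^ 2 ∂P ≤ M)
    (hM4 : ∀ s ≤ t, ∫ ω, gbm W μ x₀ s ω ^ 4 ∂P ≤ M) :
    ∃ R : Ω → ℝ, MemLp R 2 P ∧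
      ∫ ω, R ω ^ 2 ∂P ≤ 2 * (t * (9 * M * ((t : ℝ) / N))) + 2 * (2 *
        (t * (2 * ((2 * (m * ((t : ℝ) / N))) ^ 2 * M) + 2 * (M / N ^ 2)))
        + 2 * (N ^ 2 * (2 * (((m * ((t : ℝ) / N)) ^ 2) ^ 2 * M)
          + 2 * ((m * ((t : ℝ) / N)) ^ 2 * (M / N ^ 2))))) ∧
      ∀ ω, gbm W μ x₀ t ω - x₀ - (∫ s in Set.Ioc 0 (t : ℝ), (gbmGrid hW hx hμ t N).eval s.toNNReal ω)
        * μ ω - (gbmGrid hW hx hμ t N).integral W t ω = R ω := by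
  have hN' : (0 : ℝ) < N := Nat.cast_pos.2 (Nat.pos_of_ne_zero hN)
  set h : ℝ := (t : ℝ) / N with hh
  have hh0 : 0 ≤ h := div_nonneg t.2 hN'.le
  have hNh : (N : ℝ) * h = t := mul_div_cancel₀ _ hN'.ne'
  set τ : ℕ → ℝ≥0 := fun i => (i : ℝ≥0) * (t / N) with hτdef
  have hτ : Monotone τ := fun i j hij => mul_le_mul_left (Nat.cast_le.2 hij) _
  have hτr : ∀ i, (τ i : ℝ) = i * h := fun i => coe_grid i N t
  have hstep : ∀ i, (τ (i + 1) : ℝ) - τ i = h := fun i => by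
    rw [hτr, hτr]; push_cast; ring
  have hle := fun i => hτ (Nat.le_succ i)
  have hτt : ∀ {i}, i ≤ N → τ i ≤ t := fun hi => grid_le hi t
  have hτN : τ N = t := by
    have : (N : ℝ≥0) ≠ 0 := Nat.cast_ne_zero.2 hN
    exact mul_div_cancel₀ _ this
  set X : ℝ≥0 → Ω → ℝ := gbm W μ x₀ with hX
  have hXm : ∀ i, StronglyMeasurable[F (τ i)] (X (τ i)) := fun i => stronglyMeasurable_gbm hW hμ _
  have hXL : ∀ s, MemLp (X s) 2 P := fun s => memLp_gbm hW hx hμ hm s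
  have hμi : ∀ i, StronglyMeasurable[F (τ i)] μ := fun i => hμ.mono (F.mono zero_le)
  have hem : ∀ i, StronglyMeasurable[F (τ i)] fun ω => Real.exp (μ ω * h) := fun i =>
    Real.continuous_exp.comp_stronglyMeasurable ((hμi i).mul_const h)
  have hdm : ∀ i, StronglyMeasurable[F (τ i)] fun ω => X (τ i) ω - min (X (τ i) ω) N := fun i =>
    (hXm i).sub ((continuous_id.min continuous_const).comp_stronglyMeasurable (hXm i))
  have am : ∀ i, StronglyMeasurable[F (τ i)] fun ω => X (τ i) ω * Real.exp (μ ω * h) := fun i =>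
    (hXm i).mul (hem i)
  have bm : ∀ i, StronglyMeasurable[F (τ i)] fun ω => X (τ i) ω * (Real.exp (μ ω * h) - 1) :=
    fun i => (hXm i).mul ((hem i).sub stronglyMeasurable_const)
  have ζm : ∀ i, StronglyMeasurable[F (τ i)] fun ω => X (τ i) ω * (Real.exp (μ ω * h) - 1)
      + (X (τ i) ω - min (X (τ i) ω) N) := fun i => (bm i).add (hdm i)
  have cm : ∀ i, StronglyMeasurable[F (τ i)]
      fun ω => X (τ i) ω * (Real.exp (μ ω * h) - 1 - μ ω * h) := fun i =>
    (hXm i).mul (((hem i).sub stronglyMeasurable_const).sub ((hμi i).mul_const h))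
  have c'm : ∀ i, StronglyMeasurable[F (τ i)]
      fun ω => μ ω * h * (X (τ i) ω - min (X (τ i) ω) N) := fun i =>
    ((hμi i).mul_const h).mul (hdm i)
  have ae : ∀ i {f : Ω → ℝ}, StronglyMeasurable[F (τ i)] f → AEStronglyMeasurable f P :=
    fun i _ hf => (hf.mono (F.le _)).aestronglyMeasurable
  have ha := fun i => memLp_integral_sq_le_of_abs_le (c := 3) (ae i (am i)) (hXL (τ i)) fun ω => by
    rw [abs_mul, mul_comm]
    exact mul_le_mul_of_nonneg_right (exp_mul_bounds (hm ω) hh0 h2).1 (abs_nonneg _)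
  have hb := fun i => memLp_integral_sq_le_of_abs_le (c := 2 * (m * h)) (ae i (bm i)) (hXL (τ i))
    fun ω => by
      rw [abs_mul, mul_comm]
      exact mul_le_mul_of_nonneg_right (exp_mul_bounds (hm ω) hh0 h2).2.1 (abs_nonneg _)
  have hc := fun i => memLp_integral_sq_le_of_abs_le (c := (m * h) ^ 2) (ae i (cm i)) (hXL (τ i))
    fun ω => by
      rw [abs_mul, mul_comm]
      exact mul_le_mul_of_nonneg_right (exp_mul_bounds (hm ω) hh0 h2).2.2 (abs_nonneg _)
  have hdL : ∀ i, MemLp (fun ω => X (τ i) ω - min (X (τ i) ω) N) 2 P := fun i =>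
    (memLp_sub_min_gbm hW hx hμ hm (τ i) hN le_rfl).1
  have hdI : ∀ i ≤ N, ∫ ω, (X (τ i) ω - min (X (τ i) ω) N) ^ 2 ∂P ≤ M / N ^ 2 := fun i hi =>
    (memLp_sub_min_gbm hW hx hμ hm (τ i) hN (hM4 _ (hτt hi))).2
  have hc' := fun i => memLp_integral_sq_le_of_abs_le (c := m * h) (ae i (c'm i)) (hdL i)
    fun ω => by
      rw [abs_mul, abs_mul, abs_of_nonneg hh0]
      exact mul_le_mul_of_nonneg_right (mul_le_mul_of_nonneg_right (hm ω) hh0) (abs_nonneg _)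
  have ζL : ∀ i, MemLp (fun ω => X (τ i) ω * (Real.exp (μ ω * h) - 1)
      + (X (τ i) ω - min (X (τ i) ω) N)) 2 P := fun i => (hb i).1.add (hdL i)
  have rem := fun i => hW.exp_remainder (hle i)
  simp_rw [Nat.succ_eq_add_one, hstep] at rem
  obtain ⟨AL, AI⟩ := hW.integral_sum_mul_sq hτ (g := fun x => Real.exp (x - h / 2) - 1 - x)
    (by fun_prop) am (fun i => (ha i).1) (fun i => (rem i).1) (fun i => (rem i).2.1) N
  obtain ⟨ZL, ZI⟩ := hW.integral_sum_mul_sq hτ (g := fun x => x)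
    measurable_id ζm ζL (fun i => hW.memLp_sub (hle i) 2)
    (fun i => hW.integral_sub_eq_zero (hle i)) N
  have cL : ∀ i, MemLp (fun ω => X (τ i) ω * (Real.exp (μ ω * h) - 1 - μ ω * h)
      + μ ω * h * (X (τ i) ω - min (X (τ i) ω) N)) 2 P := fun i => (hc i).1.add (hc' i).1
  have CL := memLp_finsetSum (Finset.range N) fun i _ => cL i
  have CI := integral_sum_sq_le cL N
  -- The remainder is a sum of three. The first two collect martingale increments, whose mean
  -- squares add over the `N` steps. The third, the drift error, has no orthogonality and pays the
  -- factor `N` of Cauchy–Schwarz, which its higher order in the mesh compensates.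
  refine ⟨_, AL.add (ZL.add CL), ?_, ?_⟩
  · refine (integral_add_sq_le AL (ZL.add CL)).trans ?_
    have k2 := integral_add_sq_le ZL CL
    have hMN : 0 ≤ M / (N : ℝ) ^ 2 := by positivity
    have aB : ∑ i ∈ Finset.range N, (∫ ω, (X (τ i) ω * Real.exp (μ ω * h)) ^ 2 ∂P) *
        ∫ ω, (Real.exp (W (τ (i + 1)) ω - W (τ i) ω - h / 2) - 1
          - (W (τ (i + 1)) ω - W (τ i) ω)) ^ 2 ∂P ≤ t * (9 * M * h) := by
      have hr : Real.exp h - 1 - h ≤ h ^ 2 :=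
        (abs_le.1 (Real.abs_exp_sub_one_sub_id_le (x := h) (by rwa [abs_of_nonneg hh0]))).2
      have hr0 : 0 ≤ Real.exp h - 1 - h := by linarith [Real.add_one_le_exp h]
      refine (Finset.sum_le_card_nsmul _ _ (9 * M * h ^ 2) fun i hi => ?_).trans (le_of_eq ?_)
      · rw [(rem i).2.2]
        refine mul_le_mul ?_ hr hr0 (by positivity)
        have := hM2 _ (hτt (Finset.mem_range.1 hi).le)
        linarith [(ha i).2]
      · rw [Finset.card_range, nsmul_eq_mul, ← hNh]; ring
    have zB : ∑ i ∈ Finset.range N, (∫ ω, (X (τ i) ω * (Real.exp (μ ω * h) - 1)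
        + (X (τ i) ω - min (X (τ i) ω) N)) ^ 2 ∂P) *
        ∫ ω, (W (τ (i + 1)) ω - W (τ i) ω) ^ 2 ∂P
        ≤ t * (2 * ((2 * (m * h)) ^ 2 * M) + 2 * (M / N ^ 2)) := by
      refine (Finset.sum_le_card_nsmul _ _ ((2 * ((2 * (m * h)) ^ 2 * M) + 2 * (M / N ^ 2)) * h)
        fun i hi => ?_).trans (le_of_eq ?_)
      · rw [hW.integral_sub_sq (hle i), hstep]
        refine mul_le_mul_of_nonneg_right ((integral_add_sq_le (hb i).1 (hdL i)).trans ?_) hh0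
        have h3 := mul_le_mul_of_nonneg_left (hM2 _ (hτt (Finset.mem_range.1 hi).le))
          (sq_nonneg (2 * (m * h)))
        linarith [(hb i).2, hdI i (Finset.mem_range.1 hi).le]
      · rw [Finset.card_range, nsmul_eq_mul, ← hNh]; ring
    have cB : N * ∑ i ∈ Finset.range N, ∫ ω, (X (τ i) ω * (Real.exp (μ ω * h) - 1 - μ ω * h)
        + μ ω * h * (X (τ i) ω - min (X (τ i) ω) N)) ^ 2 ∂P
        ≤ (N : ℝ) ^ 2 * (2 * (((m * h) ^ 2) ^ 2 * M) + 2 * ((m * h) ^ 2 * (M / N ^ 2))) := by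
      rw [sq (N : ℝ), mul_assoc]
      refine mul_le_mul_of_nonneg_left ?_ hN'.le
      refine (Finset.sum_le_card_nsmul _ _
        (2 * (((m * h) ^ 2) ^ 2 * M) + 2 * ((m * h) ^ 2 * (M / N ^ 2)))
        fun i hi => ?_).trans (le_of_eq ?_)
      · refine (integral_add_sq_le (hc i).1 (hc' i).1).trans ?_
        have h3 := mul_le_mul_of_nonneg_left (hM2 _ (hτt (Finset.mem_range.1 hi).le))
          (sq_nonneg ((m * h) ^ 2))
        have h4 := mul_le_mul_of_nonneg_left (hdI i (Finset.mem_range.1 hi).le)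
          (sq_nonneg (m * h))
        linarith [(hc i).2, (hc' i).2]
      · rw [Finset.card_range, nsmul_eq_mul, sq (N : ℝ)]
    simp only [Pi.add_apply] at *
    linarith
  · intro ω
    have hmin : ∀ i ≤ N, min (τ i) t = τ i := fun i hi => min_eq_left (hτt hi)
    have e1 : X t ω - x₀ = ∑ i ∈ Finset.range N, (X (τ (i + 1)) ω - X (τ i) ω) := by
      rw [Finset.sum_range_sub (fun i => X (τ i) ω), hτN]
      have : τ 0 = 0 := by simp [hτdef]
      rw [this, hX, gbm_zero]
    have e2 : ∫ s in Set.Ioc 0 (t : ℝ), (gbmGrid hW hx hμ t N).eval s.toNNReal ω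
        = ∑ i ∈ Finset.range N, min (X (τ i) ω) N * h := by
      rw [ElementaryProcess.setIntegral_eval]
      refine Finset.sum_congr rfl fun i hi => ?_
      have hi' := Finset.mem_range.1 hi
      change min (X (τ i) ω) N * (((min (τ (i + 1)) t : ℝ≥0) : ℝ) - ((min (τ i) t : ℝ≥0) : ℝ)) = _
      rw [hmin _ hi', hmin _ hi'.le, hstep]
    have e3 : (gbmGrid hW hx hμ t N).integral W t ω
        = ∑ i ∈ Finset.range N, min (X (τ i) ω) N * (W (τ (i + 1)) ω - W (τ i) ω) := by
      refine Finset.sum_congr rfl fun i hi => ?_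
      have hi' := Finset.mem_range.1 hi
      change min (X (τ i) ω) N * (W (min (τ (i + 1)) t) ω - W (min (τ i) t) ω) = _
      rw [hmin _ hi', hmin _ hi'.le]
    rw [e1, e2, e3, Finset.sum_mul, ← Finset.sum_sub_distrib, ← Finset.sum_sub_distrib]
    simp only [Pi.add_apply]
    rw [← Finset.sum_add_distrib, ← Finset.sum_add_distrib]
    refine Finset.sum_congr rfl fun i _ => ?_
    have e4 := gbm_eq_mul (W := W) (μ := μ) (x₀ := x₀) (τ i) (τ (i + 1)) ω
    rw [hstep] at e4
    simp only [hX]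
    rw [e4]
    ring

end GBMStep
end MeanVariance

namespace MeanVariance

/-! ### The stock price equation: existence and uniqueness. -/

section SDE

variable {Ω : Type*} {mΩ : MeasurableSpace Ω} {P : Measure Ω} {F : Filtration ℝ≥0 mΩ}
  {W : ℝ≥0 → Ω → ℝ} {μ : Ω → ℝ} {x₀ m : ℝ}

theorem L2Tendsto.zero_of_le {α : Type*} {mα : MeasurableSpace α} {ν : Measure α}
    {f : ℕ → α → ℝ} {b : ℕ → ℝ} (hf : ∀ n, MemLp (f n) 2 ν) (h : ∀ n, ∫ x, f n x ^ 2 ∂ν ≤ b n)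
    (hb : Tendsto b atTop (𝓝 0)) : L2Tendsto ν f (fun _ => 0) := by
  refine L2Tendsto.of_integral hf MemLp.zero' ?_
  simp only [sub_zero]
  exact squeeze_zero (fun n => integral_nonneg fun _ => sq_nonneg _) h hb

theorem gbm_memLp_timeMeasure [IsProbabilityMeasure P] (hW : IsFiltrationBrownian P F W)
    (hx : 0 < x₀) (hμ : StronglyMeasurable[F 0] μ) (hm : ∀ ω, |μ ω| ≤ m) (t : ℝ≥0) :
    MemLp (fun p : ℝ × Ω => gbm W μ x₀ p.1.toNNReal p.2) 2 (timeMeasure P t) := by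
  obtain ⟨M, -, hM⟩ := exists_gbm_moment_bound hW hx hμ hm t 2
  have h1 : ∀ s ∈ Set.Ioc 0 (t : ℝ), MemLp (fun ω => gbm W μ x₀ s.toNNReal ω) 2 P :=
    fun s _ => memLp_gbm hW hx hμ hm s.toNNReal
  have h2 : ∀ s ∈ Set.Ioc 0 (t : ℝ), ∫ ω, gbm W μ x₀ s.toNNReal ω ^ 2 ∂P ≤ M :=
    fun s hs => (hM s.toNNReal (Real.toNNReal_le_iff_le_coe.2 hs.2)).2
  exact (memLp_timeMeasure_of_section (f := fun p => gbm W μ x₀ p.1.toNNReal p.2)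
    (aestronglyMeasurable_gbm_uncurry hW hμ) h1 h2).1

/-- Geometric Brownian motion solves its stochastic differential equation. -/
theorem isItoIntegral_gbm [IsProbabilityMeasure P] (hW : IsFiltrationBrownian P F W)
    (hx : 0 < x₀) (hμ : StronglyMeasurable[F 0] μ) (hm : ∀ ω, |μ ω| ≤ m) (hm0 : 0 ≤ m) (t : ℝ≥0) :
    IsItoIntegral P F W t (gbm W μ x₀) (fun ω => gbm W μ x₀ t ω - x₀ -
      (∫ s in Set.Ioc 0 (t : ℝ), gbm W μ x₀ s.toNNReal ω) * μ ω) := by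
  obtain ⟨M₂, hM₂0, hM₂⟩ := exists_gbm_moment_bound hW hx hμ hm t 2
  obtain ⟨M₄, hM₄0, hM₄⟩ := exists_gbm_moment_bound hW hx hμ hm t 4
  set M := M₂ + M₄ with hM
  have hM0 : 0 ≤ M := add_nonneg hM₂0 hM₄0
  have b2 : ∀ s ≤ t, ∫ ω, gbm W μ x₀ s ω ^ 2 ∂P ≤ M := fun s hs => by linarith [(hM₂ s hs).2]
  have b4 : ∀ s ≤ t, ∫ ω, gbm W μ x₀ s ω ^ 4 ∂P ≤ M := fun s hs => by linarith [(hM₄ s hs).2]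
  -- Beyond `N₀` both the mesh and `m` times the mesh are at most one, as the one-step estimates
  -- require.
  set N₀ : ℕ := ⌈(t : ℝ) * (m + 1)⌉₊ + 1 with hN₀
  set N : ℕ → ℕ := fun n => n + N₀ with hNdef
  have hN : ∀ n, N n ≠ 0 := fun n => by simp only [hNdef, hN₀]; omega
  have hNpos : ∀ n, (0 : ℝ) < N n := fun n => Nat.cast_pos.2 (Nat.pos_of_ne_zero (hN n))
  have hNlarge : ∀ n, (t : ℝ) * (m + 1) ≤ N n := fun n => by
    refine (Nat.le_ceil _).trans (Nat.cast_le.2 ?_)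
    simp only [hNdef, hN₀]; omega
  have ht0 : (0 : ℝ) ≤ t := t.2
  have h1 : ∀ n, (t : ℝ) / N n ≤ 1 := fun n => by
    rw [div_le_one (hNpos n)]
    nlinarith [hNlarge n, mul_nonneg ht0 hm0]
  have h2 : ∀ n, m * ((t : ℝ) / N n) ≤ 1 := fun n => by
    rw [← mul_div_assoc, div_le_one (hNpos n)]
    nlinarith [hNlarge n]
  have hNt : Tendsto (fun n => (N n : ℝ)) atTop atTop :=
    tendsto_natCast_atTop_atTop.comp (tendsto_add_atTop_nat N₀)
  have hh : Tendsto (fun n => (t : ℝ) / N n) atTop (𝓝 0) := hNt.const_div_atTop _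
  have hq : Tendsto (fun n => M / (N n : ℝ) ^ 2) atTop (𝓝 0) :=
    ((tendsto_pow_atTop two_ne_zero).comp hNt).const_div_atTop _
  set K : ℕ → ElementaryProcess F := fun n => gbmGrid hW hx hμ t (N n) with hK
  have XL := gbm_memLp_timeMeasure hW hx hμ hm t
  have KL : ∀ n, MemLp (K n).evalProd 2 (timeMeasure P t) := fun n => (K n).memLp_evalProd t
  have lim1 : L2Tendsto (timeMeasure P t) (fun n => (K n).evalProd)
      (fun p : ℝ × Ω => gbm W μ x₀ p.1.toNNReal p.2) := by
    refine L2Tendsto.of_integral KL XL ?_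
    refine squeeze_zero (fun n => integral_nonneg fun _ => sq_nonneg _)
      (fun n => (gbmGrid_approx hW hx hμ hm hm0 (hN n) (h1 n) (h2 n) hM0 b2 b4).2) ?_
    have hc : Continuous fun z : ℝ × ℝ =>
        (t : ℝ) * (2 * ((54 + 16 * m) * M * z.1) + 2 * z.2) := by fun_prop
    simpa [Function.comp_def] using (hc.tendsto (0, 0)).comp (hh.prodMk_nhds hq)
  choose R RL RI Req using fun n =>
    gbmGrid_remainder hW hx hμ hm (hN n) (h1 n) (h2 n) hM0 b2 b4
  have lim2 : L2Tendsto P R (fun _ => 0) := by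
    refine L2Tendsto.zero_of_le RL RI ?_
    -- The bound is rewritten in the mesh `z.1` and in `z.2 = M / N²`; `N` times the mesh equals
    -- `t`, which removes the factor `N²`.
    have hc : Continuous fun z : ℝ × ℝ =>
        2 * ((t : ℝ) * (9 * M * z.1)) + 2 * (2 *
        (t * (2 * ((2 * (m * z.1)) ^ 2 * M) + 2 * z.2))
        + 2 * (t ^ 2 * (2 * (m ^ 4 * z.1 ^ 2 * M)) + 2 * ((m * z.1) ^ 2 * M))) := by fun_prop
    have hl := (hc.tendsto (0, 0)).comp (hh.prodMk_nhds hq)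
    simp only [Function.comp_def, mul_zero, ne_eq, OfNat.ofNat_ne_zero, not_false_eq_true,
      zero_pow, zero_mul, add_zero] at hl
    refine hl.congr fun n => ?_
    have := (hNpos n).ne'
    field_simp
  have lim3 : L2Tendsto P (fun n ω => (∫ s in Set.Ioc 0 (t : ℝ), (K n).evalProd (s, ω)) * μ ω)
      (fun ω => (∫ s in Set.Ioc 0 (t : ℝ), gbm W μ x₀ s.toNNReal ω) * μ ω) :=
    (lim1.integral KL XL).mul_of_bound (Eventually.of_forall hm)
  have hμm : AEStronglyMeasurable μ P := (hμ.mono (F.le 0)).aestronglyMeasurable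
  have DL : ∀ n, MemLp (fun ω => (∫ s in Set.Ioc 0 (t : ℝ), (K n).evalProd (s, ω)) * μ ω) 2 P :=
    fun n => by
      have := memLp_bdd_mul hμm (Eventually.of_forall hm) (memLp_integral (KL n))
      simpa only [mul_comm] using this
  have DL' : MemLp (fun ω => (∫ s in Set.Ioc 0 (t : ℝ), gbm W μ x₀ s.toNNReal ω) * μ ω) 2 P := by
    have := memLp_bdd_mul hμm (Eventually.of_forall hm) (memLp_integral XL)
    simpa only [mul_comm] using this
  have lim4 := ((lim2.add lim3 (fun n => by simpa using (RL n).1)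
    (fun n => ((DL n).sub DL').1)).const_mul (-1)).add
      (L2Tendsto.const (fun ω => gbm W μ x₀ t ω - x₀))
      (fun n => by
        have := (((RL n).add (DL n)).sub DL').const_mul (-1)
        refine this.1.congr (Eventually.of_forall fun ω => ?_)
        simp; ring)
      (fun n => by simpa using aestronglyMeasurable_const)
  refine ⟨XL.1, ((memLp_gbm hW hx hμ hm t).sub (memLp_const x₀)).sub DL', K, lim1, ?_⟩
  refine Tendsto.congr (fun n => ?_) lim4
  congr 1
  ext ω
  have := Req n ω
  change _ - _ - (∫ s in Set.Ioc 0 (t : ℝ), (K n).evalProd (s, ω)) * μ ω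
    - (K n).integral W t ω = _ at this
  linarith

/-- Iterating the inequality gives `φ t ≤ B (L t)ⁿ / n!` for every `n`. Integrability of `φ`
suffices, without continuity. -/
theorem gronwall_eq_zero {φ : ℝ → ℝ} {L T : ℝ} (hL : 0 ≤ L) (hint : IntegrableOn φ (Set.Ioc 0 T))
    (h0 : ∀ t ∈ Set.Icc 0 T, 0 ≤ φ t)
    (h : ∀ t ∈ Set.Icc 0 T, φ t ≤ L * ∫ s in Set.Ioc 0 t, φ s) :
    ∀ t ∈ Set.Icc 0 T, φ t = 0 := by
  set B := L * ∫ s in Set.Ioc 0 T, φ s with hB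
  have key : ∀ n : ℕ, ∀ t ∈ Set.Icc 0 T, φ t ≤ B * ((L * t) ^ n / n.factorial) := by
    intro n
    induction n with
    | zero =>
      intro t ht
      simp only [pow_zero, Nat.factorial_zero, Nat.cast_one, div_one, mul_one]
      refine (h t ht).trans (mul_le_mul_of_nonneg_left ?_ hL)
      refine setIntegral_mono_set hint ?_ (Set.Ioc_subset_Ioc_right ht.2).eventuallyLE
      filter_upwards [ae_restrict_mem measurableSet_Ioc] with s hs
      exact h0 s ⟨hs.1.le, hs.2⟩
    | succ n ih =>
      intro t ht
      have hle : ∫ s in Set.Ioc 0 t, φ s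
          ≤ ∫ s in Set.Ioc 0 t, B * ((L * s) ^ n / n.factorial) := by
        refine setIntegral_mono_on (hint.mono_set (Set.Ioc_subset_Ioc_right ht.2)) ?_
          measurableSet_Ioc fun s hs => ih s ⟨hs.1.le, hs.2.trans ht.2⟩
        exact (Continuous.integrableOn_Icc (by fun_prop)).mono_set Set.Ioc_subset_Icc_self
      refine (h t ht).trans ((mul_le_mul_of_nonneg_left hle hL).trans (le_of_eq ?_))
      rw [← intervalIntegral.integral_of_le ht.1]
      simp_rw [mul_pow]
      have e : ∀ s : ℝ, B * (L ^ n * s ^ n / n.factorial) = (B * L ^ n / n.factorial) * s ^ n :=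
        fun s => by ring
      simp_rw [e]
      rw [intervalIntegral.integral_const_mul, integral_pow, Nat.factorial_succ]
      have h3 : (n.factorial : ℝ) ≠ 0 := Nat.cast_ne_zero.2 (Nat.factorial_ne_zero n)
      have h4 : (n : ℝ) + 1 ≠ 0 := by positivity
      push_cast
      field_simp
      ring
  intro t ht
  refine le_antisymm ?_ (h0 t ht)
  have hlim : Tendsto (fun n : ℕ => B * ((L * t) ^ n / n.factorial)) atTop (𝓝 (B * 0)) :=
    (FloorSemiring.tendsto_pow_div_factorial_atTop (L * t)).const_mul B
  rw [mul_zero] at hlim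
  exact ge_of_tendsto' hlim fun n => key n t ht

/-- Uniqueness for the stock price equation. -/
theorem IsStockPrice.ae_eq_gbm [IsProbabilityMeasure P] (hW : IsFiltrationBrownian P F W)
    (hx : 0 < x₀) (hμ : StronglyMeasurable[F 0] μ) (hm : ∀ ω, |μ ω| ≤ m) (hm0 : 0 ≤ m)
    {μ' : Ω → ℝ} (hμ' : μ' =ᵐ[P] μ) {T : ℝ≥0} {S : ℝ≥0 → Ω → ℝ}
    (hS : IsStockPrice P F W μ' x₀ T S) {t : ℝ≥0} (ht : t ≤ T) :
    S t =ᵐ[P] gbm W μ x₀ t := by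
  set D : ℝ × Ω → ℝ := fun p => S p.1.toNNReal p.2 - gbm W μ x₀ p.1.toNNReal p.2 with hD
  have SL : ∀ u ≤ T, MemLp (fun p : ℝ × Ω => S p.1.toNNReal p.2) 2 (timeMeasure P u) :=
    fun u hu => (hS.sde u hu).memLp_integrand
  have XL : ∀ u, MemLp (fun p : ℝ × Ω => gbm W μ x₀ p.1.toNNReal p.2) 2 (timeMeasure P u) :=
    fun u => gbm_memLp_timeMeasure hW hx hμ hm u
  have DL : ∀ u ≤ T, MemLp D 2 (timeMeasure P u) := fun u hu => (SL u hu).sub (XL u)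
  have hμm : AEStronglyMeasurable μ P := (hμ.mono (F.le 0)).aestronglyMeasurable
  set φ : ℝ → ℝ := fun s => ∫ ω, D (s, ω) ^ 2 ∂P with hφ
  -- The difference of two solutions is a stochastic part `Y`, with second moment `∫ φ` by the
  -- isometry, plus a drift part, with second moment at most `m² T ∫ φ` by Cauchy–Schwarz. This
  -- explains the constant `2 + 2 m² T`.
  have main : ∀ u : ℝ≥0, u ≤ T → MemLp (fun ω => S u ω - gbm W μ x₀ u ω) 2 P ∧
      ∫ ω, (S u ω - gbm W μ x₀ u ω) ^ 2 ∂P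
        ≤ (2 + 2 * (m ^ 2 * T)) * ∫ s in Set.Ioc 0 (u : ℝ), φ s := by
    intro u hu
    have i1 := hS.sde u hu
    have i2 := isItoIntegral_gbm hW hx hμ hm hm0 u
    have iso := i1.integral_sub_sq hW i2
    set Y : Ω → ℝ := fun ω => (S u ω - x₀ - ∫ s in (0 : ℝ)..u, μ' ω * S s.toNNReal ω)
      - (gbm W μ x₀ u ω - x₀ - (∫ s in Set.Ioc 0 (u : ℝ), gbm W μ x₀ s.toNNReal ω) * μ ω) with hY
    have YL : MemLp Y 2 P := i1.memLp.sub i2.memLp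
    have IL : MemLp (fun ω => ∫ s in Set.Ioc 0 (u : ℝ), D (s, ω)) 2 P := memLp_integral (DL u hu)
    obtain ⟨ZL, ZI⟩ := memLp_integral_sq_le_of_abs_le (c := m)
      (f := fun ω => μ ω * ∫ s in Set.Ioc 0 (u : ℝ), D (s, ω)) (hμm.mul IL.1) IL fun ω => by
        rw [abs_mul]; exact mul_le_mul_of_nonneg_right (hm ω) (abs_nonneg _)
    have e : (fun ω => S u ω - gbm W μ x₀ u ω)
        =ᵐ[P] fun ω => Y ω + μ ω * ∫ s in Set.Ioc 0 (u : ℝ), D (s, ω) := by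
      filter_upwards [hμ', ae_integrable_section (SL u hu), ae_integrable_section (XL u)]
        with ω h1 h2 h3
      have h4 : ∫ s in Set.Ioc 0 (u : ℝ), D (s, ω) = (∫ s in Set.Ioc 0 (u : ℝ), S s.toNNReal ω)
          - ∫ s in Set.Ioc 0 (u : ℝ), gbm W μ x₀ s.toNNReal ω := integral_sub h2 h3
      have h5 : ∫ s in (0 : ℝ)..u, μ' ω * S s.toNNReal ω
          = μ ω * ∫ s in Set.Ioc 0 (u : ℝ), S s.toNNReal ω := by
        rw [intervalIntegral.integral_const_mul, intervalIntegral.integral_of_le u.coe_nonneg, h1]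
      simp only [hY]
      rw [h4, h5]
      ring
    refine ⟨(memLp_congr_ae e).2 (YL.add ZL), ?_⟩
    have e2 : ∫ ω, (S u ω - gbm W μ x₀ u ω) ^ 2 ∂P
        = ∫ ω, (Y ω + μ ω * ∫ s in Set.Ioc 0 (u : ℝ), D (s, ω)) ^ 2 ∂P := by
      refine integral_congr_ae ?_
      filter_upwards [e] with ω hω
      rw [hω]
    have fub : ∫ p, D p ^ 2 ∂(timeMeasure P u) = ∫ s in Set.Ioc 0 (u : ℝ), φ s :=
      integral_prod _ (DL u hu).integrable_sq
    have h6 := integral_sq_integral_le (DL u hu)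
    have hvol : (volume.restrict (Set.Ioc 0 (u : ℝ))).real Set.univ = u := by
      simp [Measure.real]
    rw [hvol, fub] at h6
    rw [e2]
    refine (integral_add_sq_le YL ZL).trans ?_
    have iso' : ∫ ω, Y ω ^ 2 ∂P = ∫ s in Set.Ioc 0 (u : ℝ), φ s := iso.trans fub
    have hΦ0 : 0 ≤ ∫ s in Set.Ioc 0 (u : ℝ), φ s := by
      rw [← iso']; exact integral_nonneg fun _ => sq_nonneg _
    have h7 := mul_le_mul_of_nonneg_left h6 (sq_nonneg m)
    have h8 : m ^ 2 * (u * ∫ s in Set.Ioc 0 (u : ℝ), φ s)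
        ≤ m ^ 2 * (T * ∫ s in Set.Ioc 0 (u : ℝ), φ s) :=
      mul_le_mul_of_nonneg_left (mul_le_mul_of_nonneg_right (NNReal.coe_le_coe.2 hu) hΦ0)
        (sq_nonneg m)
    rw [iso']
    linarith
  have hzero := gronwall_eq_zero (φ := φ) (T := T) (L := 2 + 2 * (m ^ 2 * T)) (by positivity)
    ((DL T le_rfl).integrable_sq.integral_prod_left)
    (fun s _ => integral_nonneg fun _ => sq_nonneg _)
    (fun s hs => by
      have h1 := (main s.toNNReal (Real.toNNReal_le_iff_le_coe.2 hs.2)).2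
      rwa [Real.coe_toNNReal _ hs.1] at h1)
  have hφt := hzero t ⟨t.coe_nonneg, NNReal.coe_le_coe.2 ht⟩
  simp only [hφ, hD, Real.toNNReal_coe] at hφt
  rw [integral_eq_zero_iff_of_nonneg (fun _ => sq_nonneg _) (main t ht).1.integrable_sq] at hφt
  filter_upwards [hφt] with ω hω
  simpa [sub_eq_zero] using hω

end SDE
end MeanVariance

namespace MeanVariance

/-! ### The posterior probability and a jointly measurable version of it. -/

section Posterior

variable {Ω : Type*} {mΩ : MeasurableSpace Ω} {P : Measure Ω}
  {G : Filtration ℝ≥0 mΩ} {A : Set Ω}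

/-- A `[0, 1]`-valued version of the conditional probability of `A`. -/
noncomputable def condProb (P : Measure Ω) (G : Filtration ℝ≥0 mΩ) (A : Set Ω) (t : ℝ≥0)
    (ω : Ω) : ℝ :=
  -- Clipping makes the bounds hold for every `ω`, as is demanded of the coefficients of elementary
  -- processes.
  max 0 (min 1 ((P[A.indicator (fun _ => (1 : ℝ)) | G t]) ω))

theorem condProb_nonneg (t : ℝ≥0) (ω : Ω) : 0 ≤ condProb P G A t ω := le_max_left _ _

theorem condProb_le_one (t : ℝ≥0) (ω : Ω) : condProb P G A t ω ≤ 1 :=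
  max_le zero_le_one (min_le_left _ _)

theorem abs_condProb_le (t : ℝ≥0) (ω : Ω) : |condProb P G A t ω| ≤ 1 :=
  abs_le.2 ⟨by linarith [condProb_nonneg (P := P) (G := G) (A := A) t ω], condProb_le_one t ω⟩

theorem stronglyMeasurable_condProb (t : ℝ≥0) :
    StronglyMeasurable[G t] (condProb P G A t) :=
  (continuous_const.max (continuous_const.min continuous_id)).comp_stronglyMeasurable
    stronglyMeasurable_condExp

theorem measurable_condProb (t : ℝ≥0) : Measurable (condProb P G A t) :=
  ((stronglyMeasurable_condProb t).mono (G.le t)).measurable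

variable [IsProbabilityMeasure P]

theorem integrable_indicator_one (hA : MeasurableSet A) :
    Integrable (A.indicator (fun _ => (1 : ℝ))) P :=
  (integrable_const 1).indicator hA

theorem condProb_ae_eq (hA : MeasurableSet A) (t : ℝ≥0) :
    condProb P G A t =ᵐ[P] P[A.indicator (fun _ => (1 : ℝ)) | G t] := by
  have h1 : 0 ≤ᵐ[P] P[A.indicator (fun _ => (1 : ℝ)) | G t] :=
    condExp_nonneg (Eventually.of_forall fun ω => Set.indicator_nonneg (fun _ _ => zero_le_one) ω)
  have h2 : P[A.indicator (fun _ => (1 : ℝ)) | G t] ≤ᵐ[P] P[fun _ => (1 : ℝ) | G t] :=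
    condExp_mono (integrable_indicator_one hA) (integrable_const 1)
      (Eventually.of_forall fun ω => Set.indicator_le_self' (fun _ _ => zero_le_one) ω)
  rw [condExp_const (G.le t)] at h2
  filter_upwards [h1, h2] with ω h3 h4
  unfold condProb
  rw [min_eq_right h4]
  exact max_eq_right h3

theorem memLp_condProb (t : ℝ≥0) : MemLp (condProb P G A t) 2 P :=
  MemLp.of_bound (measurable_condProb t).aestronglyMeasurable 1
    (Eventually.of_forall fun ω => abs_condProb_le t ω)

/-- The defining property of conditional probabilities. -/
theorem integral_condProb_mul (hA : MeasurableSet A) {t : ℝ≥0} {Z : Ω → ℝ}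
    (hZ : AEStronglyMeasurable[G t] Z P) (hZL : MemLp Z 2 P) :
    ∫ ω, condProb P G A t ω * Z ω ∂P = ∫ ω, A.indicator (fun _ => (1 : ℝ)) ω * Z ω ∂P := by
  have hAL : MemLp (A.indicator (fun _ => (1 : ℝ))) 2 P :=
    memLp_indicator_const 2 hA 1 (Or.inr (measure_ne_top _ _))
  rw [← integral_condExp (G.le t) (f := fun ω => A.indicator (fun _ => (1 : ℝ)) ω * Z ω)]
  refine integral_congr_ae ?_
  have h := condExp_mul_of_aestronglyMeasurable_right (m := G t) (μ := P) hZ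
    (hAL.integrable_mul hZL) (integrable_indicator_one hA)
  filter_upwards [h, condProb_ae_eq (G := G) hA t] with ω h1 h2
  rw [h2]
  exact h1.symm

/-- Martingale orthogonality: pairing the value at `s` with the value at `t`, or with itself, gives
its integral over `A` in both cases. Mean square increments are thus increments of one monotone
bounded function of time. -/
theorem integral_condProb_sub_sq (hA : MeasurableSet A) {s t : ℝ≥0} (hst : s ≤ t) :
    ∫ ω, (condProb P G A s ω - condProb P G A t ω) ^ 2 ∂P
      = ∫ ω, condProb P G A t ω ^ 2 ∂P - ∫ ω, condProb P G A s ω ^ 2 ∂P := by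
  have hm : AEStronglyMeasurable[G s] (condProb P G A s) P :=
    (stronglyMeasurable_condProb s).aestronglyMeasurable
  have h1 := integral_condProb_mul (P := P) hA hm (memLp_condProb s)
  have h2 := integral_condProb_mul (P := P) (t := t) hA (hm.mono (G.mono hst)) (memLp_condProb s)
  rw [ElementaryProcess.integral_sub_sq (memLp_condProb s) (memLp_condProb t)]
  simp_rw [sq]
  have h3 : ∫ ω, condProb P G A s ω * condProb P G A t ω ∂P
      = ∫ ω, condProb P G A s ω * condProb P G A s ω ∂P := by
    rw [h1, ← h2]
    simp_rw [mul_comm (condProb P G A s _) (condProb P G A t _)]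
  rw [h3]
  ring

theorem condProb_sq_mono (hA : MeasurableSet A) :
    Monotone fun t => ∫ ω, condProb P G A t ω ^ 2 ∂P := by
  intro s t hst
  have h := integral_condProb_sub_sq (P := P) (G := G) hA hst
  have h2 : 0 ≤ ∫ ω, (condProb P G A s ω - condProb P G A t ω) ^ 2 ∂P :=
    integral_nonneg fun _ => sq_nonneg _
  simp only
  linarith

theorem integral_condProb_sq_le_one (t : ℝ≥0) : ∫ ω, condProb P G A t ω ^ 2 ∂P ≤ 1 := by
  have : ∫ ω, condProb P G A t ω ^ 2 ∂P ≤ ∫ _, (1 : ℝ) ∂P :=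
    integral_mono (memLp_condProb t).integrable_sq (integrable_const 1) fun ω =>
      pow_le_one₀ (condProb_nonneg t ω) (condProb_le_one t ω)
  simpa using this

/-- The dyadic approximation of a time from below. -/
noncomputable def dyadicFloor (n : ℕ) (t : ℝ≥0) : ℝ≥0 := (⌊t * 2 ^ n⌋₊ : ℝ≥0) / 2 ^ n

theorem dyadicFloor_le (n : ℕ) (t : ℝ≥0) : dyadicFloor n t ≤ t := by
  unfold dyadicFloor
  rw [div_le_iff₀ (by positivity)]
  exact Nat.floor_le zero_le

theorem monotone_dyadicFloor (t : ℝ≥0) : Monotone fun n => dyadicFloor n t := by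
  refine monotone_nat_of_le_succ fun n => ?_
  unfold dyadicFloor
  rw [div_le_div_iff₀ (by positivity) (by positivity), pow_succ]
  have h : ⌊t * 2 ^ n⌋₊ * 2 ≤ ⌊t * (2 ^ n * 2)⌋₊ := by
    refine Nat.le_floor ?_
    push_cast
    rw [← mul_assoc]
    exact mul_le_mul_left (Nat.floor_le zero_le) _
  have h2 : ((⌊t * 2 ^ n⌋₊ : ℝ≥0)) * 2 ≤ ⌊t * (2 ^ n * 2)⌋₊ := by exact_mod_cast h
  calc (⌊t * 2 ^ n⌋₊ : ℝ≥0) * (2 ^ n * 2) = (⌊t * 2 ^ n⌋₊ : ℝ≥0) * 2 * 2 ^ n := by ring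
    _ ≤ _ := mul_le_mul_left h2 _

theorem tendsto_dyadicFloor (t : ℝ≥0) : Tendsto (fun n => dyadicFloor n t) atTop (𝓝 t) := by
  rw [← NNReal.tendsto_coe]
  have h1 : Tendsto (fun n : ℕ => (2 : ℝ) ^ n) atTop atTop :=
    tendsto_pow_atTop_atTop_of_one_lt one_lt_two
  have h2 := (tendsto_nat_floor_mul_div_atTop (R := ℝ) t.coe_nonneg).comp h1
  refine h2.congr fun n => ?_
  simp only [Function.comp, dyadicFloor]
  push_cast
  congr 2

omit [IsProbabilityMeasure P] in
theorem measurable_condProb_dyadicFloor (n : ℕ) :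
    Measurable fun p : ℝ≥0 × Ω => condProb P G A (dyadicFloor n p.1) p.2 := by
  obtain ⟨f, hf⟩ : ∃ f : ℕ → Ω → ℝ, f = fun k : ℕ => condProb P G A ((k : ℝ≥0) / 2 ^ n) := ⟨_, rfl⟩
  have h0 : ∀ k, Measurable (f k) := fun k => by rw [hf]; exact measurable_condProb _
  have h1 : Measurable fun q : ℕ × Ω => f q.1 q.2 :=
    measurable_from_prod_countable_right fun k => h0 k
  have h2 : Measurable fun p : ℝ≥0 × Ω => (⌊p.1 * 2 ^ n⌋₊, p.2) :=
    (Nat.measurable_floor.comp (measurable_fst.mul_const _)).prodMk measurable_snd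
  have h3 : (fun p : ℝ≥0 × Ω => condProb P G A (dyadicFloor n p.1) p.2)
      = fun p : ℝ≥0 × Ω => f ⌊p.1 * 2 ^ n⌋₊ p.2 := by
    rw [hf]; rfl
  rw [h3]
  exact h1.comp h2

theorem l2Tendsto_condProb_dyadicFloor (hA : MeasurableSet A) {t : ℝ≥0}
    (ht : ContinuousAt (fun t => ∫ ω, condProb P G A t ω ^ 2 ∂P) t) :
    L2Tendsto P (fun n => condProb P G A (dyadicFloor n t)) (condProb P G A t) := by
  refine L2Tendsto.of_integral (fun n => memLp_condProb _) (memLp_condProb t) ?_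
  simp_rw [integral_condProb_sub_sq hA (dyadicFloor_le _ t)]
  have := (tendsto_const_nhds (x := ∫ ω, condProb P G A t ω ^ 2 ∂P)).sub
    (ht.tendsto.comp (tendsto_dyadicFloor t))
  simpa using this

/-- Dyadic floors increase with `n`, so Lévy's upward theorem gives almost sure convergence. At
continuity points of the second moment, the `L²` limit shows that the limit is the value at `t`
itself, not only a left limit. -/
theorem limsup_condProb_ae_eq (hA : MeasurableSet A) {t : ℝ≥0}
    (ht : ContinuousAt (fun t => ∫ ω, condProb P G A t ω ^ 2 ∂P) t) :
    (fun ω => limsup (fun n => condProb P G A (dyadicFloor n t) ω) atTop)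
      =ᵐ[P] condProb P G A t := by
  let 𝓗 : Filtration ℕ mΩ :=
    { seq := fun n => G (dyadicFloor n t)
      mono' := fun i j hij => G.mono (monotone_dyadicFloor t hij)
      le' := fun n => G.le _ }
  have h1 := tendsto_ae_condExp (ℱ := 𝓗) (μ := P) (A.indicator (fun _ => (1 : ℝ)))
  have h2 : ∀ᵐ ω ∂P, ∀ n, condProb P G A (dyadicFloor n t) ω
      = (P[A.indicator (fun _ => (1 : ℝ)) | 𝓗 n]) ω :=
    ae_all_iff.2 fun n => condProb_ae_eq hA _
  obtain ⟨φ, hφ, h3⟩ := (l2Tendsto_condProb_dyadicFloor (P := P) (G := G) hA ht).exists_subseq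
    (fun n => (memLp_condProb _).1) (memLp_condProb t).1
  filter_upwards [h1, h2, h3] with ω k1 k2 k3
  have k4 : Tendsto (fun n => condProb P G A (dyadicFloor n t) ω) atTop
      (𝓝 ((P[A.indicator (fun _ => (1 : ℝ)) | ⨆ n, 𝓗 n]) ω)) := by
    simp_rw [k2]; exact k1
  rw [k4.limsup_eq]
  exact tendsto_nhds_unique (k4.comp hφ.tendsto_atTop) k3

/-- On countably many time slices a jointly measurable function may be replaced by arbitrary
measurable ones. -/
theorem measurable_of_countable_slices {D : Set ℝ≥0} (hD : D.Countable) {f g : ℝ≥0 × Ω → ℝ}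
    (hf : ∀ t, Measurable fun ω => f (t, ω)) (hg : Measurable g) [DecidablePred (· ∈ D)] :
    Measurable fun p => if p.1 ∈ D then f p else g p := by
  intro B hB
  have hDm : MeasurableSet {p : ℝ≥0 × Ω | p.1 ∈ D} := hD.measurableSet.preimage measurable_fst
  have e : (fun p => if p.1 ∈ D then f p else g p) ⁻¹' B
      = (⋃ d ∈ D, {d} ×ˢ ((fun ω => f (d, ω)) ⁻¹' B)) ∪
        ({p : ℝ≥0 × Ω | p.1 ∈ D}ᶜ ∩ g ⁻¹' B) := by
    ext p
    by_cases h : p.1 ∈ D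
    · simp only [Set.mem_preimage, h, if_true, Set.mem_union, Set.mem_iUnion, Set.mem_prod,
        Set.mem_singleton_iff, Set.mem_inter_iff, Set.mem_compl_iff]
      constructor
      · exact fun h2 => Or.inl ⟨p.1, h, rfl, h2⟩
      · rintro (⟨d, _, rfl, h2⟩ | h2)
        · exact h2
        · exact absurd h h2.1
    · simp only [Set.mem_preimage, h, if_false, Set.mem_union, Set.mem_iUnion, Set.mem_prod,
        Set.mem_singleton_iff, Set.mem_inter_iff, Set.mem_compl_iff]
      constructor
      · exact fun h2 => Or.inr ⟨h, h2⟩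
      · rintro (⟨d, hd, rfl, _⟩ | h2)
        · exact absurd hd h
        · exact h2.2
  rw [e]
  exact (MeasurableSet.biUnion hD fun d _ => (measurableSet_singleton d).prod (hf d hB)).union
    (hDm.compl.inter (hg hB))

/-- A jointly measurable version of the conditional probability process exists. -/
theorem exists_measurable_condProb (hA : MeasurableSet A) :
    ∃ π : ℝ≥0 → Ω → ℝ, Measurable (Function.uncurry π) ∧
      ∀ t, π t =ᵐ[P] P[A.indicator (fun _ => (1 : ℝ)) | G t] := by
  classical
  -- A monotone second moment has only countably many discontinuities. At those times the version is
  -- prescribed slice by slice, elsewhere as the limit along dyadic floors.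
  set D : Set ℝ≥0 := {t | ¬ContinuousAt (fun t => ∫ ω, condProb P G A t ω ^ 2 ∂P) t} with hDdef
  have hD : D.Countable := (condProb_sq_mono hA).countable_not_continuousAt
  refine ⟨fun t ω => if t ∈ D then condProb P G A t ω else
    limsup (fun n => condProb P G A (dyadicFloor n t) ω) atTop, ?_, fun t => ?_⟩
  · exact measurable_of_countable_slices hD (f := fun p => condProb P G A p.1 p.2)
      (fun t => measurable_condProb t) (Measurable.limsup measurable_condProb_dyadicFloor)
  · refine EventuallyEq.trans ?_ (condProb_ae_eq hA t)
    by_cases ht : t ∈ D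
    · simp only [ht, if_true]
      exact EventuallyEq.rfl
    · simp only [ht, if_false]
      exact limsup_condProb_ae_eq hA (not_not.1 ht)

end Posterior
end MeanVariance

namespace MeanVariance

/-! ### Elementary approximation of the posterior. -/

section Approximation

variable {Ω : Type*} {mΩ : MeasurableSpace Ω} {P : Measure Ω} [IsProbabilityMeasure P]
  {G : Filtration ℝ≥0 mΩ} {A : Set Ω} {T : ℝ≥0} {π : ℝ≥0 → Ω → ℝ}

theorem toNNReal_le_of_mem {T : ℝ≥0} {s : ℝ} (hs : s ∈ Set.Ioc 0 (T : ℝ)) : s.toNNReal ≤ T :=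
  Real.toNNReal_le_iff_le_coe.2 hs.2

omit [IsProbabilityMeasure P] in
theorem measurable_affine (hπ : Measurable (Function.uncurry π)) (c₀ c₁ : ℝ) :
    Measurable fun p : ℝ × Ω => c₀ + c₁ * π p.1.toNNReal p.2 := by
  have h : Measurable fun p : ℝ × Ω => (p.1.toNNReal, p.2) :=
    (measurable_real_toNNReal.comp measurable_fst).prodMk measurable_snd
  exact ((hπ.comp h).const_mul c₁).const_add c₀

theorem ae_mem_unit_of_section (hπ : Measurable (Function.uncurry π))
    (hπc : ∀ t ≤ T, π t =ᵐ[P] condProb P G A t) :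
    ∀ᵐ p : ℝ × Ω ∂(timeMeasure P T), 0 ≤ π p.1.toNNReal p.2 ∧ π p.1.toNNReal p.2 ≤ 1 := by
  have hm : Measurable fun p : ℝ × Ω => π p.1.toNNReal p.2 := by
    have := measurable_affine hπ 0 1
    simpa using this
  refine (Measure.ae_prod_iff_ae_ae
    (p := fun p : ℝ × Ω => 0 ≤ π p.1.toNNReal p.2 ∧ π p.1.toNNReal p.2 ≤ 1)
    ((measurableSet_le measurable_const hm).inter (measurableSet_le hm measurable_const))).2 ?_
  filter_upwards [ae_restrict_mem measurableSet_Ioc] with s hs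
  filter_upwards [hπc s.toNNReal (toNNReal_le_of_mem hs)] with ω hω
  rw [hω]
  exact ⟨condProb_nonneg _ _, condProb_le_one _ _⟩

theorem ae_abs_affine_le (hπ : Measurable (Function.uncurry π))
    (hπc : ∀ t ≤ T, π t =ᵐ[P] condProb P G A t) (c₀ c₁ : ℝ) :
    ∀ᵐ p : ℝ × Ω ∂(timeMeasure P T), |c₀ + c₁ * π p.1.toNNReal p.2| ≤ |c₀| + |c₁| := by
  filter_upwards [ae_mem_unit_of_section hπ hπc] with p hp
  refine (abs_add_le _ _).trans (add_le_add_right ?_ _)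
  rw [abs_mul, abs_of_nonneg hp.1]
  exact mul_le_of_le_one_right (abs_nonneg _) hp.2

theorem memLp_affine (hπ : Measurable (Function.uncurry π))
    (hπc : ∀ t ≤ T, π t =ᵐ[P] condProb P G A t) (c₀ c₁ : ℝ) :
    MemLp (fun p : ℝ × Ω => c₀ + c₁ * π p.1.toNNReal p.2) 2 (timeMeasure P T) :=
  MemLp.of_bound (measurable_affine hπ c₀ c₁).aestronglyMeasurable _
    (ae_abs_affine_le hπ hπc c₀ c₁)

omit [IsProbabilityMeasure P] in
theorem abs_affine_condProb_le (c₀ c₁ : ℝ) (t : ℝ≥0) (ω : Ω) :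
    |c₀ + c₁ * condProb P G A t ω| ≤ |c₀| + |c₁| := by
  refine (abs_add_le _ _).trans (add_le_add_right ?_ _)
  rw [abs_mul]
  exact mul_le_of_le_one_right (abs_nonneg _) (abs_condProb_le t ω)

/-- Affine functions of the conditional probability, sampled along a uniform grid. -/
noncomputable def condGrid (P : Measure Ω) (G : Filtration ℝ≥0 mΩ) (A : Set Ω) (c₀ c₁ : ℝ)
    (T : ℝ≥0) (N : ℕ) : ElementaryProcess G :=
  ElementaryProcess.grid T N (fun i ω => c₀ + c₁ * condProb P G A (i * (T / N)) ω)
    (fun _ => stronglyMeasurable_const.add ((stronglyMeasurable_condProb _).const_mul c₁))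
    fun _ => ⟨|c₀| + |c₁|, fun ω => abs_affine_condProb_le c₀ c₁ _ ω⟩

/-- On each grid interval the mean square error is at most `c₁²` times the increment of the second
moment. These increments telescope to at most one, and the mesh supplies the factor `T / N`. No path
regularity of `π` is involved. -/
theorem integral_condGrid_sub_sq_le (hA : MeasurableSet A) (hπ : Measurable (Function.uncurry π))
    (hπc : ∀ t ≤ T, π t =ᵐ[P] condProb P G A t) (c₀ c₁ : ℝ) {N : ℕ} (hN : N ≠ 0) :
    ∫ p : ℝ × Ω, ((condGrid P G A c₀ c₁ T N).evalProd p - (c₀ + c₁ * π p.1.toNNReal p.2)) ^ 2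
      ∂(timeMeasure P T) ≤ c₁ ^ 2 * T / N := by
  have hN' : (0 : ℝ) < N := Nat.cast_pos.2 (Nat.pos_of_ne_zero hN)
  set K := condGrid P G A c₀ c₁ T N with hK
  set φ : ℝ≥0 → ℝ := fun t => ∫ ω, condProb P G A t ω ^ 2 ∂P with hφ
  have hφm : Monotone φ := condProb_sq_mono hA
  set τ : ℕ → ℝ≥0 := fun i => (i : ℝ≥0) * (T / N) with hτdef
  have hτ : Monotone τ := fun i j hij => mul_le_mul_left (Nat.cast_le.2 hij) _
  have hτT : ∀ {i}, i ≤ N → τ i ≤ T := fun hi => grid_le hi T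
  have hτN : τ N = T := by
    have : (N : ℝ≥0) ≠ 0 := Nat.cast_ne_zero.2 hN
    exact mul_div_cancel₀ _ this
  have hτ0 : τ 0 = 0 := by simp [hτdef]
  have hstep : ∀ i, (τ (i + 1) : ℝ) - τ i = (T : ℝ) / N := fun i => by
    simp only [hτdef, coe_grid]; push_cast; ring
  have DL : MemLp (fun p : ℝ × Ω => K.evalProd p - (c₀ + c₁ * π p.1.toNNReal p.2)) 2
    (timeMeasure P T) := (K.memLp_evalProd T).sub (memLp_affine hπ hπc c₀ c₁)
  set g : ℝ → ℝ := fun s => ∫ ω, (K.evalProd (s, ω) - (c₀ + c₁ * π s.toNNReal ω)) ^ 2 ∂P with hg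
  have fub : ∫ p : ℝ × Ω, (K.evalProd p - (c₀ + c₁ * π p.1.toNNReal p.2)) ^ 2 ∂(timeMeasure P T)
      = ∫ s in (0 : ℝ)..T, g s := by
    rw [intervalIntegral.integral_of_le T.coe_nonneg]
    exact integral_prod _ DL.integrable_sq
  have gint : IntegrableOn g (Set.Ioc 0 (T : ℝ)) := DL.integrable_sq.integral_prod_left
  have gint' : ∀ i < N, IntervalIntegrable g volume (τ i) (τ (i + 1)) := fun i hi => by
    rw [intervalIntegrable_iff_integrableOn_Ioc_of_le (NNReal.coe_le_coe.2 (hτ (Nat.le_succ i)))]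
    exact gint.mono_set (Set.Ioc_subset_Ioc (NNReal.coe_nonneg _) (NNReal.coe_le_coe.2 (hτT hi)))
  have gle : ∀ i < N, ∀ s ∈ Set.Ioc (τ i : ℝ) (τ (i + 1)),
      g s ≤ c₁ ^ 2 * (φ (τ (i + 1)) - φ (τ i)) := by
    intro i hi s hs
    have hs0 : 0 < s := (NNReal.coe_nonneg _).trans_lt hs.1
    have hs' : s.toNNReal ∈ Set.Ioc (τ i) (τ (i + 1)) :=
      ⟨Real.lt_toNNReal_iff_coe_lt.2 hs.1, Real.toNNReal_le_iff_le_coe.2 hs.2⟩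
    have hev : ∀ ω, K.evalProd (s, ω) = c₀ + c₁ * condProb P G A (τ i) ω := fun ω =>
      K.eval_eq_of_mem (i := i) hi hs' ω
    have e : g s = c₁ ^ 2 * ∫ ω, (condProb P G A (τ i) ω - condProb P G A s.toNNReal ω) ^ 2 ∂P := by
      rw [← integral_const_mul]
      refine integral_congr_ae ?_
      filter_upwards [hπc s.toNNReal (hs'.2.trans (hτT hi))] with ω hω
      rw [hev, hω]; ring
    rw [e, integral_condProb_sub_sq hA hs'.1.le]
    exact mul_le_mul_of_nonneg_left (sub_le_sub_right (hφm hs'.2) _) (sq_nonneg _)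
  have h0 : ((τ 0 : ℝ≥0) : ℝ) = 0 := by rw [hτ0]; rfl
  have hsum := intervalIntegral.sum_integral_adjacent_intervals (a := fun i => (τ i : ℝ)) gint'
  simp only [h0, hτN] at hsum
  rw [fub, ← hsum]
  have hle : ∀ i ∈ Finset.range N, ∫ s in (τ i : ℝ)..(τ (i + 1)), g s
      ≤ (T / N) * c₁ ^ 2 * (φ (τ (i + 1)) - φ (τ i)) := by
    intro i hi
    have hi' := Finset.mem_range.1 hi
    have hle' : (τ i : ℝ) ≤ τ (i + 1) := NNReal.coe_le_coe.2 (hτ (Nat.le_succ i))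
    have h1 : ∫ s in (τ i : ℝ)..(τ (i + 1)), g s
        ≤ ∫ _ in (τ i : ℝ)..(τ (i + 1)), c₁ ^ 2 * (φ (τ (i + 1)) - φ (τ i)) := by
      rw [intervalIntegral.integral_of_le hle', intervalIntegral.integral_of_le hle']
      refine setIntegral_mono_on ?_ (integrableOn_const (by simp)) measurableSet_Ioc (gle i hi')
      exact (intervalIntegrable_iff_integrableOn_Ioc_of_le hle').1 (gint' i hi')
    refine h1.trans (le_of_eq ?_)
    rw [intervalIntegral.integral_const, hstep, smul_eq_mul]
    ring
  refine (Finset.sum_le_sum hle).trans ?_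
  rw [← Finset.mul_sum, Finset.sum_range_sub (fun i => φ (τ i))]
  have h1 : φ (τ N) ≤ 1 := integral_condProb_sq_le_one _
  have h2 : 0 ≤ φ (τ 0) := integral_nonneg fun _ => sq_nonneg _
  have h3 : 0 ≤ (T : ℝ) / N * c₁ ^ 2 := by positivity
  refine (mul_le_mul_of_nonneg_left (by linarith : φ (τ N) - φ (τ 0) ≤ 1) h3).trans (le_of_eq ?_)
  ring

theorem l2Tendsto_condGrid (hA : MeasurableSet A) (hπ : Measurable (Function.uncurry π))
    (hπc : ∀ t ≤ T, π t =ᵐ[P] condProb P G A t) (c₀ c₁ : ℝ) :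
    L2Tendsto (timeMeasure P T) (fun n => (condGrid P G A c₀ c₁ T (n + 1)).evalProd)
      (fun p : ℝ × Ω => c₀ + c₁ * π p.1.toNNReal p.2) := by
  refine L2Tendsto.of_integral (fun n => ElementaryProcess.memLp_evalProd _ T)
    (memLp_affine hπ hπc c₀ c₁) ?_
  refine squeeze_zero (fun n => integral_nonneg fun _ => sq_nonneg _)
    (fun n => integral_condGrid_sub_sq_le hA hπ hπc c₀ c₁ (Nat.succ_ne_zero n)) ?_
  refine Tendsto.const_div_atTop ?_ _
  exact tendsto_natCast_atTop_atTop.comp (tendsto_add_atTop_nat 1)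

end Approximation

/-! ### Passing from the observation filtration to a larger one. -/

section ChangeOfFiltration

variable {Ω : Type*} {mΩ : MeasurableSpace Ω} {G F : Filtration ℝ≥0 mΩ}

/-- An elementary process is elementary for every larger filtration. -/
def ElementaryProcess.enlarge (K : ElementaryProcess G) (h : ∀ t, G t ≤ F t) :
    ElementaryProcess F where
  n := K.n
  time := K.time
  monotone_time := K.monotone_time
  coef := K.coef
  measurable_coef i := (K.measurable_coef i).mono (h _)
  bounded_coef := K.bounded_coef

end ChangeOfFiltration
end MeanVariance

/-! ### Partial observation and integrals against the innovation process. -/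

namespace MeanVariance

variable {Ω : Type*} {mΩ : MeasurableSpace Ω} {P : Measure Ω} {G F : Filtration ℝ≥0 mΩ}
  {W S π : ℝ≥0 → Ω → ℝ} {A : Set Ω} {a b s₀ : ℝ} {T : ℝ≥0}

/-- A random drift which takes the value `a` on `A` and `b` off `A`. -/
noncomputable def twoPointDrift (a b : ℝ) (A : Set Ω) (ω : Ω) : ℝ :=
  b + (a - b) * A.indicator (fun _ => (1 : ℝ)) ω

/-- A filtration `G` that observes a geometric Brownian motion `S` with the drift `a` on `A` and `b`
off `A`, along with a version `π` of the conditional probability of `A` given `G`. -/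
structure PartialObservation (P : Measure Ω) (G F : Filtration ℝ≥0 mΩ) (W : ℝ≥0 → Ω → ℝ)
    (A : Set Ω) (a b s₀ : ℝ) (T : ℝ≥0) (S π : ℝ≥0 → Ω → ℝ) : Prop where
  brownian : IsFiltrationBrownian P F W
  le : ∀ t, G t ≤ F t
  measurableSet : MeasurableSet[F 0] A
  observed : ∀ t, StronglyMeasurable[G t] (S t)
  pos : 0 < s₀
  price : ∀ t ≤ T, S t =ᵐ[P] gbm W (twoPointDrift a b A) s₀ t
  measurable_posterior : Measurable (Function.uncurry π)
  posterior : ∀ t ≤ T, π t =ᵐ[P] condProb P G A t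

/-- The drift of the innovation process with respect to the large filtration. -/
noncomputable def filteringError (a b : ℝ) (A : Set Ω) (π : ℝ≥0 → Ω → ℝ) (p : ℝ × Ω) : ℝ :=
  (a - b) * (A.indicator (fun _ => (1 : ℝ)) p.2 - π p.1.toNNReal p.2)

theorem ae_abs_setIntegral_le {P : Measure Ω} [SFinite P] {ν : Measure ℝ} [IsFiniteMeasure ν]
    {f : ℝ × Ω → ℝ} {C : ℝ} (hC : ∀ᵐ p ∂(ν.prod P), |f p| ≤ C) :
    ∀ᵐ ω ∂P, |∫ s, f (s, ω) ∂ν| ≤ C * ν.real Set.univ := by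
  have h : ∀ᵐ q ∂(P.prod ν), |f q.swap| ≤ C := by
    rw [← Measure.prod_swap] at hC
    exact ae_of_ae_map measurable_swap.aemeasurable hC
  filter_upwards [Measure.ae_ae_of_ae_prod h] with ω hω
  exact norm_integral_le_of_norm_le_const (f := fun s => f (s, ω)) hω

namespace PartialObservation

theorem measurableSet' (h : PartialObservation P G F W A a b s₀ T S π) : MeasurableSet A :=
  F.le 0 _ h.measurableSet

theorem measurable_filteringError (h : PartialObservation P G F W A a b s₀ T S π) :
    Measurable (filteringError a b A π) := by
  have h1 : Measurable fun p : ℝ × Ω => A.indicator (fun _ => (1 : ℝ)) p.2 :=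
    (measurable_const.indicator h.measurableSet').comp measurable_snd
  have h2 : Measurable fun p : ℝ × Ω => π p.1.toNNReal p.2 := by
    simpa using measurable_affine h.measurable_posterior 0 1
  exact (h1.sub h2).const_mul _

variable [IsProbabilityMeasure P]

theorem ae_abs_filteringError_le (h : PartialObservation P G F W A a b s₀ T S π) :
    ∀ᵐ p ∂(timeMeasure P T), |filteringError a b A π p| ≤ |a - b| := by
  filter_upwards [ae_mem_unit_of_section h.measurable_posterior h.posterior] with p hp
  unfold filteringError
  rw [abs_mul]
  refine mul_le_of_le_one_right (abs_nonneg _) ?_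
  by_cases hA : p.2 ∈ A
  · rw [Set.indicator_of_mem hA, abs_le]; constructor <;> linarith [hp.1, hp.2]
  · rw [Set.indicator_of_notMem hA, abs_le]; constructor <;> linarith [hp.1, hp.2]

theorem memLp_filteringError (h : PartialObservation P G F W A a b s₀ T S π) :
    MemLp (filteringError a b A π) 2 (timeMeasure P T) :=
  MemLp.of_bound h.measurable_filteringError.aestronglyMeasurable _ h.ae_abs_filteringError_le

/-- The drift of `log S` is `twoPointDrift a b A - 1 / 2`. Subtracting its estimate leaves exactly
the filtering error. -/
theorem innovation_ae_eq (h : PartialObservation P G F W A a b s₀ T S π) {t : ℝ≥0} (ht : t ≤ T) :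
    ∀ᵐ ω ∂P, innovation a b S π t ω = Real.log s₀ + (W t ω - W 0 ω)
      + ∫ s in (0 : ℝ)..t, filteringError a b A π (s, ω) := by
  filter_upwards [h.price t ht, ae_integrable_section
    (memLp_affine h.measurable_posterior h.posterior (b - 1 / 2) (a - b))] with ω hω hi
  have hi' : IntervalIntegrable (fun s : ℝ => b - 1 / 2 + (a - b) * π s.toNNReal ω) volume 0 t := by
    rw [intervalIntegrable_iff_integrableOn_Ioc_of_le t.coe_nonneg]
    exact IntegrableOn.mono_set hi (Set.Ioc_subset_Ioc_right (NNReal.coe_le_coe.2 ht))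
  have e : (fun s : ℝ => filteringError a b A π (s, ω)) = fun s : ℝ =>
      (twoPointDrift a b A ω - 1 / 2) - (b - 1 / 2 + (a - b) * π s.toNNReal ω) := by
    funext s
    simp only [filteringError, twoPointDrift]
    ring
  rw [innovation, hω, e, intervalIntegral.integral_sub intervalIntegrable_const hi', gbm,
    Real.log_mul h.pos.ne' (Real.exp_ne_zero _), Real.log_exp, intervalIntegral.integral_const]
  simp only [sub_zero, smul_eq_mul]
  ring

/-- The decomposition of the innovation holds almost surely at each fixed time; only the countably
many partition times enter, so one null set serves them all. -/
theorem integral_innovation_ae_eq (h : PartialObservation P G F W A a b s₀ T S π)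
    (K : ElementaryProcess G) :
    ∀ᵐ ω ∂P, K.integral (innovation a b S π) T ω = K.integral W T ω
      + ∫ s in Set.Ioc 0 (T : ℝ), K.evalProd (s, ω) * filteringError a b A π (s, ω) := by
  have h1 : ∀ᵐ ω ∂P, ∀ i, innovation a b S π (min (K.time i) T) ω
      = Real.log s₀ + (W (min (K.time i) T) ω - W 0 ω)
      + ∫ s in (0 : ℝ)..(min (K.time i) T : ℝ≥0), filteringError a b A π (s, ω) :=
    ae_all_iff.2 fun i => h.innovation_ae_eq (min_le_right _ _)
  filter_upwards [h1, ae_integrable_section h.memLp_filteringError] with ω hω hi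
  have hi' : ∀ t : ℝ≥0, t ≤ T →
      IntervalIntegrable (fun s : ℝ => filteringError a b A π (s, ω)) volume 0 t := fun t ht => by
    rw [intervalIntegrable_iff_integrableOn_Ioc_of_le t.coe_nonneg]
    exact IntegrableOn.mono_set hi (Set.Ioc_subset_Ioc_right (NNReal.coe_le_coe.2 ht))
  have key := K.setIntegral_eval_mul T (θ := fun s => filteringError a b A π (s, ω)) hi ω
  change ∫ s in Set.Ioc 0 (T : ℝ), K.evalProd (s, ω) * filteringError a b A π (s, ω) = _ at key
  rw [key, ElementaryProcess.integral, ElementaryProcess.integral, ← Finset.sum_add_distrib]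
  refine Finset.sum_congr rfl fun i _ => ?_
  rw [hω i, hω (i + 1), ← intervalIntegral.integral_interval_sub_left
    (hi' _ (min_le_right _ _)) (hi' _ (min_le_right _ _))]
  ring

theorem memLp_mul_filteringError (h : PartialObservation P G F W A a b s₀ T S π)
    {f : ℝ × Ω → ℝ} (hf : MemLp f 2 (timeMeasure P T)) :
    MemLp (fun p => f p * filteringError a b A π p) 2 (timeMeasure P T) := by
  simpa only [mul_comm] using memLp_bdd_mul
    h.measurable_filteringError.aestronglyMeasurable h.ae_abs_filteringError_le hf

theorem memLp_integral_mul_filteringError (h : PartialObservation P G F W A a b s₀ T S π)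
    {f : ℝ × Ω → ℝ} (hf : MemLp f 2 (timeMeasure P T)) :
    MemLp (fun ω => ∫ s in Set.Ioc 0 (T : ℝ), f (s, ω) * filteringError a b A π (s, ω)) 2 P :=
  memLp_integral (ν := volume.restrict (Set.Ioc 0 (T : ℝ)))
    (f := fun p => f p * filteringError a b A π p) (h.memLp_mul_filteringError hf)

theorem l2Tendsto_integral_filteringError (h : PartialObservation P G F W A a b s₀ T S π)
    {K : ℕ → ElementaryProcess G} {H : ℝ × Ω → ℝ} (hH : MemLp H 2 (timeMeasure P T))
    (hK : L2Tendsto (timeMeasure P T) (fun n => (K n).evalProd) H) :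
    L2Tendsto P
      (fun n ω => ∫ s in Set.Ioc 0 (T : ℝ), (K n).evalProd (s, ω) * filteringError a b A π (s, ω))
      (fun ω => ∫ s in Set.Ioc 0 (T : ℝ), H (s, ω) * filteringError a b A π (s, ω)) :=
  L2Tendsto.integral (ν := volume.restrict (Set.Ioc 0 (T : ℝ)))
    (f := fun n p => (K n).evalProd p * filteringError a b A π p)
    (g := fun p => H p * filteringError a b A π p) (hK.mul_of_bound h.ae_abs_filteringError_le)
    (fun n => h.memLp_mul_filteringError ((K n).memLp_evalProd T))
    (h.memLp_mul_filteringError hH)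

theorem memLp_integral_innovation (h : PartialObservation P G F W A a b s₀ T S π)
    (K : ElementaryProcess G) : MemLp (K.integral (innovation a b S π) T) 2 P := by
  have h1 : MemLp (K.integral W T) 2 P :=
    (K.enlarge h.le).memLp_integral h.brownian T
  refine (memLp_congr_ae (h.integral_innovation_ae_eq K)).2 (h1.add ?_)
  exact h.memLp_integral_mul_filteringError (K.memLp_evalProd T)

/-- Itô integrals against the innovation process are Itô integrals against the Brownian motion plus
the integral of the drift. -/
theorem isItoIntegral_brownian (h : PartialObservation P G F W A a b s₀ T S π) {H : ℝ≥0 → Ω → ℝ}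
    {I : Ω → ℝ} (hI : IsItoIntegral P G (innovation a b S π) T H I)
    (hH : MemLp (fun p : ℝ × Ω => H p.1.toNNReal p.2) 2 (timeMeasure P T)) :
    IsItoIntegral P F W T H (fun ω => I ω
      - ∫ s in Set.Ioc 0 (T : ℝ), H s.toNNReal ω * filteringError a b A π (s, ω)) := by
  obtain ⟨K, hK, hKI⟩ := hI.exists_approx
  have hB : MemLp (fun ω => ∫ s in Set.Ioc 0 (T : ℝ),
      H s.toNNReal ω * filteringError a b A π (s, ω)) 2 P :=
    h.memLp_integral_mul_filteringError hH
  -- The same approximating processes are used, read as elementary processes of `F`.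
  refine ⟨hI.aestronglyMeasurable_integrand, hI.memLp.sub hB,
    fun n => (K n).enlarge h.le, hK, ?_⟩
  have h1 := (h.l2Tendsto_integral_filteringError hH hK).const_mul (-1)
  have hBn := fun n => h.memLp_integral_mul_filteringError
    ((K n).memLp_evalProd T)
  have h2 : L2Tendsto P (fun n => (K n).integral (innovation a b S π) T) I := hKI
  refine (h2.add h1 (fun n => ((h.memLp_integral_innovation (K n)).sub hI.memLp).1)
    (fun n => (((hBn n).const_mul (-1)).sub (hB.const_mul (-1))).1)).congr (fun n => ?_)
    (Eventually.of_forall fun ω => by simp only; ring)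
  filter_upwards [h.integral_innovation_ae_eq (K n)] with ω hω
  rw [hω]
  change _ = (K n).integral W T ω
  ring

/-- The grid approximations are elementary for `G`. Their integrals against `W` converge by the
isometry in `F`, and their drift terms converge because the filtering error is bounded. No isometry
for the innovation is needed. -/
theorem exists_isItoIntegral_innovation (h : PartialObservation P G F W A a b s₀ T S π)
    (c₀ c₁ : ℝ) :
    ∃ I, IsItoIntegral P G (innovation a b S π) T (fun s ω => c₀ + c₁ * π s ω) I := by
  have hH := memLp_affine h.measurable_posterior h.posterior c₀ c₁
  have hK := l2Tendsto_condGrid h.measurableSet' h.measurable_posterior h.posterior c₀ c₁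
  obtain ⟨J, hJ, hKJ⟩ := IsItoIntegral.exists_of_approx (H := fun s ω => c₀ + c₁ * π s ω)
    h.brownian (fun n => (condGrid P G A c₀ c₁ T (n + 1)).enlarge h.le) hH.1 hK
  have hB := h.memLp_integral_mul_filteringError hH
  refine ⟨_, hH.1, hJ.memLp.add hB, fun n => condGrid P G A c₀ c₁ T (n + 1), hK, ?_⟩
  have hBn := fun n => h.memLp_integral_mul_filteringError
    ((condGrid P G A c₀ c₁ T (n + 1)).memLp_evalProd T)
  refine (hKJ.add (h.l2Tendsto_integral_filteringError hH hK)
    (fun n => ((ElementaryProcess.memLp_integral h.brownian _ T).sub hJ.memLp).1)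
    (fun n => ((hBn n).sub hB).1)).congr (fun n => ?_) (ae_eq_refl _)
  filter_upwards [h.integral_innovation_ae_eq (condGrid P G A c₀ c₁ T (n + 1))] with ω hω
  rw [hω]
  rfl

/-- Exponential moments of the Itô integrals of affine functions of the posterior. -/
theorem integrable_exp_mul_of_isItoIntegral (h : PartialObservation P G F W A a b s₀ T S π)
    {c₀ c₁ c : ℝ} (hc : c ≠ 0) {J : Ω → ℝ}
    (hJ : IsItoIntegral P F W T (fun s ω => c₀ + c₁ * π s ω) J) :
    Integrable (fun ω => Real.exp (c * J ω)) P := by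
  have hH := memLp_affine h.measurable_posterior h.posterior c₀ c₁
  have hK := l2Tendsto_condGrid h.measurableSet' h.measurable_posterior h.posterior c₀ c₁
  obtain ⟨J', hJ', hKJ⟩ := IsItoIntegral.exists_of_approx (H := fun s ω => c₀ + c₁ * π s ω)
    h.brownian (fun n => (condGrid P G A c₀ c₁ T (n + 1)).enlarge h.le) hH.1 hK
  -- The summand `1` keeps the bound positive when both constants vanish.
  have hC : 0 < |c₀| + |c₁| + 1 := by positivity
  have hb := fun n : ℕ => ElementaryProcess.integral_exp_le h.brownian
    ((condGrid P G A c₀ c₁ T (n + 1)).enlarge h.le) hC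
    (fun i ω => (abs_affine_condProb_le c₀ c₁ _ ω).trans (le_add_of_nonneg_right zero_le_one)) hc T
  have := integrable_exp_of_l2Tendsto hKJ
    (fun n => (ElementaryProcess.memLp_integral h.brownian _ T).1) hJ'.memLp.1 c
    (fun n => (hb n).1) (fun n => (hb n).2)
  refine this.congr ?_
  filter_upwards [hJ'.unique h.brownian hJ] with ω hω
  rw [hω]

end PartialObservation
end MeanVariance

/-! ### Square integrability and measurability of the state price density. -/

namespace MeanVariance

/-- The rate of the finite variation part of the logarithm of the state price density with respect
to the large filtration. -/
noncomputable def exponentRate {Ω : Type*} (a b r : ℝ) (A : Set Ω) (π : ℝ≥0 → Ω → ℝ)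
    (p : ℝ × Ω) : ℝ :=
  (b - r + (a - b) * π p.1.toNNReal p.2) * filteringError a b A π p
    + (r + 1 / 2 * (b - r + (a - b) * π p.1.toNNReal p.2) ^ 2)

/-- A bound for `exponentRate`. -/
noncomputable def exponentBound (a b r : ℝ) : ℝ :=
  (|b - r| + |a - b|) * |a - b| + (|r| + 1 / 2 * (|b - r| + |a - b|) ^ 2)

namespace PartialObservation

variable {Ω : Type*} {mΩ : MeasurableSpace Ω} {P : Measure Ω} {G F : Filtration ℝ≥0 mΩ}
  {W S π : ℝ≥0 → Ω → ℝ} {A : Set Ω} {a b s₀ : ℝ} {T : ℝ≥0} [IsProbabilityMeasure P]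

omit [IsProbabilityMeasure P] in
theorem measurable_exponentRate (h : PartialObservation P G F W A a b s₀ T S π) (r : ℝ) :
    Measurable (exponentRate a b r A π) := by
  have h1 := measurable_affine h.measurable_posterior (b - r) (a - b)
  exact (h1.mul h.measurable_filteringError).add (((h1.pow_const 2).const_mul _).const_add r)

theorem ae_abs_exponentRate_le (h : PartialObservation P G F W A a b s₀ T S π) (r : ℝ) :
    ∀ᵐ p ∂(timeMeasure P T), |exponentRate a b r A π p| ≤ exponentBound a b r := by
  filter_upwards [h.ae_abs_filteringError_le,
    ae_abs_affine_le h.measurable_posterior h.posterior (b - r) (a - b)] with p h1 h2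
  refine (abs_add_le _ _).trans (add_le_add ?_ ((abs_add_le _ _).trans (add_le_add le_rfl ?_)))
  · rw [abs_mul]
    exact mul_le_mul h2 h1 (abs_nonneg _) (by positivity)
  · rw [abs_mul, abs_pow, abs_of_nonneg (by norm_num : (0 : ℝ) ≤ 1 / 2)]
    gcongr

theorem memLp_exponentRate (h : PartialObservation P G F W A a b s₀ T S π) (r : ℝ) :
    MemLp (exponentRate a b r A π) 2 (timeMeasure P T) :=
  MemLp.of_bound (h.measurable_exponentRate r).aestronglyMeasurable _ (h.ae_abs_exponentRate_le r)

/-- Replacing `dν` by `dW` plus the filtering error splits the exponent into an Itô integral against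
`W` and a time integral with bounded rate. Integrability and nondegeneracy of `ρ` are both read off
from this form. -/
theorem exists_isItoIntegral_brownian (h : PartialObservation P G F W A a b s₀ T S π) {r : ℝ}
    {ρ : Ω → ℝ} (hρ : IsStatePriceDensity P G a b r S π T ρ) :
    ∃ J, IsItoIntegral P F W T (fun s ω => b - r + (a - b) * π s ω) J ∧
      ρ =ᵐ[P] fun ω => Real.exp (-J ω
        - ∫ s in Set.Ioc 0 (T : ℝ), exponentRate a b r A π (s, ω)) := by
  obtain ⟨I, hI, rfl⟩ := hρ
  have hH := memLp_affine h.measurable_posterior h.posterior (b - r) (a - b)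
  refine ⟨_, h.isItoIntegral_brownian hI hH, ?_⟩
  have h1 := ae_integrable_section (ν := volume.restrict (Set.Ioc 0 (T : ℝ)))
    (h.memLp_mul_filteringError hH)
  have h2 := ae_integrable_section (ν := volume.restrict (Set.Ioc 0 (T : ℝ)))
    (h.memLp_exponentRate r)
  filter_upwards [h1, h2] with ω i1 i2
  rw [intervalIntegral.integral_of_le T.coe_nonneg]
  have e : ∀ s : ℝ, r + 1 / 2 * (b - r + (a - b) * π s.toNNReal ω) ^ 2
      = exponentRate a b r A π (s, ω)
        - (b - r + (a - b) * π s.toNNReal ω) * filteringError a b A π (s, ω) := fun s => by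
    simp only [exponentRate]; ring
  simp_rw [e]
  rw [integral_sub i2 i1]
  congr 1
  ring

/-- `ρ²` is `exp (-2 J)`, which is integrable, times a bounded factor. -/
theorem memLp_statePriceDensity (h : PartialObservation P G F W A a b s₀ T S π) {r : ℝ}
    {ρ : Ω → ℝ} (hρ : IsStatePriceDensity P G a b r S π T ρ) : MemLp ρ 2 P := by
  obtain ⟨J, hJ, e⟩ := h.exists_isItoIntegral_brownian hρ
  refine (memLp_congr_ae e).2 ?_
  have hΘ : AEStronglyMeasurable
      (fun ω => ∫ s in Set.Ioc 0 (T : ℝ), exponentRate a b r A π (s, ω)) P :=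
    (memLp_integral (ν := volume.restrict (Set.Ioc 0 (T : ℝ))) (h.memLp_exponentRate r)).1
  have hm : AEStronglyMeasurable (fun ω => Real.exp (-J ω
      - ∫ s in Set.Ioc 0 (T : ℝ), exponentRate a b r A π (s, ω))) P :=
    Real.continuous_exp.comp_aestronglyMeasurable (hJ.memLp.1.neg.sub hΘ)
  refine (memLp_two_iff_integrable_sq hm).2 ?_
  set C := exponentBound a b r * (volume.restrict (Set.Ioc 0 (T : ℝ))).real Set.univ
  refine ((h.integrable_exp_mul_of_isItoIntegral (c := -2) (by norm_num) hJ).mul_const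
    (Real.exp (2 * C))).mono' (hm.pow 2) ?_
  filter_upwards [ae_abs_setIntegral_le (ν := volume.restrict (Set.Ioc 0 (T : ℝ)))
    (h.ae_abs_exponentRate_le r)] with ω hω
  rw [Real.norm_of_nonneg (sq_nonneg _), ← Real.exp_nat_mul, ← Real.exp_add]
  refine Real.exp_le_exp.2 ?_
  have := (abs_le.1 hω).1
  push_cast
  linarith

theorem aestronglyMeasurable_setIntegral_affine (h : PartialObservation P G F W A a b s₀ T S π)
    (c₀ c₁ : ℝ) {f : ℝ → ℝ} (hf : Continuous f) {t u : ℝ≥0} (ht : t ≤ u) (hu : u ≤ T) :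
    AEStronglyMeasurable[G u]
      (fun ω => ∫ s in Set.Ioc 0 (t : ℝ), f (c₀ + c₁ * π s.toNNReal ω)) P := by
  -- The argument of `f` almost surely stays in this compact interval, since the posterior lies in
  -- `[0, 1]`.
  obtain ⟨C, hC⟩ := (isCompact_Icc (a := -(|c₀| + |c₁|)) (b := |c₀| + |c₁|)).exists_bound_of_continuousOn
    hf.continuousOn
  refine aestronglyMeasurable_integral_of_sub (ν := volume.restrict (Set.Ioc 0 (t : ℝ))) (C := C)
    (f := fun p => f (c₀ + c₁ * π p.1.toNNReal p.2)) (G.le u)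
    (hf.measurable.comp (measurable_affine h.measurable_posterior c₀ c₁)).aestronglyMeasurable ?_ ?_
  · have h1 := ae_abs_affine_le h.measurable_posterior h.posterior c₀ c₁
    have h2 := (timeMeasure_mono (P := P) (ht.trans hu)).absolutelyContinuous.ae_le h1
    filter_upwards [h2] with p hp
    exact hC _ (abs_le.1 hp)
  · filter_upwards [ae_restrict_mem measurableSet_Ioc] with s hs
    have hst := toNNReal_le_of_mem hs
    have hsm : StronglyMeasurable[G u] fun ω => f (c₀ + c₁ * condProb P G A s.toNNReal ω) :=
      hf.comp_stronglyMeasurable (stronglyMeasurable_const.add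
        (((stronglyMeasurable_condProb _).mono (G.mono (hst.trans ht))).const_mul c₁))
    refine hsm.aestronglyMeasurable.congr ?_
    filter_upwards [h.posterior _ (hst.trans (ht.trans hu))] with ω hω
    rw [hω]

theorem aestronglyMeasurable_innovation (h : PartialObservation P G F W A a b s₀ T S π)
    {t u : ℝ≥0} (ht : t ≤ u) (hu : u ≤ T) :
    AEStronglyMeasurable[G u] (innovation a b S π t) P := by
  have h1 : StronglyMeasurable[G u] fun ω => Real.log (S t ω) :=
    (Real.measurable_log.comp ((h.observed t).mono (G.mono ht)).measurable).stronglyMeasurable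
  have h2 := h.aestronglyMeasurable_setIntegral_affine (b - 1 / 2) (a - b) continuous_id ht hu
  refine (h1.aestronglyMeasurable.sub h2).congr (Eventually.of_forall fun ω => ?_)
  simp only [innovation, intervalIntegral.integral_of_le t.coe_nonneg]
  rfl

theorem aestronglyMeasurable_integral_innovation (h : PartialObservation P G F W A a b s₀ T S π)
    (K : ElementaryProcess G) :
    AEStronglyMeasurable[G T] (K.integral (innovation a b S π) T) P := by
  have : K.integral (innovation a b S π) T = ∑ i ∈ Finset.range K.n, fun ω => K.coef i ω *
      (innovation a b S π (min (K.time (i + 1)) T) ω - innovation a b S π (min (K.time i) T) ω) := by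
    funext ω
    simp [ElementaryProcess.integral]
  rw [this]
  refine Finset.sum_induction _ (fun f => AEStronglyMeasurable[G T] f P)
    (fun _ _ hf hg => hf.add hg) stronglyMeasurable_const.aestronglyMeasurable fun i _ => ?_
  rcases le_total (K.time i) T with hi | hi
  · exact ((K.measurable_coef i).mono (G.mono hi)).aestronglyMeasurable.mul
      ((h.aestronglyMeasurable_innovation (min_le_right _ _) le_rfl).sub
        (h.aestronglyMeasurable_innovation (min_le_right _ _) le_rfl))
  · rw [min_eq_right hi, min_eq_right (hi.trans (K.monotone_time (Nat.le_succ i)))]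
    have h0 : StronglyMeasurable[G T] fun _ : Ω => (0 : ℝ) := stronglyMeasurable_const
    simpa using h0.aestronglyMeasurable

/-- Here the integral against the innovation in `G` is kept: its elementary integrals are known at
time `T` from the observations alone, whereas those against `W` are not. -/
theorem aestronglyMeasurable_statePriceDensity (h : PartialObservation P G F W A a b s₀ T S π)
    {r : ℝ} {ρ : Ω → ℝ} (hρ : IsStatePriceDensity P G a b r S π T ρ) :
    AEStronglyMeasurable[G T] ρ P := by
  obtain ⟨I, hI, rfl⟩ := hρ
  obtain ⟨K, -, hKI⟩ := hI.exists_approx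
  have hIm : AEStronglyMeasurable[G T] I P :=
    L2Tendsto.aestronglyMeasurable_of_sub (f := fun n => (K n).integral (innovation a b S π) T)
      hKI (G.le T) (fun n => h.aestronglyMeasurable_integral_innovation (K n))
      (fun n => h.memLp_integral_innovation (K n)) hI.memLp
  have h2 := h.aestronglyMeasurable_setIntegral_affine (b - r) (a - b)
    (f := fun x => r + 1 / 2 * x ^ 2) (by fun_prop) (le_refl T) le_rfl
  simp_rw [intervalIntegral.integral_of_le T.coe_nonneg]
  exact Real.continuous_exp.comp_aestronglyMeasurable (hIm.neg.sub h2)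

end PartialObservation
end MeanVariance

/-! ### Comparing a martingale with a process of finite variation. -/

namespace MeanVariance

variable {Ω : Type*} {mΩ : MeasurableSpace Ω} {P : Measure Ω} [IsProbabilityMeasure P]
  {G F : Filtration ℝ≥0 mΩ} {W S π : ℝ≥0 → Ω → ℝ} {A : Set Ω} {a b s₀ : ℝ} {T : ℝ≥0}

/-- An Itô integral up to `T` has an Itô integral up to `t ≤ T` as conditional expectation. -/
theorem IsItoIntegral.exists_conditional (hW : IsFiltrationBrownian P F W) {H : ℝ≥0 → Ω → ℝ}
    {J : Ω → ℝ} (hJ : IsItoIntegral P F W T H J) {t : ℝ≥0} (ht : t ≤ T) :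
    ∃ X, IsItoIntegral P F W t H X ∧ AEStronglyMeasurable[F t] X P ∧
      ∀ Z, AEStronglyMeasurable[F t] Z P → MemLp Z 2 P → ∫ ω, J ω * Z ω ∂P = ∫ ω, X ω * Z ω ∂P := by
  obtain ⟨K, hK, hKJ⟩ := hJ.exists_approx
  have hK' : L2Tendsto (timeMeasure P T) (fun n => (K n).evalProd)
    (fun p : ℝ × Ω => H p.1.toNNReal p.2) := hK
  obtain ⟨X, hX, hKX⟩ := IsItoIntegral.exists_of_approx hW K
    (hJ.aestronglyMeasurable_integrand.mono_measure (timeMeasure_mono ht))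
    (hK'.mono_measure (timeMeasure_mono ht))
  refine ⟨X, hX, hKX.aestronglyMeasurable_of_sub (F.le t)
    (fun n => ((K n).stronglyMeasurable_integral hW t).aestronglyMeasurable)
    (fun n => (K n).memLp_integral hW t) hX.memLp, fun Z hZ hZL => ?_⟩
  obtain ⟨Y, hY, hZY⟩ := hZ
  have hYL : MemLp Y 2 P := (memLp_congr_ae hZY).1 hZL
  have e : ∀ f : Ω → ℝ, ∫ ω, f ω * Z ω ∂P = ∫ ω, f ω * Y ω ∂P := fun f =>
    integral_congr_ae (by filter_upwards [hZY] with ω hω; rw [hω])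
  rw [e, e]
  have hKJ' : L2Tendsto P (fun n => (K n).integral W T) J := hKJ
  have l1 := hKJ'.tendsto_integral_mul (L2Tendsto.const Y) (fun n => (K n).memLp_integral hW T)
    hJ.memLp (fun _ => hYL) hYL
  have l2 := hKX.tendsto_integral_mul (L2Tendsto.const Y) (fun n => (K n).memLp_integral hW t)
    hX.memLp (fun _ => hYL) hYL
  exact tendsto_nhds_unique l1
    (l2.congr fun n => ((K n).integral_integral_mul_of_le hW ht hY hYL).symm)

/-- If an Itô integral is close to a random variable known at time `t`, its integrand is small after
time `t`. -/
theorem IsItoIntegral.integral_sq_sub_le (hW : IsFiltrationBrownian P F W) {H : ℝ≥0 → Ω → ℝ}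
    {J Z R : Ω → ℝ} (hJ : IsItoIntegral P F W T H J) {t : ℝ≥0} (ht : t ≤ T)
    (hZ : AEStronglyMeasurable[F t] Z P) (hZL : MemLp Z 2 P) (hR : MemLp R 2 P)
    (e : J =ᵐ[P] fun ω => Z ω - R ω) :
    ∫ p : ℝ × Ω, H p.1.toNNReal p.2 ^ 2 ∂(timeMeasure P T)
      - ∫ p : ℝ × Ω, H p.1.toNNReal p.2 ^ 2 ∂(timeMeasure P t) ≤ ∫ ω, R ω ^ 2 ∂P := by
  -- By the isometry the left side is `E (J - X)²`. As `J - X` is orthogonal to what is known at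
  -- `t`, it also equals `-E ((J - X) R)`, and Cauchy–Schwarz concludes.
  obtain ⟨X, hX, hXm, hXZ⟩ := hJ.exists_conditional hW ht
  have i1 := hJ.integral_mul hW hJ
  have i2 := hX.integral_mul hW hX
  simp_rw [sq (H _ _), ← i1, ← i2]
  have hD : MemLp (fun ω => J ω - X ω) 2 P := hJ.memLp.sub hX.memLp
  have hZX : MemLp (fun ω => Z ω - X ω) 2 P := hZL.sub hX.memLp
  have d1 : ∫ ω, (J ω - X ω) ^ 2 ∂P = ∫ ω, J ω * J ω ∂P - ∫ ω, X ω * X ω ∂P := by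
    rw [ElementaryProcess.integral_sub_sq hJ.memLp hX.memLp, hXZ X hXm hX.memLp]
    ring
  have d2 : ∫ ω, (J ω - X ω) * (Z ω - X ω) ∂P = 0 := by
    have := hXZ _ (hZ.sub hXm) hZX
    simp_rw [sub_mul]
    have q1 : Integrable (fun ω => J ω * (Z ω - X ω)) P := hJ.memLp.integrable_mul hZX
    have q2 : Integrable (fun ω => X ω * (Z ω - X ω)) P := hX.memLp.integrable_mul hZX
    rw [integral_sub q1 q2]
    exact sub_eq_zero.2 this
  have d3 : ∫ ω, (J ω - X ω) ^ 2 ∂P = -∫ ω, (J ω - X ω) * R ω ∂P := by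
    have q1 : Integrable (fun ω => (J ω - X ω) * (Z ω - X ω)) P := hD.integrable_mul hZX
    have q2 : Integrable (fun ω => (J ω - X ω) * R ω) P := hD.integrable_mul hR
    rw [← zero_sub, ← d2, ← integral_sub q1 q2]
    refine integral_congr_ae ?_
    filter_upwards [e] with ω hω
    have : J ω - X ω = (Z ω - X ω) - R ω := by rw [hω]; ring
    calc (J ω - X ω) ^ 2 = (J ω - X ω) * (J ω - X ω) := sq _
      _ = (J ω - X ω) * ((Z ω - X ω) - R ω) := by rw [← this]
      _ = _ := by ring
  have cs := integral_mul_sq_le hD hR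
  rw [← d1]
  set x := ∫ ω, (J ω - X ω) ^ 2 ∂P
  have hx0 : 0 ≤ x := integral_nonneg fun _ => sq_nonneg _
  have hR0 : 0 ≤ ∫ ω, R ω ^ 2 ∂P := integral_nonneg fun _ => sq_nonneg _
  have hx : x ^ 2 ≤ x * ∫ ω, R ω ^ 2 ∂P := by
    rw [d3, neg_sq]
    rw [d3] at cs
    exact cs
  rcases hx0.eq_or_lt with h0 | h0
  · rw [← h0]; exact hR0
  · rw [sq] at hx
    exact le_of_mul_le_mul_left hx h0

theorem integral_affine_condProb_sq (hA : MeasurableSet A) (c₀ c₁ : ℝ) (t : ℝ≥0) :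
    ∫ ω, (c₀ + c₁ * condProb P G A t ω) ^ 2 ∂P
      = c₀ ^ 2 + 2 * c₀ * c₁ * P.real A + c₁ ^ 2 * ∫ ω, condProb P G A t ω ^ 2 ∂P := by
  have i1 : Integrable (condProb P G A t) P := (memLp_condProb t).integrable (by norm_num)
  have i2 := (memLp_condProb (P := P) (G := G) (A := A) t).integrable_sq
  have e : ∫ ω, condProb P G A t ω ∂P = P.real A := by
    have := integral_condProb_mul (P := P) (G := G) (t := t) hA (Z := fun _ => 1)
      stronglyMeasurable_const.aestronglyMeasurable (memLp_const 1)
    simp only [mul_one] at this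
    rw [this, integral_indicator_const _ hA, smul_eq_mul, mul_one]
  have e2 : ∀ ω, (c₀ + c₁ * condProb P G A t ω) ^ 2
      = c₀ ^ 2 + 2 * c₀ * c₁ * condProb P G A t ω + c₁ ^ 2 * condProb P G A t ω ^ 2 :=
    fun ω => by ring
  simp_rw [e2]
  have i3 : Integrable (fun ω => c₀ ^ 2 + 2 * c₀ * c₁ * condProb P G A t ω) P :=
    (integrable_const _).add (i1.const_mul _)
  rw [integral_add i3 (i2.const_mul _),
    integral_add (integrable_const _) (i1.const_mul _), integral_const_mul, integral_const_mul, e]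
  simp

theorem integral_affine_condProb_sq_mono (hA : MeasurableSet A) (c₀ c₁ : ℝ) :
    Monotone fun t => ∫ ω, (c₀ + c₁ * condProb P G A t ω) ^ 2 ∂P := fun s t hst => by
  simp only [integral_affine_condProb_sq hA]
  exact add_le_add_right (mul_le_mul_of_nonneg_left (condProb_sq_mono hA hst) (sq_nonneg _)) _

namespace PartialObservation

theorem integral_affine_sq (h : PartialObservation P G F W A a b s₀ T S π) (c₀ c₁ : ℝ) {t : ℝ≥0}
    (ht : t ≤ T) :
    ∫ p : ℝ × Ω, (c₀ + c₁ * π p.1.toNNReal p.2) ^ 2 ∂(timeMeasure P t)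
      = ∫ s in (0 : ℝ)..t, ∫ ω, (c₀ + c₁ * condProb P G A s.toNNReal ω) ^ 2 ∂P := by
  have hL := (memLp_affine (T := t) h.measurable_posterior
    (fun s hs => h.posterior s (hs.trans ht)) c₀ c₁).integrable_sq
  rw [intervalIntegral.integral_of_le t.coe_nonneg]
  refine (integral_prod _ hL).trans ?_
  refine setIntegral_congr_fun measurableSet_Ioc fun s hs => ?_
  refine integral_congr_ae ?_
  filter_upwards [h.posterior _ ((toNNReal_le_of_mem hs).trans ht)] with ω hω
  simp only [hω]

/-- The second moment of the integrand is monotone in time, so on `(t, T]` it is bounded below by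
its value at `t`. -/
theorem le_integral_affine_sq_sub (h : PartialObservation P G F W A a b s₀ T S π) (c₀ c₁ : ℝ)
    {t : ℝ≥0} (ht : t ≤ T) :
    ((T : ℝ) - t) * ∫ ω, (c₀ + c₁ * condProb P G A t ω) ^ 2 ∂P
      ≤ ∫ p : ℝ × Ω, (c₀ + c₁ * π p.1.toNNReal p.2) ^ 2 ∂(timeMeasure P T)
        - ∫ p : ℝ × Ω, (c₀ + c₁ * π p.1.toNNReal p.2) ^ 2 ∂(timeMeasure P t) := by
  rw [h.integral_affine_sq c₀ c₁ le_rfl, h.integral_affine_sq c₀ c₁ ht]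
  set e : ℝ → ℝ := fun s => ∫ ω, (c₀ + c₁ * condProb P G A s.toNNReal ω) ^ 2 ∂P with he
  have hm : Monotone e := fun s u hsu =>
    integral_affine_condProb_sq_mono h.measurableSet' c₀ c₁ (Real.toNNReal_mono hsu)
  have hi : ∀ u v, IntervalIntegrable e volume u v := fun u v => hm.intervalIntegrable
  rw [intervalIntegral.integral_interval_sub_left (hi _ _) (hi _ _)]
  have hle : (t : ℝ) ≤ T := NNReal.coe_le_coe.2 ht
  have h1 : ∫ _ in (t : ℝ)..T, e t ≤ ∫ s in (t : ℝ)..T, e s :=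
    intervalIntegral.integral_mono_on hle intervalIntegrable_const (hi _ _) fun s hs => hm hs.1
  rw [intervalIntegral.integral_const, smul_eq_mul] at h1
  simpa only [he, Real.toNNReal_coe] using h1

/-- If the stochastic part of the logarithm of the state price density is of finite variation, then
its integrand vanishes. -/
theorem integral_affine_condProb_sq_eq_zero (h : PartialObservation P G F W A a b s₀ T S π)
    {r κ : ℝ} {J : Ω → ℝ} (hJ : IsItoIntegral P F W T (fun s ω => b - r + (a - b) * π s ω) J)
    (e : J =ᵐ[P] fun ω => κ - ∫ s in Set.Ioc 0 (T : ℝ), exponentRate a b r A π (s, ω))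
    {t : ℝ≥0} (ht : t < T) :
    ∫ ω, (b - r + (a - b) * condProb P G A t ω) ^ 2 ∂P = 0 := by
  set C := exponentBound a b r
  set E : ℝ≥0 → ℝ := fun t => ∫ ω, (b - r + (a - b) * condProb P G A t ω) ^ 2 ∂P with hE
  have hEm : Monotone E := integral_affine_condProb_sq_mono h.measurableSet' _ _
  -- On `(u, T]` the martingale has second moment at least `(T - u) E u`, but the time integral that
  -- replaces it has at most `C² (T - u)²`.
  have main : ∀ u < T, E u ≤ C ^ 2 * ((T : ℝ) - u) := by
    intro u hu
    have huT : (u : ℝ) < T := NNReal.coe_lt_coe.2 hu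
    have hb := h.ae_abs_exponentRate_le r
    have hm := (h.measurable_exponentRate r).aestronglyMeasurable (μ := timeMeasure P T)
    have hb0 : ∀ᵐ p ∂(timeMeasure P u), |exponentRate a b r A π p| ≤ C :=
      (timeMeasure_mono (P := P) hu.le).absolutelyContinuous.ae_le hb
    have hmem : MemLp (exponentRate a b r A π) 2 (timeMeasure P u) :=
      (h.memLp_exponentRate r).mono_measure (timeMeasure_mono hu.le)
    have hle : volume.restrict (Set.Ioc (u : ℝ) T) ≤ volume.restrict (Set.Ioc 0 (T : ℝ)) :=
      Measure.restrict_mono (Set.Ioc_subset_Ioc_left u.coe_nonneg) le_rfl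
    have hle' : (volume.restrict (Set.Ioc (u : ℝ) T)).prod P ≤ timeMeasure P T :=
      Measure.prod_mono hle le_rfl
    have hb1 : ∀ᵐ p ∂((volume.restrict (Set.Ioc (u : ℝ) T)).prod P),
        |exponentRate a b r A π p| ≤ C := hle'.absolutelyContinuous.ae_le hb
    have hmem1 := (h.memLp_exponentRate r).mono_measure hle'
    -- The rate contains the indicator of `A`, which `F` knows from time `0`; hence the comparison
    -- is made in `F` rather than in `G`.
    have hZm : AEStronglyMeasurable[F u]
        (fun ω => ∫ s in Set.Ioc 0 (u : ℝ), exponentRate a b r A π (s, ω)) P := by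
      refine aestronglyMeasurable_integral_of_sub (ν := volume.restrict (Set.Ioc 0 (u : ℝ)))
        (F.le u) (h.measurable_exponentRate r).aestronglyMeasurable hb0 ?_
      filter_upwards [ae_restrict_mem measurableSet_Ioc] with s hs
      have hsu := toNNReal_le_of_mem hs
      have hp : StronglyMeasurable[F u] (condProb P G A s.toNNReal) :=
        (stronglyMeasurable_condProb _).mono ((G.mono hsu).trans (h.le u))
      have hAm : StronglyMeasurable[F u] (A.indicator fun _ => (1 : ℝ)) :=
        stronglyMeasurable_const.indicator (F.mono bot_le _ h.measurableSet)
      have hH : StronglyMeasurable[F u]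
          (fun ω => b - r + (a - b) * condProb P G A s.toNNReal ω) :=
        stronglyMeasurable_const.add (hp.const_mul _)
      have hsum : StronglyMeasurable[F u] fun ω =>
          (b - r + (a - b) * condProb P G A s.toNNReal ω) *
            ((a - b) * (A.indicator (fun _ => (1 : ℝ)) ω - condProb P G A s.toNNReal ω))
          + (r + 1 / 2 * (b - r + (a - b) * condProb P G A s.toNNReal ω) ^ 2) :=
        (hH.mul ((hAm.sub hp).const_mul (a - b))).add
          (stronglyMeasurable_const.add ((hH.pow 2).const_mul (1 / 2)))
      refine hsum.aestronglyMeasurable.congr ?_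
      filter_upwards [h.posterior _ (hsu.trans hu.le)] with ω hω
      simp only [exponentRate, filteringError, hω]
    have hZL : MemLp (fun ω => ∫ s in Set.Ioc 0 (u : ℝ), exponentRate a b r A π (s, ω)) 2 P :=
      memLp_integral (ν := volume.restrict (Set.Ioc 0 (u : ℝ))) hmem
    have hRL : MemLp (fun ω => ∫ s in Set.Ioc (u : ℝ) T, exponentRate a b r A π (s, ω)) 2 P :=
      memLp_integral (ν := volume.restrict (Set.Ioc (u : ℝ) T)) hmem1
    have hdec : J =ᵐ[P] fun ω =>
        (κ - ∫ s in Set.Ioc 0 (u : ℝ), exponentRate a b r A π (s, ω))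
          - ∫ s in Set.Ioc (u : ℝ) T, exponentRate a b r A π (s, ω) := by
      filter_upwards [e, ae_integrable_section (ν := volume.restrict (Set.Ioc 0 (u : ℝ))) hmem,
        ae_integrable_section (ν := volume.restrict (Set.Ioc (u : ℝ) T)) hmem1] with ω h1 h2 h3
      rw [h1, ← Set.Ioc_union_Ioc_eq_Ioc u.coe_nonneg huT.le,
        setIntegral_union (Set.Ioc_disjoint_Ioc_of_le le_rfl) measurableSet_Ioc h2 h3]
      ring
    have k1 := hJ.integral_sq_sub_le h.brownian hu.le
      (stronglyMeasurable_const.aestronglyMeasurable.sub hZm) ((memLp_const κ).sub hZL) hRL hdec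
    have k2 := h.le_integral_affine_sq_sub (b - r) (a - b) hu.le
    have k3 : ∫ ω, (∫ s in Set.Ioc (u : ℝ) T, exponentRate a b r A π (s, ω)) ^ 2 ∂P
        ≤ (C * ((T : ℝ) - u)) ^ 2 := by
      have hae := ae_abs_setIntegral_le hb1
      have hv : (volume.restrict (Set.Ioc (u : ℝ) T)).real Set.univ = (T : ℝ) - u := by
        simp [Measure.real, ENNReal.toReal_ofReal (sub_nonneg.2 huT.le)]
      rw [hv] at hae
      refine (integral_mono_ae hRL.integrable_sq (integrable_const ((C * ((T : ℝ) - u)) ^ 2))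
        ?_).trans (le_of_eq (by simp))
      filter_upwards [hae] with ω hω
      exact sq_le_sq' (abs_le.1 hω).1 (abs_le.1 hω).2
    have k4 : ((T : ℝ) - u) * E u ≤ ((T : ℝ) - u) * (C ^ 2 * ((T : ℝ) - u)) :=
      (k2.trans (k1.trans k3)).trans (le_of_eq (by ring))
    exact le_of_mul_le_mul_left k4 (sub_pos.2 huT)
  refine le_antisymm ?_ (integral_nonneg fun _ => sq_nonneg _)
  have hlim : Tendsto (fun u : ℝ => C ^ 2 * ((T : ℝ) - u)) (𝓝[<] (T : ℝ)) (𝓝 0) := by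
    have : Tendsto (fun u : ℝ => C ^ 2 * ((T : ℝ) - u)) (𝓝 (T : ℝ)) (𝓝 (C ^ 2 * ((T : ℝ) - T))) :=
      (continuous_const.mul (continuous_const.sub continuous_id)).tendsto _
    rw [sub_self, mul_zero] at this
    exact this.mono_left nhdsWithin_le_nhds
  -- By monotonicity `E t` is at most `E u` for `u` between `t` and `T`, and the bound on `E u`
  -- vanishes as `u` rises to `T`.
  refine ge_of_tendsto hlim ?_
  have htT : (t : ℝ) < T := NNReal.coe_lt_coe.2 ht
  filter_upwards [Ioo_mem_nhdsLT htT] with u hu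
  have hu0 : 0 ≤ u := t.coe_nonneg.trans hu.1.le
  have e1 : E t ≤ E u.toNNReal := hEm (Real.le_toNNReal_iff_coe_le hu0 |>.2 hu.1.le)
  have e2 := main u.toNNReal (by rw [Real.toNNReal_lt_iff_lt_coe hu0]; exact hu.2)
  rw [Real.coe_toNNReal _ hu0] at e2
  exact e1.trans e2

end PartialObservation
end MeanVariance

/-! ### The state price density is not constant. -/

namespace MeanVariance.PartialObservation

variable {Ω : Type*} {mΩ : MeasurableSpace Ω} {P : Measure Ω} [IsProbabilityMeasure P]
  {G F : Filtration ℝ≥0 mΩ} {W S π : ℝ≥0 → Ω → ℝ} {A : Set Ω} {a b s₀ : ℝ} {T : ℝ≥0}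

omit [IsProbabilityMeasure P] in
theorem stronglyMeasurable_twoPointDrift (h : PartialObservation P G F W A a b s₀ T S π) :
    StronglyMeasurable[F 0] (twoPointDrift a b A) :=
  stronglyMeasurable_const.add ((stronglyMeasurable_const.indicator h.measurableSet).const_mul _)

theorem integral_twoPointDrift_sub (h : PartialObservation P G F W A a b s₀ T S π) (r : ℝ) :
    ∫ ω, (twoPointDrift a b A ω - r) ∂P = b - r + (a - b) * P.real A := by
  have i1 := integrable_indicator_one (P := P) h.measurableSet'
  have e : ∀ ω, twoPointDrift a b A ω - r
      = b - r + (a - b) * A.indicator (fun _ => (1 : ℝ)) ω := fun ω => by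
    simp only [twoPointDrift]; ring
  simp_rw [e]
  rw [integral_add (integrable_const _) (i1.const_mul _), integral_const_mul,
    integral_indicator_const _ h.measurableSet']
  simp

theorem integral_twoPointDrift_sub_sq (h : PartialObservation P G F W A a b s₀ T S π) (r : ℝ) :
    ∫ ω, (twoPointDrift a b A ω - r) ^ 2 ∂P
      = (b - r) ^ 2 + ((a - r) ^ 2 - (b - r) ^ 2) * P.real A := by
  have i1 := integrable_indicator_one (P := P) h.measurableSet'
  have e : ∀ ω, (twoPointDrift a b A ω - r) ^ 2
      = (b - r) ^ 2 + ((a - r) ^ 2 - (b - r) ^ 2) * A.indicator (fun _ => (1 : ℝ)) ω := fun ω => by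
    by_cases hω : ω ∈ A <;> simp [twoPointDrift, hω]
  simp_rw [e]
  rw [integral_add (integrable_const _) (i1.const_mul _), integral_const_mul,
    integral_indicator_const _ h.measurableSet']
  simp

theorem memLp_twoPointDrift_sub (h : PartialObservation P G F W A a b s₀ T S π) (r : ℝ) :
    MemLp (fun ω => twoPointDrift a b A ω - r) 2 P :=
  ((memLp_const b).add ((memLp_indicator_const 2 h.measurableSet' 1
    (Or.inr (measure_ne_top _ _))).const_mul (a - b))).sub (memLp_const r)

/-- Against test variables known at `t`, the drift may be replaced by its conditional expectation.
-/
theorem integral_twoPointDrift_sub_mul (h : PartialObservation P G F W A a b s₀ T S π) (r : ℝ)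
    {t : ℝ≥0} {Z : Ω → ℝ} (hZ : AEStronglyMeasurable[G t] Z P) (hZL : MemLp Z 2 P) :
    ∫ ω, (twoPointDrift a b A ω - r) * Z ω ∂P
      = ∫ ω, (b - r + (a - b) * condProb P G A t ω) * Z ω ∂P := by
  have i0 : Integrable Z P := hZL.integrable (by norm_num)
  have i1 : Integrable (fun ω => A.indicator (fun _ => (1 : ℝ)) ω * Z ω) P :=
    (memLp_indicator_const 2 h.measurableSet' 1 (Or.inr (measure_ne_top _ _))).integrable_mul hZL
  have i2 : Integrable (fun ω => condProb P G A t ω * Z ω) P := (memLp_condProb t).integrable_mul hZL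
  have e1 : ∀ ω, (twoPointDrift a b A ω - r) * Z ω
      = (b - r) * Z ω + (a - b) * (A.indicator (fun _ => (1 : ℝ)) ω * Z ω) := fun ω => by
    simp only [twoPointDrift]; ring
  have e2 : ∀ ω, (b - r + (a - b) * condProb P G A t ω) * Z ω
      = (b - r) * Z ω + (a - b) * (condProb P G A t ω * Z ω) := fun ω => by ring
  simp_rw [e1, e2]
  rw [integral_add (i0.const_mul _) (i1.const_mul _), integral_add (i0.const_mul _) (i2.const_mul _),
    integral_const_mul, integral_const_mul, integral_const_mul,
    integral_condProb_mul h.measurableSet' hZ hZL]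

omit [IsProbabilityMeasure P] in
theorem log_price_ae_eq (h : PartialObservation P G F W A a b s₀ T S π) (r : ℝ) {t : ℝ≥0}
    (ht : t ≤ T) :
    (fun ω => Real.log (S t ω)) =ᵐ[P] fun ω => Real.log s₀ + (r - 1 / 2) * t
      + t * (twoPointDrift a b A ω - r) + (W t ω - W 0 ω) := by
  filter_upwards [h.price t ht] with ω hω
  rw [hω, gbm, Real.log_mul h.pos.ne' (Real.exp_ne_zero _), Real.log_exp]
  ring

theorem memLp_log_price (h : PartialObservation P G F W A a b s₀ T S π) {t : ℝ≥0} (ht : t ≤ T) :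
    MemLp (fun ω => Real.log (S t ω)) 2 P := by
  refine (memLp_congr_ae (h.log_price_ae_eq 0 ht)).2 ?_
  have h1 : MemLp (fun _ => Real.log s₀ + (0 - 1 / 2) * t) 2 P := memLp_const _
  have h2 : MemLp (fun ω => t * (twoPointDrift a b A ω - 0)) 2 P :=
    (h.memLp_twoPointDrift_sub 0).const_mul (t : ℝ)
  have h3 : MemLp (fun ω => W t ω - W 0 ω) 2 P := by
    simpa using h.brownian.memLp_sub (zero_le : 0 ≤ t) 2
  exact (h1.add h2).add h3

/-- In `log S` the drift appears with factor `t`, and the Brownian increment is independent of the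
drift. Hence the observation correlates with `μ - r` through its second moment. -/
theorem integral_twoPointDrift_sub_mul_log_price
    (h : PartialObservation P G F W A a b s₀ T S π) (r : ℝ) {t : ℝ≥0} (ht : t ≤ T) :
    ∫ ω, (twoPointDrift a b A ω - r) * Real.log (S t ω) ∂P
      = (Real.log s₀ + (r - 1 / 2) * t) * ∫ ω, (twoPointDrift a b A ω - r) ∂P
        + t * ∫ ω, (twoPointDrift a b A ω - r) ^ 2 ∂P := by
  have hm := h.memLp_twoPointDrift_sub r
  have hW : MemLp (fun ω => W t ω - W 0 ω) 2 P := by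
    simpa using h.brownian.memLp_sub (zero_le : 0 ≤ t) 2
  have i1 : Integrable (fun ω => twoPointDrift a b A ω - r) P := hm.integrable (by norm_num)
  have i2 := hm.integrable_sq
  have i3 : Integrable (fun ω => (twoPointDrift a b A ω - r) * (W t ω - W 0 ω)) P :=
    hm.integrable_mul hW
  have z := h.brownian.integral_mul_sub_eq_zero (zero_le : 0 ≤ t)
    (h.stronglyMeasurable_twoPointDrift.sub stronglyMeasurable_const (g := fun _ => r))
  have e : (fun ω => (twoPointDrift a b A ω - r) * Real.log (S t ω)) =ᵐ[P] fun ω =>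
      ((Real.log s₀ + (r - 1 / 2) * t) * (twoPointDrift a b A ω - r)
        + t * (twoPointDrift a b A ω - r) ^ 2)
        + (twoPointDrift a b A ω - r) * (W t ω - W 0 ω) := by
    filter_upwards [h.log_price_ae_eq r ht] with ω hω
    rw [hω]; ring
  rw [integral_congr_ae e]
  have i4 : Integrable (fun ω => (Real.log s₀ + (r - 1 / 2) * t) * (twoPointDrift a b A ω - r)
        + t * (twoPointDrift a b A ω - r) ^ 2) P := (i1.const_mul _).add (i2.const_mul _)
  rw [integral_add i4 i3, integral_add (i1.const_mul _) (i2.const_mul _), integral_const_mul,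
    integral_const_mul]
  refine (add_eq_left.2 ?_)
  exact z

/-- A constant `ρ` would express `J` as a constant minus a time integral, forcing its integrand to
vanish before `T`. Then `μ - r` is orthogonal to all that is observed by `T / 2`; the test variables
`1` and `log S` give `E (μ - r) = 0` and `E (μ - r)² = 0`, although the variance of the drift is `(a
- b)² p (1 - p) > 0` with `p` the probability of `A`. -/
theorem variance_statePriceDensity_pos (h : PartialObservation P G F W A a b s₀ T S π)
    (hab : b < a) (hT : 0 < T) (hA0 : 0 < P.real A) (hA1 : P.real A < 1) {r : ℝ} {ρ : Ω → ℝ}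
    (hρ : IsStatePriceDensity P G a b r S π T ρ) : 0 < Var[ρ; P] := by
  refine (variance_nonneg ρ P).lt_of_ne' fun hv => ?_
  have hc := ae_eq_integral_of_variance_eq_zero (h.memLp_statePriceDensity hρ) hv
  obtain ⟨J, hJ, e⟩ := h.exists_isItoIntegral_brownian hρ
  have eJ : J =ᵐ[P] fun ω => -Real.log (∫ ω, ρ ω ∂P)
      - ∫ s in Set.Ioc 0 (T : ℝ), exponentRate a b r A π (s, ω) := by
    filter_upwards [hc, e] with ω h1 h2
    rw [← h1, h2, Real.log_exp]
    ring
  -- Any time strictly between `0` and `T` would do: before `T` for the vanishing, positive in order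
  -- to divide by it in `o3`.
  have ht : T / 2 < T := NNReal.half_lt_self hT.ne'
  have hL : MemLp (fun ω => b - r + (a - b) * condProb P G A (T / 2) ω) 2 P :=
    (memLp_const (b - r)).add ((memLp_condProb (T / 2)).const_mul (a - b))
  have hz : (fun ω => (b - r + (a - b) * condProb P G A (T / 2) ω) ^ 2) =ᵐ[P] 0 :=
    (integral_eq_zero_iff_of_nonneg (fun _ => sq_nonneg _)
      hL.integrable_sq).1
      (h.integral_affine_condProb_sq_eq_zero hJ eJ ht)
  have orth : ∀ Z : Ω → ℝ, AEStronglyMeasurable[G (T / 2)] Z P → MemLp Z 2 P →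
      ∫ ω, (twoPointDrift a b A ω - r) * Z ω ∂P = 0 := fun Z hZ hZL => by
    rw [h.integral_twoPointDrift_sub_mul r hZ hZL]
    refine integral_eq_zero_of_ae ?_
    filter_upwards [hz] with ω hω
    have : b - r + (a - b) * condProb P G A (T / 2) ω = 0 := pow_eq_zero_iff two_ne_zero |>.1 hω
    rw [this, zero_mul]
    rfl
  have o1 := orth (fun _ => 1) stronglyMeasurable_const.aestronglyMeasurable (memLp_const 1)
  simp only [mul_one] at o1
  have hlog : StronglyMeasurable[G (T / 2)] fun ω => Real.log (S (T / 2) ω) :=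
    (Real.measurable_log.comp (h.observed _).measurable).stronglyMeasurable
  have o2 := orth _ hlog.aestronglyMeasurable (h.memLp_log_price ht.le)
  rw [h.integral_twoPointDrift_sub_mul_log_price r ht.le, o1, mul_zero, zero_add] at o2
  have hT2 : ((T / 2 : ℝ≥0) : ℝ) ≠ 0 := NNReal.coe_ne_zero.2 (div_pos hT two_pos).ne'
  have o3 := (mul_eq_zero.1 o2).resolve_left hT2
  rw [h.integral_twoPointDrift_sub] at o1
  rw [h.integral_twoPointDrift_sub_sq] at o3
  have hbr : b - r = -((a - b) * P.real A) := by linarith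
  have har : a - r = (a - b) * (1 - P.real A) := by linarith
  rw [har, hbr] at o3
  have key : (a - b) ^ 2 * (P.real A * (1 - P.real A)) = 0 := by linear_combination o3
  have : 0 < (a - b) ^ 2 * (P.real A * (1 - P.real A)) :=
    mul_pos (pow_pos (sub_pos.2 hab) 2) (mul_pos hA0 (sub_pos.2 hA1))
  exact this.ne' key

end MeanVariance.PartialObservation

/-! ### The minimisation problem and its Hilbert space form. -/

namespace MeanVariance

variable {Ω : Type*} {m mΩ : MeasurableSpace Ω} {P : Measure Ω} [IsProbabilityMeasure P]
  {ρ : Ω → ℝ} {z y₀ : ℝ}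

omit [IsProbabilityMeasure P] in
theorem optimalWealth_eq (ρ : Ω → ℝ) (z y₀ : ℝ) : optimalWealth P ρ z y₀ = fun ω =>
    (z * (∫ ω', ρ ω' ^ 2 ∂P) - y₀ * (∫ ω', ρ ω' ∂P)) / Var[ρ; P]
      + (y₀ - z * ∫ ω', ρ ω' ∂P) / Var[ρ; P] * ρ ω := by
  funext ω
  rw [optimalWealth, add_div, mul_div_right_comm]

theorem variance_eq_integral_sq_sub (hρ : MemLp ρ 2 P) :
    Var[ρ; P] = ∫ ω, ρ ω ^ 2 ∂P - (∫ ω, ρ ω ∂P) ^ 2 := by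
  rw [variance_eq_sub hρ]
  rfl

theorem memLp_optimalWealth (hρ : MemLp ρ 2 P) : MemLp (optimalWealth P ρ z y₀) 2 P := by
  have key : ∀ x w : ℝ, MemLp (fun ω => x + w * ρ ω) 2 P := fun x w =>
    (memLp_const x).add (hρ.const_mul w)
  rw [optimalWealth_eq]
  exact key _ _

/-- The coefficients of `1` and `ρ` solve the two by two linear system of the constraints, whose
determinant is the variance. -/
theorem optimalWealth_mem_admissible (hm : AEStronglyMeasurable[m] ρ P) (hρ : MemLp ρ 2 P)
    (hv : 0 < Var[ρ; P]) : optimalWealth P ρ z y₀ ∈ admissible m P ρ z y₀ := by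
  have hvar := variance_eq_integral_sq_sub hρ
  have i1 : Integrable ρ P := hρ.integrable (by norm_num)
  have i2 := hρ.integrable_sq
  refine ⟨?_, memLp_optimalWealth hρ, ?_, ?_⟩
  · rw [optimalWealth_eq]
    exact stronglyMeasurable_const.aestronglyMeasurable.add (hm.const_mul _)
  · rw [optimalWealth_eq, integral_add (integrable_const _) (i1.const_mul _), integral_const_mul,
      integral_const]
    simp only [probReal_univ, one_smul]
    field_simp
    rw [hvar]
    ring
  · have e : ∀ x w : ℝ, ∫ ω, ρ ω * (x + w * ρ ω) ∂P = x * ∫ ω, ρ ω ∂P + w * ∫ ω, ρ ω ^ 2 ∂P := by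
      intro x w
      have : ∀ ω, ρ ω * (x + w * ρ ω) = x * ρ ω + w * ρ ω ^ 2 := fun ω => by ring
      simp_rw [this]
      rw [integral_add (i1.const_mul _) (i2.const_mul _), integral_const_mul, integral_const_mul]
    rw [optimalWealth_eq, e]
    field_simp
    rw [hvar]
    ring

/-- The Pythagorean identity for feasible wealths. -/
theorem integral_sub_sq_of_mem_admissible (hm : AEStronglyMeasurable[m] ρ P) (hρ : MemLp ρ 2 P)
    (hv : 0 < Var[ρ; P]) {w : Ω → ℝ} (hw : w ∈ admissible m P ρ z y₀) :
    ∫ ω, (w ω - z) ^ 2 ∂P = ∫ ω, (optimalWealth P ρ z y₀ ω - z) ^ 2 ∂P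
      + ∫ ω, (w ω - optimalWealth P ρ z y₀ ω) ^ 2 ∂P := by
  obtain ⟨-, vL, v1, v2⟩ := optimalWealth_mem_admissible (z := z) (y₀ := y₀) hm hρ hv
  obtain ⟨-, wL, w1, w2⟩ := hw
  set v := optimalWealth P ρ z y₀ with hvdef
  have dL : MemLp (fun ω => w ω - v ω) 2 P := wL.sub vL
  have eL : MemLp (fun ω => v ω - z) 2 P := vL.sub (memLp_const z)
  have iw : Integrable w P := wL.integrable (by norm_num)
  have iv : Integrable v P := vL.integrable (by norm_num)
  have id' : Integrable (fun ω => w ω - v ω) P := iw.sub iv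
  have iρw : Integrable (fun ω => ρ ω * w ω) P := hρ.integrable_mul wL
  have iρv : Integrable (fun ω => ρ ω * v ω) P := hρ.integrable_mul vL
  have iρd : Integrable (fun ω => ρ ω * (w ω - v ω)) P := hρ.integrable_mul dL
  have d1 : ∫ ω, (w ω - v ω) ∂P = 0 := by rw [integral_sub iw iv, w1, v1, sub_self]
  have d2 : ∫ ω, ρ ω * (w ω - v ω) ∂P = 0 := by
    simp_rw [mul_sub]
    rw [integral_sub iρw iρv, w2, v2, sub_self]
  -- `v - z` lies in the span of `1` and `ρ`, and the difference of two feasible wealths is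
  -- orthogonal to both.
  have cross : ∫ ω, (v ω - z) * (w ω - v ω) ∂P = 0 := by
    obtain ⟨x, y, hxy⟩ : ∃ x y : ℝ, ∀ ω, v ω = x + y * ρ ω :=
      ⟨_, _, fun ω => congrFun (optimalWealth_eq ρ z y₀) ω⟩
    have : ∀ ω, (v ω - z) * (w ω - v ω) = (x - z) * (w ω - v ω) + y * (ρ ω * (w ω - v ω)) :=
      fun ω => by rw [show v ω - z = (x - z) + y * ρ ω by rw [hxy]; ring]; ring
    simp_rw [this]
    rw [integral_add (id'.const_mul _) (iρd.const_mul _), integral_const_mul, integral_const_mul,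
      d1, d2, mul_zero, mul_zero, add_zero]
  have ic : Integrable (fun ω => (v ω - z) * (w ω - v ω)) P := eL.integrable_mul dL
  have e : ∀ ω, (w ω - z) ^ 2
      = ((v ω - z) ^ 2 + (w ω - v ω) ^ 2) + 2 * ((v ω - z) * (w ω - v ω)) := fun ω => by ring
  have is : Integrable (fun ω => (v ω - z) ^ 2 + (w ω - v ω) ^ 2) P :=
    eL.integrable_sq.add dL.integrable_sq
  simp_rw [e]
  rw [integral_add is (ic.const_mul 2), integral_add eL.integrable_sq dL.integrable_sq,
    integral_const_mul, cross, mul_zero, add_zero]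

theorem integral_optimalWealth_sub_sq_le (hm : AEStronglyMeasurable[m] ρ P) (hρ : MemLp ρ 2 P)
    (hv : 0 < Var[ρ; P]) {w : Ω → ℝ} (hw : w ∈ admissible m P ρ z y₀) :
    ∫ ω, (optimalWealth P ρ z y₀ ω - z) ^ 2 ∂P ≤ ∫ ω, (w ω - z) ^ 2 ∂P := by
  rw [integral_sub_sq_of_mem_admissible hm hρ hv hw]
  exact le_add_of_nonneg_right (integral_nonneg fun _ => sq_nonneg _)

theorem ae_eq_optimalWealth_of_le (hm : AEStronglyMeasurable[m] ρ P) (hρ : MemLp ρ 2 P)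
    (hv : 0 < Var[ρ; P]) {w : Ω → ℝ} (hw : w ∈ admissible m P ρ z y₀)
    (hle : ∫ ω, (w ω - z) ^ 2 ∂P ≤ ∫ ω, (optimalWealth P ρ z y₀ ω - z) ^ 2 ∂P) :
    w =ᵐ[P] optimalWealth P ρ z y₀ := by
  rw [integral_sub_sq_of_mem_admissible hm hρ hv hw] at hle
  have hL : MemLp (fun ω => w ω - optimalWealth P ρ z y₀ ω) 2 P :=
    hw.2.1.sub (memLp_optimalWealth hρ)
  have h0 : ∫ ω, (w ω - optimalWealth P ρ z y₀ ω) ^ 2 ∂P = 0 :=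
    le_antisymm (by linarith) (integral_nonneg fun _ => sq_nonneg _)
  filter_upwards [(integral_eq_zero_iff_of_nonneg (fun _ => sq_nonneg _) hL.integrable_sq).1 h0]
    with ω hω
  exact sub_eq_zero.1 (pow_eq_zero_iff two_ne_zero |>.1 hω)

omit [IsProbabilityMeasure P] in
theorem inner_hilbertL2_eq {f g : HilbertL2 m P} {f' : Ω → ℝ} (hf : (f : Lp ℝ 2 P) =ᵐ[P] f') :
    inner ℝ f g = ∫ ω, f' ω * (g : Lp ℝ 2 P) ω ∂P := by
  rw [Submodule.coe_inner, L2.inner_def]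
  refine integral_congr_ae ?_
  filter_upwards [hf] with ω hω
  rw [hω]
  simp [mul_comm]

/-- The vector from `v` to `0` lies in `K`, hence is orthogonal to the direction `Kᗮ`, so `v` is the
foot of the perpendicular. -/
theorem exists_orthogonalProjection_zero_eq {E : Type*} [NormedAddCommGroup E]
    [InnerProductSpace ℝ E] (K : Submodule ℝ E) [FiniteDimensional ℝ K] {v : E} (hv : v ∈ K) :
    ∃ (_ : Nonempty (AffineSubspace.mk' v Kᗮ))
      (_ : (AffineSubspace.mk' v Kᗮ).direction.HasOrthogonalProjection),
      ((EuclideanGeometry.orthogonalProjection (AffineSubspace.mk' v Kᗮ) 0 :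
        AffineSubspace.mk' v Kᗮ) : E) = v := by
  have hdir : (AffineSubspace.mk' v Kᗮ).direction = Kᗮ := AffineSubspace.direction_mk' _ _
  have hne : Nonempty (AffineSubspace.mk' v Kᗮ) := ⟨⟨v, AffineSubspace.self_mem_mk' _ _⟩⟩
  have hproj : (AffineSubspace.mk' v Kᗮ).direction.HasOrthogonalProjection := by
    rw [hdir]; infer_instance
  refine ⟨hne, hproj, ?_⟩
  rw [EuclideanGeometry.coe_orthogonalProjection_eq_iff_mem]
  refine ⟨AffineSubspace.self_mem_mk' _ _, ?_⟩
  rw [hdir, vsub_eq_sub, zero_sub]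
  exact Submodule.neg_mem _ (Submodule.le_orthogonal_orthogonal K hv)

/-- The Hilbert space form of the optimal wealth. -/
theorem exists_hilbertL2_optimalWealth (hm : AEStronglyMeasurable[m] ρ P) (hρ : MemLp ρ 2 P)
    (hv : 0 < Var[ρ; P]) :
    ∃ α β V : HilbertL2 m P,
      (α : Lp ℝ 2 P) =ᵐ[P] (fun _ => (1 : ℝ)) ∧
      (β : Lp ℝ 2 P) =ᵐ[P] ρ ∧
      (V : Lp ℝ 2 P) =ᵐ[P] optimalWealth P ρ z y₀ ∧
      V = (inner ℝ α α * inner ℝ β β - inner ℝ α β ^ 2)⁻¹ •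
        ((z * inner ℝ β β - y₀ * inner ℝ α β) • α +
          (-z * inner ℝ α β + y₀ * inner ℝ α α) • β) ∧
      ∃ A : AffineSubspace ℝ (HilbertL2 m P),
        (A : Set (HilbertL2 m P)) = admissibleClasses m P ρ z y₀ ∧
        ∃ (_ : Nonempty A) (_ : A.direction.HasOrthogonalProjection),
          ((EuclideanGeometry.orthogonalProjection A 0 : A) : HilbertL2 m P) = V := by
  have h1 : MemLp (fun _ : Ω => (1 : ℝ)) 2 P := memLp_const 1
  have hmem : ∀ {f : Ω → ℝ} (hf : MemLp f 2 P), AEStronglyMeasurable[m] f P →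
      hf.toLp f ∈ lpMeas ℝ ℝ m 2 P := fun hf h =>
    mem_lpMeas_iff_aestronglyMeasurable.2 (h.congr hf.coeFn_toLp.symm)
  set α : HilbertL2 m P := ⟨h1.toLp _, hmem h1 stronglyMeasurable_const.aestronglyMeasurable⟩
    with hαdef
  set β : HilbertL2 m P := ⟨hρ.toLp _, hmem hρ hm⟩ with hβdef
  have hα : (α : Lp ℝ 2 P) =ᵐ[P] (fun _ => (1 : ℝ)) := h1.coeFn_toLp
  have hβ : (β : Lp ℝ 2 P) =ᵐ[P] ρ := hρ.coeFn_toLp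
  have iα : ∀ f : HilbertL2 m P, inner ℝ α f = ∫ ω, (f : Lp ℝ 2 P) ω ∂P := fun f => by
    rw [inner_hilbertL2_eq hα]; simp
  have iβ : ∀ f : HilbertL2 m P, inner ℝ β f = ∫ ω, ρ ω * (f : Lp ℝ 2 P) ω ∂P := fun f =>
    inner_hilbertL2_eq hβ
  have e1 : inner ℝ α α = 1 := by
    rw [iα, integral_congr_ae hα]; simp
  have e2 : inner ℝ α β = ∫ ω, ρ ω ∂P := by rw [iα, integral_congr_ae hβ]
  have e3 : inner ℝ β β = ∫ ω, ρ ω ^ 2 ∂P := by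
    rw [iβ]
    refine integral_congr_ae ?_
    filter_upwards [hβ] with ω hω
    rw [hω, sq]
  have hvar := variance_eq_integral_sq_sub hρ
  set V : HilbertL2 m P := (inner ℝ α α * inner ℝ β β - inner ℝ α β ^ 2)⁻¹ •
    ((z * inner ℝ β β - y₀ * inner ℝ α β) • α +
      (-z * inner ℝ α β + y₀ * inner ℝ α α) • β) with hVdef
  have hV : (V : Lp ℝ 2 P) =ᵐ[P] optimalWealth P ρ z y₀ := by
    rw [hVdef, Submodule.coe_smul, Submodule.coe_add, Submodule.coe_smul, Submodule.coe_smul,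
      e1, e2, e3, one_mul, ← hvar]
    refine (Lp.coeFn_smul _ _).trans ?_
    filter_upwards [hα, hβ, Lp.coeFn_add
        ((z * ∫ ω, ρ ω ^ 2 ∂P - y₀ * ∫ ω, ρ ω ∂P) • (α : Lp ℝ 2 P))
        ((-z * ∫ ω, ρ ω ∂P + y₀ * 1) • (β : Lp ℝ 2 P)),
      Lp.coeFn_smul (z * ∫ ω, ρ ω ^ 2 ∂P - y₀ * ∫ ω, ρ ω ∂P) (α : Lp ℝ 2 P),
      Lp.coeFn_smul (-z * ∫ ω, ρ ω ∂P + y₀ * 1) (β : Lp ℝ 2 P)] with ω q1 q2 q3 q4 q5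
    rw [Pi.smul_apply, q3, Pi.add_apply, q4, q5, Pi.smul_apply, Pi.smul_apply, q1, q2,
      optimalWealth]
    simp only [smul_eq_mul]
    rw [div_eq_inv_mul]
    ring
  obtain ⟨-, -, v1, v2⟩ := optimalWealth_mem_admissible (z := z) (y₀ := y₀) hm hρ hv
  have hV1 : inner ℝ α V = z := by rw [iα, integral_congr_ae hV, v1]
  have hV2 : inner ℝ β V = y₀ := by
    rw [iβ, ← v2]
    refine integral_congr_ae ?_
    filter_upwards [hV] with ω hω
    rw [hω]
  -- The feasible set is the translate by `V` of the orthogonal complement of `K`, and `V` itself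
  -- lies in `K`.
  set K : Submodule ℝ (HilbertL2 m P) := Submodule.span ℝ {α, β} with hK
  have hVK : V ∈ K := K.smul_mem _ (K.add_mem
    (K.smul_mem _ (Submodule.subset_span (Set.mem_insert _ _)))
    (K.smul_mem _ (Submodule.subset_span (Set.mem_insert_of_mem _ rfl))))
  have hperp : ∀ f, f ∈ Kᗮ ↔ inner ℝ α f = 0 ∧ inner ℝ β f = 0 := fun f => by
    rw [hK, Submodule.mem_orthogonal]
    refine ⟨fun h => ⟨h _ (Submodule.subset_span (Set.mem_insert _ _)),
      h _ (Submodule.subset_span (Set.mem_insert_of_mem _ rfl))⟩, fun h u hu => ?_⟩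
    obtain ⟨x, y, rfl⟩ := Submodule.mem_span_pair.1 hu
    rw [inner_add_left, real_inner_smul_left, real_inner_smul_left, h.1, h.2]
    simp
  have : FiniteDimensional ℝ K := FiniteDimensional.span_of_finite ℝ (Set.toFinite _)
  refine ⟨α, β, V, hα, hβ, hV, rfl, AffineSubspace.mk' V Kᗮ, ?_, ?_⟩
  · ext f
    rw [SetLike.mem_coe, AffineSubspace.mem_mk', vsub_eq_sub, hperp, inner_sub_right,
      inner_sub_right, hV1, hV2, sub_eq_zero, sub_eq_zero, iα, iβ]
    rfl
  · exact exists_orthogonalProjection_zero_eq K hVK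

end MeanVariance
-- From the stock price model to partial observation, and the conclusion.
namespace MeanVariance

theorem observation_le {Ω : Type*} {mΩ : MeasurableSpace Ω} {F : Filtration ℝ≥0 mΩ}
    {S : ℝ≥0 → Ω → ℝ} (hS : StronglyAdapted F S) (t : ℝ≥0) : observation hS t ≤ F t :=
  iSup₂_le fun s hs => ((hS s).mono (F.mono hs)).measurable.comap_le

theorem stronglyMeasurable_observation {Ω : Type*} {mΩ : MeasurableSpace Ω}
    {F : Filtration ℝ≥0 mΩ} {S : ℝ≥0 → Ω → ℝ} (hS : StronglyAdapted F S) (t : ℝ≥0) :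
    StronglyMeasurable[observation hS t] (S t) :=
  Filtration.stronglyAdapted_natural _ t

/-- The market of a two-valued drift is a partial observation. -/
theorem IsStockPrice.partialObservation {Ω : Type*} {mΩ : MeasurableSpace Ω} {P : Measure Ω}
    [IsProbabilityMeasure P] {F : Filtration ℝ≥0 mΩ} {W : ℝ≥0 → Ω → ℝ}
    (hW : IsFiltrationBrownian P F W) {a b s₀ : ℝ} (hs₀ : 0 < s₀) {T : ℝ≥0} {μ : Ω → ℝ}
    (hμ : StronglyMeasurable[F 0] μ) (hμab : ∀ᵐ ω ∂P, μ ω = a ∨ μ ω = b)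
    {S : ℝ≥0 → Ω → ℝ} (hS : IsStockPrice P F W μ s₀ T S) {π : ℝ≥0 → Ω → ℝ}
    (hπ : IsPosterior P (observation hS.adapted) μ a T π) :
    PartialObservation P (observation hS.adapted) F W (μ ⁻¹' {a}) a b s₀ T S π := by
  have hA : MeasurableSet[F 0] (μ ⁻¹' {a}) := hμ.measurable (measurableSet_singleton a)
  -- `μ` takes its two values only almost surely; `twoPointDrift` is a version bounded everywhere,
  -- as the estimates for geometric Brownian motion require.
  have hdm : StronglyMeasurable[F 0] (twoPointDrift a b (μ ⁻¹' {a})) :=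
    stronglyMeasurable_const.add ((stronglyMeasurable_const.indicator hA).const_mul _)
  have hdb : ∀ ω, |twoPointDrift a b (μ ⁻¹' {a}) ω| ≤ |a| + |b| := fun ω => by
    by_cases hω : ω ∈ μ ⁻¹' {a}
    · rw [twoPointDrift, Set.indicator_of_mem hω, mul_one, add_sub_cancel]
      exact le_add_of_nonneg_right (abs_nonneg _)
    · rw [twoPointDrift, Set.indicator_of_notMem hω, mul_zero, add_zero]
      exact le_add_of_nonneg_left (abs_nonneg _)
  have hμd : μ =ᵐ[P] twoPointDrift a b (μ ⁻¹' {a}) := by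
    filter_upwards [hμab] with ω hω
    by_cases h : μ ω = a
    · rw [twoPointDrift, Set.indicator_of_mem (show ω ∈ μ ⁻¹' {a} from h), h]; ring
    · rw [twoPointDrift, Set.indicator_of_notMem (show ω ∉ μ ⁻¹' {a} from h), hω.resolve_left h]
      ring
  refine ⟨hW, observation_le hS.adapted, hA, stronglyMeasurable_observation hS.adapted, hs₀,
    fun t ht => hS.ae_eq_gbm hW hs₀ hdm hdb (by positivity) hμd ht, hπ.measurable, fun t ht => ?_⟩
  exact (hπ.ae_eq_condExp t ht).trans (condProb_ae_eq (F.le 0 _ hA) t).symm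

end MeanVariance

theorem mainTheorem2 {Ω : Type*} {mΩ : MeasurableSpace Ω} (P : Measure Ω) [IsProbabilityMeasure P]
    (F : Filtration ℝ≥0 mΩ) (W : ℝ≥0 → Ω → ℝ) (hW : IsFiltrationBrownian P F W)
    (a b r s₀ : ℝ) (hab : b < a) (hs₀ : 0 < s₀) (T : ℝ≥0) (hT : 0 < T)
    (μ : Ω → ℝ) (hμ : StronglyMeasurable[F 0] μ) (hμab : ∀ᵐ ω ∂P, μ ω = a ∨ μ ω = b)
    (hμW : IndepFun μ (fun ω t => W t ω) P)
    (hμ_pos : 0 < P.real (μ ⁻¹' {a})) (hμ_lt : P.real (μ ⁻¹' {a}) < 1)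
    (S : ℝ≥0 → Ω → ℝ) (hS : IsStockPrice P F W μ s₀ T S)
    (z y₀ : ℝ) :
    (∃ π, IsPosterior P (observation hS.adapted) μ a T π) ∧
    ∀ π, IsPosterior P (observation hS.adapted) μ a T π →
      (∃ ρ, IsStatePriceDensity P (observation hS.adapted) a b r S π T ρ) ∧
      ∀ ρ, IsStatePriceDensity P (observation hS.adapted) a b r S π T ρ →
        AEStronglyMeasurable[observation hS.adapted T] ρ P ∧
        MemLp ρ 2 P ∧
        0 < Var[ρ; P] ∧
        -- the given random variable is feasible, minimal, and the unique minimizer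
        optimalWealth P ρ z y₀ ∈
          admissible (observation hS.adapted T) P ρ z y₀ ∧
        (∀ w ∈ admissible (observation hS.adapted T) P ρ z y₀,
          ∫ ω, (optimalWealth P ρ z y₀ ω - z) ^ 2 ∂P ≤ ∫ ω, (w ω - z) ^ 2 ∂P) ∧
        (∀ w ∈ admissible (observation hS.adapted T) P ρ z y₀,
          ∫ ω, (w ω - z) ^ 2 ∂P ≤ ∫ ω, (optimalWealth P ρ z y₀ ω - z) ^ 2 ∂P →
          w =ᵐ[P] optimalWealth P ρ z y₀) ∧
        -- in the Hilbert space `L²(Ω, 𝒢_T, P)` with `α = 1`, `β = ρ`: the inner product formula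
        -- and the orthogonal projection of `0` onto the affine set of feasible wealths
        ∃ α β V : HilbertL2 (observation hS.adapted T) P,
          (α : Lp ℝ 2 P) =ᵐ[P] (fun _ => (1 : ℝ)) ∧
          (β : Lp ℝ 2 P) =ᵐ[P] ρ ∧
          (V : Lp ℝ 2 P) =ᵐ[P] optimalWealth P ρ z y₀ ∧
          V = (inner ℝ α α * inner ℝ β β - inner ℝ α β ^ 2)⁻¹ •
            ((z * inner ℝ β β - y₀ * inner ℝ α β) • α +
              (-z * inner ℝ α β + y₀ * inner ℝ α α) • β) ∧
          ∃ A : AffineSubspace ℝ (HilbertL2 (observation hS.adapted T) P),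
            (A : Set (HilbertL2 (observation hS.adapted T) P)) =
              admissibleClasses (observation hS.adapted T) P ρ z y₀ ∧
            ∃ (_ : Nonempty A) (_ : A.direction.HasOrthogonalProjection),
              ((EuclideanGeometry.orthogonalProjection A 0 : A) :
                HilbertL2 (observation hS.adapted T) P) = V := by
  have hA : MeasurableSet (μ ⁻¹' {a}) := F.le 0 _ (hμ.measurable (measurableSet_singleton a))
  refine ⟨?_, fun π hπ => ?_⟩
  · obtain ⟨π, hπm, hπ⟩ := exists_measurable_condProb (P := P) (G := observation hS.adapted) hA
    exact ⟨π, hπm, fun t _ => hπ t⟩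
  have h := hS.partialObservation hW hs₀ hμ hμab hπ
  refine ⟨?_, fun ρ hρ => ?_⟩
  · obtain ⟨I, hI⟩ := h.exists_isItoIntegral_innovation (b - r) (a - b)
    exact ⟨_, I, hI, rfl⟩
  have hm := h.aestronglyMeasurable_statePriceDensity hρ
  have hL := h.memLp_statePriceDensity hρ
  have hv := h.variance_statePriceDensity_pos hab hT hμ_pos hμ_lt hρ
  exact ⟨hm, hL, hv, optimalWealth_mem_admissible hm hL hv,
    fun w hw => integral_optimalWealth_sub_sq_le hm hL hv hw,
    fun w hw hle => ae_eq_optimalWealth_of_le hm hL hv hw hle,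
    exists_hilbertL2_optimalWealth hm hL hv⟩
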